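/- Let $\mathbb T^2$ be the unit two-dimensional flat torus with coordinates $(x,z)$, and let $\nu,\varepsilon_1,\varepsilon_2>0$. Consider the damped hydrostatic Navier–Stokes system $$u_t-\nu u_{zz}+uu_x+wu_z+\varepsilon_1u+p_x=0,\qquad \varepsilon_2w+p_z=0,\qquad u_x+w_z=0, \tag{1}$$ and, for $0<\alpha\le 1$, its Voigt regularization $$(u^\alpha-\alpha^2u^\alpha_{zz})_t-\nu u^\alpha_{zz}+u^\alpha u^\alpha_x+w^\alpha u^\alpha_z+\varepsilon_1u^\alpha+p^\alpha_x=0,\qquad \varepsilon_2w^\alpha+p^\alpha_z=0,\qquad u^\alpha_x+w^\alpha_z=0, \tag{2}$$ on $\mathbb T^2$, with $u,w,p$ (and $u^\alpha,w^\alpha,p^\alpha$) of period 1 in $x$ and $z$, $u,p$ even and $w$ odd in $z$. Here $w$ and $p_x$ are determined by $u$ through $$w(x,z)=-\int_0^zu_x(x,s)\,ds,\qquad p_x(x,z)=\varepsilon_2\int_0^z\!\!\int_0^su_{xx}(x,\sigma)\,d\sigma ds+\int_0^1\Big[-\varepsilon_2\int_0^{z'}\!\!\int_0^su_{xx}(x,\sigma)\,d\sigma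 ds-2uu_x(x,z')\Big]dz',$$ and similarly for $w^\alpha,p^\alpha_x$; periodicity of $w$ means $\int_0^1u_x\,dz=0$. A strong solution of (1) on $[0,\mathcal T]$ with initial data $u_0$ is a function $u$ with these symmetries such that $u\in L^\infty(0,\mathcal T;H^1)\cap L^2(0,\mathcal T;H^2)\cap C([0,\mathcal T];L^2)\cap L^\infty(0,\mathcal T;L^\infty)$, $u_z\in L^2(0,\mathcal T;L^\infty)$, $u_{xz}\in L^\infty(0,\mathcal T;L^2)$, $u_{xzz}\in L^2(0,\mathcal T;L^2)$, $\partial_tu\in L^2(0,\mathcal T;L^2)$, $u(0)=u_0$, and the first equation of (1) holds in $L^2(0,\mathcal T;L^2)$. A strong solution of (2) on $[0,\mathcal T]$ with initial data $u^\alpha_0$ is a function $u^\alpha$ with these symmetries such that $u^\alpha\in L^\infty(0,\mathcal T;H^1)\cap C([0,\mathcal T];L^2)$, $u^\alpha_z\in L^\infty(0,\mathcal T;H^1)$, $\partial_tu^\alpha\in L^2(0,\mathcal T;L^2)$, $u^\alpha(0)=u^\alpha_0$, and the first equation of (2) holds, where $(u^\alpha-\alpha^2u^\alpha_{zz})_t$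 and $p^\alpha_x$ are understood as distributions on $(0,\mathcal T)\times\mathbb T^2$ (whose sum is then in $L^2(0,\mathcal T;L^2)$). **Theorem.** Suppose that $u_0$ and $\{u_0^\alpha\}_{0<\alpha\le1}$ belong to $H^1(\mathbb T^2)$ and are even in $z$, that $\int_0^1\partial_xu_0\,dz=0$ and $\int_0^1\partial_xu_0^\alpha\,dz=0$ for all $0<\alpha\le1$, that $\partial^2_{xz}u_0\in L^2(\mathbb T^2)$, and that $\partial_zu_0^\alpha\in H^1(\mathbb T^2)$ for all $0<\alpha\le 1$. Suppose moreover that for some constant $M$ $$\sup_{0<\alpha\le1}\Big(\|u_0^\alpha\|_{L^2}+\|\partial_zu_0^\alpha\|_{L^2}+\alpha\|\partial^2_{zz}u_0^\alpha\|_{L^2}\Big)\le M.$$ Let $\mathcal T>0$ be such that $u$ is a strong solution of (1) on $[0,\mathcal T]$ with initial data $u_0$, and for $0<\alpha\le1$ let $u^\alpha$ be a strong solution of (2) on $[0,\mathcal T]$ with initial data $u_0^\alpha$. If $u_0^\alpha\to u_0$ in $L^2$ as $\alpha\to0^+$, then $u^\alpha\to u$ in $L^\infty(0,\mathcal T;L^2)$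 and $u^\alpha_z\to u_z$ in $L^2(0,\mathcal T;L^2)$ as $\alpha\to0^+$. -/

import Mathlib

open MeasureTheory Set Filter Topology
open scoped ENNReal ContDiff

noncomputable section

namespace HNS

/-! ### The torus and its function spaces -/

/-- The unit two-dimensional flat torus, with coordinates `(x, z)`, each of period 1. Its `volume`
is the product of the two probability Haar measures, that is, `dx dz` on a unit cell. -/
abbrev Torus : Type := UnitAddCircle × UnitAddCircle

/-- The Hilbert space `L²(𝕋²)` of real functions. -/
abbrev L2 : Type := Lp ℝ 2 (volume : Measure Torus)

/-- Smoothness of a function on the torus: its periodic lift to `ℝ²` is `C^∞`. -/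
def IsSmooth (φ : Torus → ℝ) : Prop :=
  ContDiff ℝ ∞ (fun q : ℝ × ℝ => φ ((q.1 : UnitAddCircle), (q.2 : UnitAddCircle)))

/-- The classical derivative `∂φ/∂x` of a function on the torus. -/
def dX (φ : Torus → ℝ) (ξ : Torus) : ℝ :=
  deriv (fun h : ℝ => φ (ξ.1 + (h : UnitAddCircle), ξ.2)) 0

/-- The classical derivative `∂φ/∂z` of a function on the torus. -/
def dZ (φ : Torus → ℝ) (ξ : Torus) : ℝ :=
  deriv (fun h : ℝ => φ (ξ.1, ξ.2 + (h : UnitAddCircle))) 0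

/-- `g ∈ L²` is the weak derivative `∂f/∂x` of `f ∈ L²` on the torus. -/
def HasWeakDx (f g : L2) : Prop :=
  ∀ φ : Torus → ℝ, IsSmooth φ → ∫ ξ, f ξ * dX φ ξ = - ∫ ξ, g ξ * φ ξ

/-- `g ∈ L²` is the weak derivative `∂f/∂z` of `f ∈ L²` on the torus. -/
def HasWeakDz (f g : L2) : Prop :=
  ∀ φ : Torus → ℝ, IsSmooth φ → ∫ ξ, f ξ * dZ φ ξ = - ∫ ξ, g ξ * φ ξ

/-- The weak derivative `∂f/∂x` exists in `L²`. -/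
def DxInL2 (f : L2) : Prop := ∃ g, HasWeakDx f g

/-- The weak derivative `∂f/∂z` exists in `L²`. -/
def DzInL2 (f : L2) : Prop := ∃ g, HasWeakDz f g

open Classical in
/-- The weak derivative `∂f/∂x`. The value `0` where it does not exist in `L²` is never used: each
condition below on `Dx f` comes with `DxInL2 f`. -/
def Dx (f : L2) : L2 := if h : DxInL2 f then h.choose else 0

open Classical in
/-- The weak derivative `∂f/∂z`, with the same convention. -/
def Dz (f : L2) : L2 := if h : DzInL2 f then h.choose else 0

/-- `f ∈ H¹(𝕋²)`. -/
def MemH1 (f : L2) : Prop := DxInL2 f ∧ DzInL2 f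

/-- `f` is even in `z`. -/
def EvenZ (f : L2) : Prop := ∀ᵐ ξ : Torus, f (ξ.1, -ξ.2) = f ξ

/-- The compatibility condition `∫₀¹ ∂ₓf(x,z) dz = 0` for almost every `x`. -/
def ZeroMeanDx (f : L2) : Prop := ∀ᵐ x : UnitAddCircle, ∫ z : UnitAddCircle, Dx f (x, z) = 0

/-! ### Functions of time with values in function spaces -/

/-- `v ∈ L^p(0,T; L²)`. -/
def LpL2 (T : ℝ) (p : ℝ≥0∞) (v : ℝ → L2) : Prop := MemLp v p (volume.restrict (Ioo 0 T))

/-- `∂v/∂x ∈ L^p(0,T; L²)`. -/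
def DxLpL2 (T : ℝ) (p : ℝ≥0∞) (v : ℝ → L2) : Prop :=
  (∀ᵐ t ∂(volume.restrict (Ioo 0 T)), DxInL2 (v t)) ∧ LpL2 T p (fun t => Dx (v t))

/-- `∂v/∂z ∈ L^p(0,T; L²)`. -/
def DzLpL2 (T : ℝ) (p : ℝ≥0∞) (v : ℝ → L2) : Prop :=
  (∀ᵐ t ∂(volume.restrict (Ioo 0 T)), DzInL2 (v t)) ∧ LpL2 T p (fun t => Dz (v t))

/-- `v ∈ L^p(0,T; H¹)`. -/
def LpH1 (T : ℝ) (p : ℝ≥0∞) (v : ℝ → L2) : Prop :=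
  LpL2 T p v ∧ DxLpL2 T p v ∧ DzLpL2 T p v

/-- `v ∈ L^p(0,T; H²)`. -/
def LpH2 (T : ℝ) (p : ℝ≥0∞) (v : ℝ → L2) : Prop :=
  LpH1 T p v ∧ LpH1 T p (fun t => Dx (v t)) ∧ LpH1 T p (fun t => Dz (v t))

/-- `v ∈ L^p(0,T; L^∞)` for a measurable `v` with values in `L²`: the norm `‖v(t)‖_{L^∞}` is in
`L^p(0,T)`. -/
def LpLinf (T : ℝ) (p : ℝ≥0∞) (v : ℝ → L2) : Prop :=
  AEStronglyMeasurable v (volume.restrict (Ioo 0 T)) ∧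
    eLpNorm (fun t => eLpNorm (v t) ⊤ (volume : Measure Torus)) p
      (volume.restrict (Ioo 0 T)) < ⊤

/-- Test functions of time: `η ∈ C_c^∞(0,T)`. -/
def IsTimeTest (T : ℝ) (η : ℝ → ℝ) : Prop :=
  ContDiff ℝ ∞ η ∧ HasCompactSupport η ∧ tsupport η ⊆ Ioo 0 T

/-- `g` is the weak time derivative of `v` on `(0,T)`, as functions with values in `L²`. -/
def HasWeakDt (T : ℝ) (v g : ℝ → L2) : Prop :=
  ∀ η : ℝ → ℝ, IsTimeTest T η →
    ∫ t in Ioo 0 T, deriv η t • v t = - ∫ t in Ioo 0 T, η t • g t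

/-! ### Vertical velocity and pressure -/

/-- The representative in `[0,1)` of a point of the circle. -/
def rep (z : UnitAddCircle) : ℝ := (AddCircle.equivIco 1 0 z : ℝ)

/-- The vertical primitive `∫₀ᶻ f(x,s) ds`, with `0 ≤ z < 1`. -/
def primZ (f : Torus → ℝ) (ξ : Torus) : ℝ :=
  ∫ s in (0 : ℝ)..(rep ξ.2), f (ξ.1, (s : UnitAddCircle))

/-- The vertical velocity `w(x,z) = -∫₀ᶻ uₓ(x,s) ds`. -/
def vertVel (f : L2) (ξ : Torus) : ℝ := - primZ (Dx f) ξ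

/-- The pressure gradient
`pₓ(x,z) = ε₂ ∫₀ᶻ∫₀ˢ uₓₓ(x,σ) dσ ds + ∫₀¹ [-ε₂ ∫₀^{z'}∫₀ˢ uₓₓ(x,σ) dσ ds - 2 u uₓ(x,z')] dz'`,
for `u` with `uₓₓ ∈ L²`. -/
def pressureX (ε₂ : ℝ) (f : L2) (ξ : Torus) : ℝ :=
  ε₂ * primZ (primZ (Dx (Dx f))) ξ +
    ∫ z' : UnitAddCircle,
      (- ε₂ * primZ (primZ (Dx (Dx f))) (ξ.1, z') - 2 * f (ξ.1, z') * Dx f (ξ.1, z'))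

/-- The pressure
`p(x,z) = ε₂ ∫₀ᶻ∫₀ˢ uₓ(x,σ) dσ ds + ∫₀¹ [-ε₂ ∫₀^{z'}∫₀ˢ uₓ(x,σ) dσ ds - u²(x,z')] dz'`
(up to an additive constant). Its distributional `x`-derivative is the `pₓ` of `pressureX`, and
makes sense without `uₓₓ ∈ L²`. -/
def pressure (ε₂ : ℝ) (f : L2) (ξ : Torus) : ℝ :=
  ε₂ * primZ (primZ (Dx f)) ξ +
    ∫ z' : UnitAddCircle, (- ε₂ * primZ (primZ (Dx f)) (ξ.1, z') - f (ξ.1, z') ^ 2)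

/-! ### Strong solutions -/

/-- `u` is a strong solution on `[0,T]` of the damped hydrostatic Navier–Stokes system
`u_t - ν u_zz + u uₓ + w u_z + ε₁ u + pₓ = 0`, `ε₂ w + p_z = 0`, `uₓ + w_z = 0`,
with initial value `u₀`. -/
structure IsStrongSolution (ν ε₁ ε₂ T : ℝ) (u₀ : L2) (u : ℝ → L2) : Prop where
  even : ∀ t ∈ Icc 0 T, EvenZ (u t)
  /-- `w` is periodic in `z`, that is, `w(x,1) = 0`. -/
  zeroMean : ∀ᵐ t ∂(volume.restrict (Ioo 0 T)), ZeroMeanDx (u t)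
  memLinftyH1 : LpH1 T ⊤ u
  memL2H2 : LpH2 T 2 u
  continuousOn : ContinuousOn u (Icc 0 T)
  memLinftyLinfty : LpLinf T ⊤ u
  dz_memL2Linfty : LpLinf T 2 (fun t => Dz (u t))
  dxz_memLinftyL2 : DzLpL2 T ⊤ (fun t => Dx (u t))
  dxzz_memL2L2 : DzLpL2 T 2 (fun t => Dz (Dx (u t)))
  /-- `∂ₜu ∈ L²(0,T; L²)`, and the momentum equation holds almost everywhere. -/
  equation : ∃ ut : ℝ → L2, LpL2 T 2 ut ∧ HasWeakDt T u ut ∧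
    ∀ᵐ t ∂(volume.restrict (Ioo 0 T)), ∀ᵐ ξ : Torus,
      ut t ξ - ν * Dz (Dz (u t)) ξ + u t ξ * Dx (u t) ξ + vertVel (u t) ξ * Dz (u t) ξ
        + ε₁ * u t ξ + pressureX ε₂ (u t) ξ = 0
  initial : u 0 = u₀

/-- `u` is a strong solution on `[0,T]` of the Voigt-regularized system
`(u - α² u_zz)_t - ν u_zz + u uₓ + w u_z + ε₁ u + pₓ = 0`, `ε₂ w + p_z = 0`, `uₓ + w_z = 0`,
with initial value `u₀`. -/
structure IsVoigtStrongSolution (ν ε₁ ε₂ α T : ℝ) (u₀ : L2) (u : ℝ → L2) : Prop where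
  even : ∀ t ∈ Icc 0 T, EvenZ (u t)
  /-- `w` is periodic in `z`, that is, `w(x,1) = 0`. -/
  zeroMean : ∀ᵐ t ∂(volume.restrict (Ioo 0 T)), ZeroMeanDx (u t)
  memLinftyH1 : LpH1 T ⊤ u
  continuousOn : ContinuousOn u (Icc 0 T)
  dz_memLinftyH1 : LpH1 T ⊤ (fun t => Dz (u t))
  dt_memL2L2 : ∃ ut : ℝ → L2, LpL2 T 2 ut ∧ HasWeakDt T u ut
  /-- The momentum equation. In this regularity class `(u - α² u_zz)_t` and `pₓ` are distributional
  derivatives, and the equation identifies their sum with a function in `L²(0,T; L²)`. It is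
  tested with the functions `η(t) φ(x,z)`. -/
  equation : ∀ η : ℝ → ℝ, IsTimeTest T η → ∀ φ : Torus → ℝ, IsSmooth φ →
    ∫ t in Ioo 0 T,
      (- deriv η t * (∫ ξ, (u t ξ - α ^ 2 * Dz (Dz (u t)) ξ) * φ ξ)
        + η t * ((∫ ξ, (- ν * Dz (Dz (u t)) ξ + u t ξ * Dx (u t) ξ
              + vertVel (u t) ξ * Dz (u t) ξ + ε₁ * u t ξ) * φ ξ)
            - ∫ ξ, pressure ε₂ (u t) ξ * dX φ ξ)) = 0
  initial : u 0 = u₀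

end HNS

end

noncomputable section

namespace HNS

/-! ### Fourier series on the torus -/

/-! Write U for the Voigt solution, W for its vertical velocity, w for that of u, and v = U - u. Two
things obstruct the plain energy estimate for v: the time derivative of U_zz is only a distribution,
and no bound on the horizontal derivatives of U that is uniform in α is at hand.

The first obstacle is met by a modulated energy. With L = 1 - α²∂_zz, take ½⟨LU,U⟩ - ⟨LU,u⟩ + ½‖u‖²,
which equals ½‖v‖² + α²(½‖U_z‖² + ⟨U_zz,u⟩). Its time derivative involves only (LU)_t and u_t, both
of which the equations provide; the price is the term α²⟨U_zz,u_t⟩. Testing the Voigt equation with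
U_zz, the nonlinearity cancels (`nonlinear_inner_zz`) and viscosity, damping and pressure all have
the good sign, so ‖U_z‖² + α²‖U_zz‖² stays below its initial value
(`IsVoigtStrongSolution.dz_energy_le`). Hence ‖U_zz‖ ≤ M/α, and the error terms carrying α² are
O(α).

The second obstacle is met by skew-symmetry of transport by (U,W): the difference of the nonlinear
terms tested with v is ⟨v u_x, v⟩ + ⟨v u_z, W - w⟩ (`nonlinear_sub_inner`), where all horizontal
derivatives fall on u. The anisotropic inequality ‖fh‖² ≤ (‖f‖² + 2‖f‖‖f_z‖)(‖h‖² + 2‖h‖‖h_x‖), with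
f = v, bounds both terms by v, v_z and norms of u. Viscosity absorbs v_z, and the pressure
difference contributes exactly ε₂‖W - w‖² (`inner_pressure_eq`), which absorbs W - w. What remains
is a coefficient times ‖v‖² that is integrable in time because u is in L²(0,T;H²), so Grönwall's
inequality gives a bound by ‖v(0)‖² plus O(α) (`IsStrongSolution.stability`).

The identities are justified on the Fourier side. Each coefficient obeys a scalar equation in time,
its quadratic expressions are integrated as products of absolutely continuous functions, and the sum
over frequencies is taken by dominated convergence. In frequency space w is -(k₁/k₂)u and p_x is
ε₂(k₁/k₂)²u, apart from the frequencies k₂ = 0, k₁ ≠ 0, which incompressibility removes from u. -/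

/-- The Fourier monomial `exp (2πi (k₁ x + k₂ z))`. -/
def expo (k : ℤ × ℤ) : C(Torus, ℂ) where
  toFun ξ := fourier k.1 ξ.1 * fourier k.2 ξ.2

theorem expo_apply (k : ℤ × ℤ) (ξ : Torus) : expo k ξ = fourier k.1 ξ.1 * fourier k.2 ξ.2 := rfl

theorem expo_add (k l : ℤ × ℤ) (ξ : Torus) : expo (k + l) ξ = expo k ξ * expo l ξ := by
  simp only [expo_apply, Prod.fst_add, Prod.snd_add, fourier_add]; ring

theorem expo_neg (k : ℤ × ℤ) (ξ : Torus) : expo (-k) ξ = starRingEnd ℂ (expo k ξ) := by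
  simp only [expo_apply, Prod.fst_neg, Prod.snd_neg, fourier_neg, map_mul]

theorem integral_fourier_circle (n : ℤ) :
    ∫ x : UnitAddCircle, (fourier n x : ℂ) = if n = 0 then 1 else 0 := by
  have h := orthonormal_iff_ite.1 (orthonormal_fourier (T := 1)) 0 n
  rw [ContinuousMap.inner_toLp, AddCircle.integral_haarAddCircle] at h
  simpa [← fourier_neg, ← fourier_add, eq_comm] using h

theorem integral_expo (k : ℤ × ℤ) : ∫ ξ : Torus, expo k ξ = if k = 0 then 1 else 0 := by
  simp only [expo_apply]
  rw [show (volume : Measure Torus) = (volume : Measure UnitAddCircle).prod volume from rfl,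
    integral_prod_mul (fun x => (fourier k.1 x : ℂ)) (fun z => (fourier k.2 z : ℂ)),
    integral_fourier_circle, integral_fourier_circle]
  by_cases h1 : k.1 = 0 <;> by_cases h2 : k.2 = 0 <;> simp [h1, h2, Prod.ext_iff]

/-- The star subalgebra of `C(𝕋², ℂ)` generated by the Fourier monomials. -/
def expoSubalgebra : StarSubalgebra ℂ C(Torus, ℂ) where
  toSubalgebra := Algebra.adjoin ℂ (range expo)
  star_mem' := by
    change Algebra.adjoin ℂ (range expo) ≤ star (Algebra.adjoin ℂ (range expo))
    refine Algebra.adjoin_le ?_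
    rintro _ ⟨n, rfl⟩
    refine Algebra.subset_adjoin ⟨-n, ?_⟩
    ext1 x
    simp only [expo_neg, starRingEnd_apply, ContinuousMap.star_apply]

theorem expoSubalgebra_coe :
    Subalgebra.toSubmodule expoSubalgebra.toSubalgebra = Submodule.span ℂ (range expo) := by
  apply Algebra.adjoin_eq_span_of_subset
  refine .trans (fun x ↦ Submonoid.closure_induction (fun _ ↦ id) ⟨0, ?_⟩ ?_)
    Submodule.subset_span
  · ext z
    simp [expo_apply]
  · rintro _ _ _ _ ⟨m, rfl⟩ ⟨n, rfl⟩
    exact ⟨m + n, by ext z; exact expo_add m n z⟩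

theorem expoSubalgebra_separatesPoints : expoSubalgebra.SeparatesPoints := by
  intro x y hxy
  have key : ∀ k : ℤ × ℤ, expo k x ≠ expo k y →
      ∃ f ∈ ((fun f : C(Torus, ℂ) => (f : Torus → ℂ)) '' (expoSubalgebra : Set C(Torus, ℂ))),
        f x ≠ f y := fun k hk =>
    ⟨_, ⟨expo k, Algebra.subset_adjoin ⟨k, rfl⟩, rfl⟩, hk⟩
  by_cases h1 : x.1 = y.1
  · have h2 : x.2 ≠ y.2 := fun h => hxy (Prod.ext h1 h)
    refine key (0, 1) fun h => h2 ?_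
    simp only [expo_apply, fourier_zero, fourier_one, one_mul] at h
    exact AddCircle.injective_toCircle one_ne_zero (Subtype.coe_inj.1 h)
  · refine key (1, 0) fun h => h1 ?_
    simp only [expo_apply, fourier_zero, fourier_one, mul_one] at h
    exact AddCircle.injective_toCircle one_ne_zero (Subtype.coe_inj.1 h)

/-- Stone–Weierstrass: the span of the monomials is a star subalgebra, and the monomials (1,0) and
(0,1) already separate points. -/
theorem span_expo_closure_eq_top : (Submodule.span ℂ (range expo)).topologicalClosure = ⊤ := by
  rw [← expoSubalgebra_coe]
  exact congr_arg (Subalgebra.toSubmodule <| StarSubalgebra.toSubalgebra ·)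
    (ContinuousMap.starSubalgebra_topologicalClosure_eq_top_of_separatesPoints _
      expoSubalgebra_separatesPoints)

/-- The Fourier monomials as elements of the complex `L²` space. -/
def expoLp (k : ℤ × ℤ) : Lp ℂ 2 (volume : Measure Torus) :=
  ContinuousMap.toLp (E := ℂ) 2 volume ℂ (expo k)

theorem span_expoLp_closure_eq_top :
    (Submodule.span ℂ (range expoLp)).topologicalClosure = ⊤ := by
  have h := (ContinuousMap.toLp_denseRange ℂ (volume : Measure Torus) ℂ (p := 2)
    (by simp)).topologicalClosure_map_submodule span_expo_closure_eq_top
  rw [Submodule.map_span, ← range_comp] at h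
  exact h

theorem orthonormal_expoLp : Orthonormal ℂ expoLp := by
  rw [orthonormal_iff_ite]
  intro m n
  simp only [expoLp, ContinuousMap.inner_toLp, ← expo_neg, ← expo_add, integral_expo]
  have : -m + n = 0 ↔ m = n := by rw [neg_add_eq_zero]
  have : n + -m = 0 ↔ m = n := by rw [add_neg_eq_zero, eq_comm]
  simp [*]

/-- The Hilbert basis of Fourier monomials. -/
def expoBasis : HilbertBasis (ℤ × ℤ) ℂ (Lp ℂ 2 (volume : Measure Torus)) :=
  HilbertBasis.mk orthonormal_expoLp span_expoLp_closure_eq_top.ge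

/-- `cos (2π (k₁ x + k₂ z))`. -/
def cs (k : ℤ × ℤ) : C(Torus, ℝ) := ⟨fun ξ => (expo k ξ).re, by fun_prop⟩

/-- `sin (2π (k₁ x + k₂ z))`. -/
def sn (k : ℤ × ℤ) : C(Torus, ℝ) := ⟨fun ξ => (expo k ξ).im, by fun_prop⟩

theorem cs_apply (k : ℤ × ℤ) (ξ : Torus) : cs k ξ = (expo k ξ).re := rfl

theorem sn_apply (k : ℤ × ℤ) (ξ : Torus) : sn k ξ = (expo k ξ).im := rfl

/-- The cosine as an element of `L²`. -/
def csL (k : ℤ × ℤ) : L2 := ContinuousMap.toLp (E := ℝ) 2 volume ℝ (cs k)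

/-- The sine as an element of `L²`. -/
def snL (k : ℤ × ℤ) : L2 := ContinuousMap.toLp (E := ℝ) 2 volume ℝ (sn k)

theorem coeFn_csL (k : ℤ × ℤ) : csL k =ᵐ[volume] cs k := ContinuousMap.coeFn_toLp volume _

theorem coeFn_snL (k : ℤ × ℤ) : snL k =ᵐ[volume] sn k := ContinuousMap.coeFn_toLp volume _

/-- The cosine coefficient of a function in `L²`. -/
def ca (k : ℤ × ℤ) : L2 →L[ℝ] ℝ := innerSL ℝ (csL k)

/-- The sine coefficient of a function in `L²`. -/
def sb (k : ℤ × ℤ) : L2 →L[ℝ] ℝ := innerSL ℝ (snL k)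

theorem inner_eq_integral (f g : L2) : inner ℝ f g = ∫ ξ, f ξ * g ξ := by
  rw [L2.inner_def]
  exact integral_congr_ae (Eventually.of_forall fun ξ => by simp [mul_comm])

theorem ca_eq (k : ℤ × ℤ) (f : L2) : ca k f = ∫ ξ, f ξ * cs k ξ := by
  rw [ca, innerSL_apply_apply, inner_eq_integral]
  refine integral_congr_ae ?_
  filter_upwards [coeFn_csL k] with ξ h
  rw [h, mul_comm]

theorem sb_eq (k : ℤ × ℤ) (f : L2) : sb k f = ∫ ξ, f ξ * sn k ξ := by
  rw [sb, innerSL_apply_apply, inner_eq_integral]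
  refine integral_congr_ae ?_
  filter_upwards [coeFn_snL k] with ξ h
  rw [h, mul_comm]

theorem integrable_mul_L2 (f g : L2) : Integrable (fun ξ => f ξ * g ξ) volume :=
  (Lp.memLp f).integrable_mul (Lp.memLp g)

theorem integrable_mul_cs (f : L2) (k : ℤ × ℤ) : Integrable (fun ξ => f ξ * cs k ξ) volume := by
  refine (integrable_mul_L2 f (csL k)).congr ?_
  filter_upwards [coeFn_csL k] with ξ h
  rw [h]

theorem integrable_mul_sn (f : L2) (k : ℤ × ℤ) : Integrable (fun ξ => f ξ * sn k ξ) volume := by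
  refine (integrable_mul_L2 f (snL k)).congr ?_
  filter_upwards [coeFn_snL k] with ξ h
  rw [h]

/-- The Fourier series of a real function in `L²`. -/
theorem hasSum_fourier (f : L2) :
    HasSum (fun k => ca k f • csL k + sb k f • snL k) f := by
  have h := expoBasis.hasSum_repr (Complex.ofRealCLM.compLp f)
  have h2 := (h.map (Complex.reCLM.compLpL 2 (volume : Measure Torus)) (ContinuousLinearMap.continuous _))
  have e1 : Complex.reCLM.compLpL 2 (volume : Measure Torus) (Complex.ofRealCLM.compLp f) = f := by
    apply Lp.ext
    filter_upwards [Complex.reCLM.coeFn_compLpL (Complex.ofRealCLM.compLp f),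
      Complex.ofRealCLM.coeFn_compLp f] with ξ h1 h2
    rw [h1, h2]; simp
  rw [e1] at h2
  convert h2 using 1
  funext k
  -- The complex coefficient is a - ib, and the real part of (a - ib)(cos + i sin) is a cos + b sin.
  -- So the real part of the complex expansion is the claimed series.
  have e2 : expoBasis.repr (Complex.ofRealCLM.compLp f) k = (ca k f : ℂ) - Complex.I * sb k f := by
    rw [expoBasis.repr_apply_apply, expoBasis, HilbertBasis.coe_mk, L2.inner_def, ca_eq, sb_eq,
      ← integral_complex_ofReal, ← integral_complex_ofReal, ← integral_const_mul,
      ← integral_sub]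
    · refine integral_congr_ae ?_
      filter_upwards [Complex.ofRealCLM.coeFn_compLp f,
        ContinuousMap.coeFn_toLp (𝕜 := ℂ) (p := 2) (volume : Measure Torus) (expo k)] with ξ h1 h2
      rw [h1, expoLp, h2, cs_apply, sn_apply]
      apply Complex.ext <;> simp [mul_comm]
    · exact (integrable_mul_cs f k).ofReal
    · exact ((integrable_mul_sn f k).ofReal).const_mul _
  apply Lp.ext
  simp only [Function.comp_apply, e2]
  filter_upwards [Complex.reCLM.coeFn_compLpL (((ca k f : ℂ) - Complex.I * sb k f) • expoBasis k),
    Lp.coeFn_smul ((ca k f : ℂ) - Complex.I * sb k f) (expoBasis k),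
    Lp.coeFn_add (ca k f • csL k) (sb k f • snL k), Lp.coeFn_smul (ca k f) (csL k),
    Lp.coeFn_smul (sb k f) (snL k), coeFn_csL k, coeFn_snL k,
    ContinuousMap.coeFn_toLp (𝕜 := ℂ) (p := 2) (volume : Measure Torus) (expo k)]
    with ξ h1 h2 h3 h4 h5 h6 h7 h8
  rw [h1, h2, h3, Pi.add_apply, h4, h5, Pi.smul_apply, Pi.smul_apply, h6, h7, Pi.smul_apply,
    expoBasis, HilbertBasis.coe_mk, expoLp, h8, cs_apply, sn_apply]
  simp

/-- The contribution of the frequency `k` to the scalar product of `L²`. -/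
def dot (k : ℤ × ℤ) (f g : L2) : ℝ := ca k f * ca k g + sb k f * sb k g

/-- Parseval. The sum runs over k and -k alike and both give the same term, which is why the real
series, although redundant, carries no factor 2. -/
theorem hasSum_dot (f g : L2) : HasSum (fun k => dot k f g) (inner ℝ f g) := by
  have h := (hasSum_fourier f).mapL (innerSL ℝ g)
  rw [innerSL_apply_apply, real_inner_comm] at h
  refine h.congr_fun fun k => ?_
  rw [map_add, map_smul, map_smul, innerSL_apply_apply, innerSL_apply_apply, real_inner_comm,
    real_inner_comm (snL k)]
  rfl

theorem dot_sub_right (k : ℤ × ℤ) (f g h : L2) : dot k f (g - h) = dot k f g - dot k f h := by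
  simp only [dot, map_sub]; ring

theorem dot_self_nonneg (k : ℤ × ℤ) (f : L2) : 0 ≤ dot k f f := by
  simp only [dot]; nlinarith [sq_nonneg (ca k f), sq_nonneg (sb k f)]

theorem sum_dot_self_le (s : Finset (ℤ × ℤ)) (f : L2) : ∑ k ∈ s, dot k f f ≤ ‖f‖ ^ 2 := by
  rw [← real_inner_self_eq_norm_sq]
  exact sum_le_hasSum s (fun k _ => dot_self_nonneg k f) (hasSum_dot f f)

theorem abs_dot_le (k : ℤ × ℤ) (f g : L2) : |dot k f g| ≤ (dot k f f + dot k g g) / 2 := by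
  simp only [dot]
  rw [abs_le]
  constructor <;>
  nlinarith [sq_nonneg (ca k f - ca k g), sq_nonneg (sb k f - sb k g),
    sq_nonneg (ca k f + ca k g), sq_nonneg (sb k f + sb k g)]

/-- The bound does not depend on the finite set of frequencies. It supplies the dominating function
when sums over frequencies are exchanged with time integrals. -/
theorem abs_sum_dot_le (s : Finset (ℤ × ℤ)) (f g : L2) :
    |∑ k ∈ s, dot k f g| ≤ (‖f‖ ^ 2 + ‖g‖ ^ 2) / 2 := by
  calc |∑ k ∈ s, dot k f g| ≤ ∑ k ∈ s, |dot k f g| := Finset.abs_sum_le_sum_abs _ _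
    _ ≤ ∑ k ∈ s, (dot k f f + dot k g g) / 2 := Finset.sum_le_sum fun k _ => abs_dot_le k f g
    _ = (∑ k ∈ s, dot k f f + ∑ k ∈ s, dot k g g) / 2 := by
      rw [← Finset.sum_div, Finset.sum_add_distrib]
    _ ≤ _ := by have := sum_dot_self_le s f; have := sum_dot_self_le s g; linarith

theorem ext_coeff {f g : L2} (ha : ∀ k, ca k f = ca k g) (hb : ∀ k, sb k f = sb k g) : f = g := by
  refine (hasSum_fourier f).unique ?_
  simp only [ha, hb]
  exact hasSum_fourier g

/-! ### Derivatives of the trigonometric functions -/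

theorem hasDerivAt_expo_x (k : ℤ × ℤ) (ξ : Torus) (h : ℝ) :
    HasDerivAt (fun h : ℝ => expo k (ξ.1 + (h : UnitAddCircle), ξ.2))
      (2 * Real.pi * Complex.I * k.1 * expo k (ξ.1 + (h : UnitAddCircle), ξ.2)) h := by
  have e : ∀ h : ℝ, expo k (ξ.1 + (h : UnitAddCircle), ξ.2)
      = fourier k.1 (h : UnitAddCircle) * expo k ξ := by
    intro h
    simp only [expo_apply, fourier_apply, smul_add, AddCircle.toCircle_add, Circle.coe_mul]
    ring
  simp only [e]
  refine ((hasDerivAt_fourier 1 k.1 h).mul_const (expo k ξ)).congr_deriv ?_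
  push_cast; ring

theorem hasDerivAt_expo_z (k : ℤ × ℤ) (ξ : Torus) (h : ℝ) :
    HasDerivAt (fun h : ℝ => expo k (ξ.1, ξ.2 + (h : UnitAddCircle)))
      (2 * Real.pi * Complex.I * k.2 * expo k (ξ.1, ξ.2 + (h : UnitAddCircle))) h := by
  have e : ∀ h : ℝ, expo k (ξ.1, ξ.2 + (h : UnitAddCircle))
      = fourier k.2 (h : UnitAddCircle) * expo k ξ := by
    intro h
    simp only [expo_apply, fourier_apply, smul_add, AddCircle.toCircle_add, Circle.coe_mul]
    ring
  simp only [e]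
  refine ((hasDerivAt_fourier 1 k.2 h).mul_const (expo k ξ)).congr_deriv ?_
  push_cast; ring

theorem hasDerivAt_re {f : ℝ → ℂ} {f' : ℂ} {x : ℝ} (h : HasDerivAt f f' x) :
    HasDerivAt (fun y => (f y).re) f'.re x := Complex.reCLM.hasFDerivAt.comp_hasDerivAt x h

theorem hasDerivAt_im {f : ℝ → ℂ} {f' : ℂ} {x : ℝ} (h : HasDerivAt f f' x) :
    HasDerivAt (fun y => (f y).im) f'.im x := Complex.imCLM.hasFDerivAt.comp_hasDerivAt x h

theorem hasDerivAt_cs_x (k : ℤ × ℤ) (ξ : Torus) (h : ℝ) :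
    HasDerivAt (fun h : ℝ => cs k (ξ.1 + (h : UnitAddCircle), ξ.2))
      (-(2 * Real.pi * k.1) * sn k (ξ.1 + (h : UnitAddCircle), ξ.2)) h := by
  refine (hasDerivAt_re (hasDerivAt_expo_x k ξ h)).congr_deriv ?_
  simp [sn_apply]

theorem hasDerivAt_sn_x (k : ℤ × ℤ) (ξ : Torus) (h : ℝ) :
    HasDerivAt (fun h : ℝ => sn k (ξ.1 + (h : UnitAddCircle), ξ.2))
      (2 * Real.pi * k.1 * cs k (ξ.1 + (h : UnitAddCircle), ξ.2)) h := by
  refine (hasDerivAt_im (hasDerivAt_expo_x k ξ h)).congr_deriv ?_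
  simp [cs_apply]

theorem hasDerivAt_cs_z (k : ℤ × ℤ) (ξ : Torus) (h : ℝ) :
    HasDerivAt (fun h : ℝ => cs k (ξ.1, ξ.2 + (h : UnitAddCircle)))
      (-(2 * Real.pi * k.2) * sn k (ξ.1, ξ.2 + (h : UnitAddCircle))) h := by
  refine (hasDerivAt_re (hasDerivAt_expo_z k ξ h)).congr_deriv ?_
  simp [sn_apply]

theorem hasDerivAt_sn_z (k : ℤ × ℤ) (ξ : Torus) (h : ℝ) :
    HasDerivAt (fun h : ℝ => sn k (ξ.1, ξ.2 + (h : UnitAddCircle)))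
      (2 * Real.pi * k.2 * cs k (ξ.1, ξ.2 + (h : UnitAddCircle))) h := by
  refine (hasDerivAt_im (hasDerivAt_expo_z k ξ h)).congr_deriv ?_
  simp [cs_apply]

theorem dX_cs (k : ℤ × ℤ) (ξ : Torus) : dX (cs k) ξ = -(2 * Real.pi * k.1) * sn k ξ := by
  simpa [dX] using (hasDerivAt_cs_x k ξ 0).deriv

theorem dX_sn (k : ℤ × ℤ) (ξ : Torus) : dX (sn k) ξ = 2 * Real.pi * k.1 * cs k ξ := by
  simpa [dX] using (hasDerivAt_sn_x k ξ 0).deriv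

theorem dZ_cs (k : ℤ × ℤ) (ξ : Torus) : dZ (cs k) ξ = -(2 * Real.pi * k.2) * sn k ξ := by
  simpa [dZ] using (hasDerivAt_cs_z k ξ 0).deriv

theorem dZ_sn (k : ℤ × ℤ) (ξ : Torus) : dZ (sn k) ξ = 2 * Real.pi * k.2 * cs k ξ := by
  simpa [dZ] using (hasDerivAt_sn_z k ξ 0).deriv

theorem contDiff_expo (k : ℤ × ℤ) :
    ContDiff ℝ ∞ (fun q : ℝ × ℝ => expo k ((q.1 : UnitAddCircle), (q.2 : UnitAddCircle))) := by
  simp only [expo_apply, fourier_coe_apply]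
  have h1 : ContDiff ℝ ∞ (fun q : ℝ × ℝ => ((q.1 : ℝ) : ℂ)) :=
    Complex.ofRealCLM.contDiff.comp contDiff_fst
  have h2 : ContDiff ℝ ∞ (fun q : ℝ × ℝ => ((q.2 : ℝ) : ℂ)) :=
    Complex.ofRealCLM.contDiff.comp contDiff_snd
  fun_prop

theorem isSmooth_cs (k : ℤ × ℤ) : IsSmooth (cs k) := Complex.reCLM.contDiff.comp (contDiff_expo k)

theorem isSmooth_sn (k : ℤ × ℤ) : IsSmooth (sn k) := Complex.imCLM.contDiff.comp (contDiff_expo k)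

/-! ### Weak derivatives in terms of Fourier coefficients -/

/-- The Fourier coefficients of `g` are those of `∂f/∂x`. -/
def IsDx (f g : L2) : Prop :=
  ∀ k : ℤ × ℤ, ca k g = 2 * Real.pi * k.1 * sb k f ∧ sb k g = -(2 * Real.pi * k.1 * ca k f)

/-- The Fourier coefficients of `g` are those of `∂f/∂z`. -/
def IsDz (f g : L2) : Prop :=
  ∀ k : ℤ × ℤ, ca k g = 2 * Real.pi * k.2 * sb k f ∧ sb k g = -(2 * Real.pi * k.2 * ca k f)

/-- Sines and cosines are admissible test functions. This necessary condition is all that is used of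
weak derivatives: it determines the derivative and turns integration by parts into a termwise
identity. -/
theorem HasWeakDx.isDx {f g : L2} (h : HasWeakDx f g) : IsDx f g := by
  intro k
  have h1 := h _ (isSmooth_cs k)
  have h2 := h _ (isSmooth_sn k)
  simp only [dX_cs, dX_sn, mul_left_comm (f _), integral_const_mul, ← ca_eq, ← sb_eq] at h1 h2
  constructor <;> linarith

theorem HasWeakDz.isDz {f g : L2} (h : HasWeakDz f g) : IsDz f g := by
  intro k
  have h1 := h _ (isSmooth_cs k)
  have h2 := h _ (isSmooth_sn k)
  simp only [dZ_cs, dZ_sn, mul_left_comm (f _), integral_const_mul, ← ca_eq, ← sb_eq] at h1 h2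
  constructor <;> linarith

theorem DxInL2.isDx {f : L2} (h : DxInL2 f) : IsDx f (Dx f) := by
  rw [Dx, dif_pos h]; exact h.choose_spec.isDx

theorem DzInL2.isDz {f : L2} (h : DzInL2 f) : IsDz f (Dz f) := by
  rw [Dz, dif_pos h]; exact h.choose_spec.isDz

theorem IsDx.sub {f g f' g' : L2} (h : IsDx f g) (h' : IsDx f' g') : IsDx (f - f') (g - g') := by
  intro k
  simp only [map_sub, (h k).1, (h k).2, (h' k).1, (h' k).2]
  constructor <;> ring

theorem IsDz.sub {f g f' g' : L2} (h : IsDz f g) (h' : IsDz f' g') : IsDz (f - f') (g - g') := by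
  intro k
  simp only [map_sub, (h k).1, (h k).2, (h' k).1, (h' k).2]
  constructor <;> ring

/-- Mixed derivatives commute. -/
theorem IsDx.mixed {f fx fz fzx : L2} (hx : IsDx f fx) (hz : IsDz f fz) (hzx : IsDx fz fzx) :
    IsDz fx fzx := by
  intro k
  simp only [(hx k).1, (hx k).2, (hzx k).1, (hzx k).2, (hz k).1, (hz k).2]
  constructor <;> ring

theorem IsDz.unique {f g g' : L2} (h : IsDz f g) (h' : IsDz f g') : g = g' :=
  ext_coeff (fun k => by rw [(h k).1, (h' k).1]) (fun k => by rw [(h k).2, (h' k).2])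

theorem IsDz.dot_self {f g : L2} (h : IsDz f g) (k : ℤ × ℤ) :
    dot k g g = (2 * Real.pi * k.2) ^ 2 * dot k f f := by
  simp only [dot, (h k).1, (h k).2]; ring

theorem IsDz.inner_left {f fz g gz : L2} (hf : IsDz f fz) (hg : IsDz g gz) :
    inner ℝ fz g = -inner ℝ f gz := by
  refine (hasSum_dot fz g).unique ((hasSum_dot f gz).neg.congr_fun fun k => ?_)
  simp only [dot, (hf k).1, (hf k).2, (hg k).1, (hg k).2]; ring

theorem IsDx.inner_left {f fz g gz : L2} (hf : IsDx f fz) (hg : IsDx g gz) :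
    inner ℝ fz g = -inner ℝ f gz := by
  refine (hasSum_dot fz g).unique ((hasSum_dot f gz).neg.congr_fun fun k => ?_)
  simp only [dot, (hf k).1, (hf k).2, (hg k).1, (hg k).2]; ring

/-! ### Calculus for smooth functions on the torus -/

theorem integrable_of_continuous {X : Type*} [TopologicalSpace X] [CompactSpace X]
    [MeasurableSpace X] [OpensMeasurableSpace X] {μ : Measure X} [IsFiniteMeasureOnCompacts μ]
    {f : X → ℝ} (hf : Continuous f) : Integrable f μ :=
  hf.integrable_of_hasCompactSupport (HasCompactSupport.of_compactSpace f)

theorem volume_torus : (volume : Measure Torus) = (volume : Measure UnitAddCircle).prod volume :=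
  rfl

theorem integral_circle (f : UnitAddCircle → ℝ) : ∫ z, f z = ∫ s in (0 : ℝ)..1, f s := by
  simpa using (UnitAddCircle.intervalIntegral_preimage 0 f).symm

theorem integral_deriv_circle {f f' : UnitAddCircle → ℝ} (hf' : Continuous f')
    (hd : ∀ h : ℝ, HasDerivAt (fun h : ℝ => f h) (f' h) h) : ∫ z, f' z = 0 := by
  rw [integral_circle, intervalIntegral.integral_eq_sub_of_hasDerivAt (fun x _ => hd x)
    (Continuous.intervalIntegrable (by fun_prop) _ _)]
  have : ((1 : ℝ) : UnitAddCircle) = ((0 : ℝ) : UnitAddCircle) := by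
    simp
  rw [this, sub_self]

theorem coe_rep (z : UnitAddCircle) : ((rep z : ℝ) : UnitAddCircle) = z :=
  (AddCircle.equivIco 1 0).symm_apply_apply z

theorem rep_mem (z : UnitAddCircle) : rep z ∈ Ico (0 : ℝ) 1 := by
  have := (AddCircle.equivIco 1 0 z).2
  simpa [rep] using this

/-- One-dimensional Agmon inequality: f(z)² - f(y)² is the integral of 2ff' between y and z, hence
at most twice the integral of |ff'| over the circle; averaging over y gives the claim. -/
theorem sq_le_integral_circle {f f' : UnitAddCircle → ℝ} (hf : Continuous f) (hf' : Continuous f')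
    (hd : ∀ h : ℝ, HasDerivAt (fun h : ℝ => f h) (f' h) h) (z : UnitAddCircle) :
    f z ^ 2 ≤ (∫ y, f y ^ 2) + 2 * ∫ y, |f y * f' y| := by
  set t := rep z with ht
  have hz : z = (t : UnitAddCircle) := (coe_rep z).symm
  have ht01 := rep_mem z
  have c1 : Continuous fun y : ℝ => f y := by fun_prop
  have c2 : Continuous fun y : ℝ => |f y * f' y| := by fun_prop
  have c3 : Continuous fun y : ℝ => 2 * (f y * f' y) := by fun_prop
  set B := ∫ y in (0 : ℝ)..1, |f y * f' y| with hB
  have key : ∀ y ∈ Icc (0 : ℝ) 1, f z ^ 2 ≤ f y ^ 2 + 2 * B := by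
    intro y hy
    have e : ∫ s in y..t, 2 * (f s * f' s) = f t ^ 2 - f y ^ 2 :=
      intervalIntegral.integral_eq_sub_of_hasDerivAt
        (fun s _ => ((hd s).pow 2).congr_deriv (by simp; ring)) (c3.intervalIntegrable _ _)
    have e2 : |∫ s in y..t, 2 * (f s * f' s)| ≤ 2 * B := by
      calc |∫ s in y..t, 2 * (f s * f' s)| = ‖∫ s in y..t, 2 * (f s * f' s)‖ := rfl
        _ ≤ ∫ s in Set.uIoc y t, ‖2 * (f s * f' s)‖ := intervalIntegral.norm_integral_le_integral_norm_uIoc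
        _ ≤ ∫ s in Ioc (0 : ℝ) 1, ‖2 * (f s * f' s)‖ := by
          refine setIntegral_mono_set ?_ ?_ ?_
          · exact (c3.norm.intervalIntegrable 0 1).1
          · exact Eventually.of_forall fun _ => norm_nonneg _
          · refine Filter.Eventually.of_forall fun s hs => ?_
            replace hs : s ∈ Set.uIoc y t := hs
            rw [mem_uIoc] at hs
            obtain hs | hs := hs
            · exact ⟨hy.1.trans_lt hs.1, hs.2.trans ht01.2.le⟩
            · exact ⟨ht01.1.trans_lt hs.1, hs.2.trans hy.2⟩
        _ = 2 * B := by
          rw [hB, intervalIntegral.integral_of_le zero_le_one, ← integral_const_mul]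
          refine integral_congr_ae (Eventually.of_forall fun s => ?_)
          simp [abs_mul]
    rw [e] at e2
    rw [hz]
    have := le_abs_self (f t ^ 2 - f y ^ 2)
    linarith
  have h1 : ∫ _ in (0 : ℝ)..1, f z ^ 2 ≤ ∫ y in (0 : ℝ)..1, (f y ^ 2 + 2 * B) :=
    intervalIntegral.integral_mono_on zero_le_one (by simp)
      (Continuous.intervalIntegrable (by fun_prop) _ _) key
  rw [intervalIntegral.integral_add (Continuous.intervalIntegrable (by fun_prop) _ _) (by simp)] at h1
  simp only [intervalIntegral.integral_const, sub_zero, one_smul] at h1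
  rw [integral_circle, integral_circle]
  exact h1

/-- Smooth functions for which `∂F/∂x = F'` in the classical sense. -/
def ClassicalDx (F F' : C(Torus, ℝ)) : Prop :=
  ∀ (ξ : Torus) (h : ℝ), HasDerivAt (fun h : ℝ => F (ξ.1 + (h : UnitAddCircle), ξ.2))
    (F' (ξ.1 + (h : UnitAddCircle), ξ.2)) h

/-- Smooth functions for which `∂F/∂z = F'` in the classical sense. -/
def ClassicalDz (F F' : C(Torus, ℝ)) : Prop :=
  ∀ (ξ : Torus) (h : ℝ), HasDerivAt (fun h : ℝ => F (ξ.1, ξ.2 + (h : UnitAddCircle)))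
    (F' (ξ.1, ξ.2 + (h : UnitAddCircle))) h

theorem ClassicalDx.mul {F F' G G' : C(Torus, ℝ)} (h : ClassicalDx F F') (h' : ClassicalDx G G') :
    ClassicalDx (F * G) (F' * G + F * G') := fun ξ t => (h ξ t).mul (h' ξ t)

theorem ClassicalDz.mul {F F' G G' : C(Torus, ℝ)} (h : ClassicalDz F F') (h' : ClassicalDz G G') :
    ClassicalDz (F * G) (F' * G + F * G') := fun ξ t => (h ξ t).mul (h' ξ t)

theorem ClassicalDx.integral_eq_zero {F F' : C(Torus, ℝ)} (h : ClassicalDx F F') :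
    ∫ ξ, F' ξ = 0 := by
  rw [volume_torus, integral_prod_symm _ (integrable_of_continuous F'.continuous)]
  have : ∀ z : UnitAddCircle, ∫ x : UnitAddCircle, F' (x, z) = 0 := fun z =>
    integral_deriv_circle (f := fun x => F (x, z)) (by fun_prop)
      (fun t => by simpa using h (0, z) t)
  simp [this]

theorem ClassicalDz.integral_eq_zero {F F' : C(Torus, ℝ)} (h : ClassicalDz F F') :
    ∫ ξ, F' ξ = 0 := by
  rw [volume_torus, integral_prod _ (integrable_of_continuous F'.continuous)]
  have : ∀ x : UnitAddCircle, ∫ z : UnitAddCircle, F' (x, z) = 0 := fun x =>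
    integral_deriv_circle (f := fun z => F (x, z)) (by fun_prop)
      (fun t => by simpa using h (x, 0) t)
  simp [this]

/-- The anisotropic product estimate for smooth functions. -/
theorem integral_sq_mul_sq_le {P Pz Q Qx : C(Torus, ℝ)} (hP : ClassicalDz P Pz)
    (hQ : ClassicalDx Q Qx) :
    ∫ ξ, (P ξ * Q ξ) ^ 2 ≤
      ((∫ ξ, P ξ ^ 2) + 2 * ∫ ξ, |P ξ * Pz ξ|) * ((∫ ξ, Q ξ ^ 2) + 2 * ∫ ξ, |Q ξ * Qx ξ|) := by
  have i1 : Integrable (fun ξ : Torus => P ξ ^ 2) ((volume : Measure UnitAddCircle).prod volume) :=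
    integrable_of_continuous (by fun_prop)
  have i2 : Integrable (fun ξ : Torus => |P ξ * Pz ξ|) ((volume : Measure UnitAddCircle).prod volume) :=
    integrable_of_continuous (by fun_prop)
  have i3 : Integrable (fun ξ : Torus => Q ξ ^ 2) ((volume : Measure UnitAddCircle).prod volume) :=
    integrable_of_continuous (by fun_prop)
  have i4 : Integrable (fun ξ : Torus => |Q ξ * Qx ξ|) ((volume : Measure UnitAddCircle).prod volume) :=
    integrable_of_continuous (by fun_prop)
  -- G bounds P² uniformly in z and depends on x only; K bounds Q² uniformly in x and depends on z
  -- only. The integral of G(x)K(z) therefore factors.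
  let G : UnitAddCircle → ℝ := fun x => (∫ z, P (x, z) ^ 2) + 2 * ∫ z, |P (x, z) * Pz (x, z)|
  let K : UnitAddCircle → ℝ := fun z => (∫ x, Q (x, z) ^ 2) + 2 * ∫ x, |Q (x, z) * Qx (x, z)|
  have hG : Integrable G volume := i1.integral_prod_left.add (i2.integral_prod_left.const_mul 2)
  have hK : Integrable K volume := i3.integral_prod_right.add (i4.integral_prod_right.const_mul 2)
  have eG : ∫ x, G x = (∫ ξ, P ξ ^ 2) + 2 * ∫ ξ, |P ξ * Pz ξ| := by
    rw [integral_add i1.integral_prod_left (i2.integral_prod_left.const_mul 2),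
      integral_const_mul, ← integral_prod _ i1, ← integral_prod _ i2]
    rfl
  have eK : ∫ z, K z = (∫ ξ, Q ξ ^ 2) + 2 * ∫ ξ, |Q ξ * Qx ξ| := by
    rw [integral_add i3.integral_prod_right (i4.integral_prod_right.const_mul 2),
      integral_const_mul, ← integral_prod_symm _ i3, ← integral_prod_symm _ i4]
    rfl
  rw [← eG, ← eK, ← integral_prod_mul, ← volume_torus]
  refine integral_mono (integrable_of_continuous (by fun_prop)) (hG.mul_prod hK) fun ξ => ?_
  have h1 : P ξ ^ 2 ≤ G ξ.1 := sq_le_integral_circle (f := fun z => P (ξ.1, z))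
    (f' := fun z => Pz (ξ.1, z)) (by fun_prop) (by fun_prop)
    (fun t => by simpa using hP (ξ.1, 0) t) ξ.2
  have h2 : Q ξ ^ 2 ≤ K ξ.2 := sq_le_integral_circle (f := fun x => Q (x, ξ.2))
    (f' := fun x => Qx (x, ξ.2)) (by fun_prop) (by fun_prop)
    (fun t => by simpa using hQ (0, ξ.2) t) ξ.1
  simp only [mul_pow]
  exact mul_le_mul h1 h2 (sq_nonneg _) ((sq_nonneg _).trans h1)

/-! ### Truncated Fourier series -/

/-- The partial sum over `s` of the Fourier series of `f`. -/
def truncC (s : Finset (ℤ × ℤ)) (f : L2) : C(Torus, ℝ) :=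
  ∑ k ∈ s, (ca k f • cs k + sb k f • sn k)

/-- A continuous function as an element of `L²`. -/
def toL2 : C(Torus, ℝ) →L[ℝ] L2 := ContinuousMap.toLp (E := ℝ) 2 volume ℝ

theorem coeFn_toL2 (F : C(Torus, ℝ)) : toL2 F =ᵐ[volume] F := ContinuousMap.coeFn_toLp volume _

theorem tendsto_trunc (f : L2) : Tendsto (fun s => toL2 (truncC s f)) atTop (𝓝 f) := by
  have := hasSum_fourier f
  simp only [HasSum] at this
  simpa [truncC, toL2, csL, snL] using this

theorem truncC_apply (s : Finset (ℤ × ℤ)) (f : L2) (ξ : Torus) :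
    truncC s f ξ = ∑ k ∈ s, (ca k f * cs k ξ + sb k f * sn k ξ) := by
  simp [truncC]

theorem IsDx.truncC {f g : L2} (h : IsDx f g) (s : Finset (ℤ × ℤ)) :
    ClassicalDx (truncC s f) (truncC s g) := by
  intro ξ t
  simp only [truncC_apply]
  refine HasDerivAt.fun_sum fun k _ => ?_
  refine (((hasDerivAt_cs_x k ξ t).const_mul (ca k f)).add
    ((hasDerivAt_sn_x k ξ t).const_mul (sb k f))).congr_deriv ?_
  rw [(h k).1, (h k).2]; ring

theorem IsDz.truncC {f g : L2} (h : IsDz f g) (s : Finset (ℤ × ℤ)) :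
    ClassicalDz (truncC s f) (truncC s g) := by
  intro ξ t
  simp only [truncC_apply]
  refine HasDerivAt.fun_sum fun k _ => ?_
  refine (((hasDerivAt_cs_z k ξ t).const_mul (ca k f)).add
    ((hasDerivAt_sn_z k ξ t).const_mul (sb k f))).congr_deriv ?_
  rw [(h k).1, (h k).2]; ring

theorem ca_toL2 (k : ℤ × ℤ) (F : C(Torus, ℝ)) : ca k (toL2 F) = ∫ ξ, F ξ * cs k ξ := by
  rw [ca_eq]
  exact integral_congr_ae (by filter_upwards [coeFn_toL2 F] with ξ h; rw [h])

theorem sb_toL2 (k : ℤ × ℤ) (F : C(Torus, ℝ)) : sb k (toL2 F) = ∫ ξ, F ξ * sn k ξ := by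
  rw [sb_eq]
  exact integral_congr_ae (by filter_upwards [coeFn_toL2 F] with ξ h; rw [h])

theorem ClassicalDx.isDx {F F' : C(Torus, ℝ)} (h : ClassicalDx F F') :
    IsDx (toL2 F) (toL2 F') := by
  intro k
  have h1 := (h.mul (G := cs k) (G' := -(2 * Real.pi * k.1) • sn k)
    (fun ξ t => hasDerivAt_cs_x k ξ t)).integral_eq_zero
  have h2 := (h.mul (G := sn k) (G' := (2 * Real.pi * k.1) • cs k)
    (fun ξ t => hasDerivAt_sn_x k ξ t)).integral_eq_zero
  simp only [ContinuousMap.add_apply, ContinuousMap.mul_apply, ContinuousMap.smul_apply,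
    smul_eq_mul] at h1 h2
  rw [integral_add (integrable_of_continuous (by fun_prop))
    (integrable_of_continuous (by fun_prop))] at h1 h2
  simp only [mul_left_comm (F _), integral_const_mul, ← ca_toL2, ← sb_toL2] at h1 h2
  constructor <;> linarith

theorem ClassicalDz.isDz {F F' : C(Torus, ℝ)} (h : ClassicalDz F F') :
    IsDz (toL2 F) (toL2 F') := by
  intro k
  have h1 := (h.mul (G := cs k) (G' := -(2 * Real.pi * k.2) • sn k)
    (fun ξ t => hasDerivAt_cs_z k ξ t)).integral_eq_zero
  have h2 := (h.mul (G := sn k) (G' := (2 * Real.pi * k.2) • cs k)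
    (fun ξ t => hasDerivAt_sn_z k ξ t)).integral_eq_zero
  simp only [ContinuousMap.add_apply, ContinuousMap.mul_apply, ContinuousMap.smul_apply,
    smul_eq_mul] at h1 h2
  rw [integral_add (integrable_of_continuous (by fun_prop))
    (integrable_of_continuous (by fun_prop))] at h1 h2
  simp only [mul_left_comm (F _), integral_const_mul, ← ca_toL2, ← sb_toL2] at h1 h2
  constructor <;> linarith

/-! ### Products of functions in `L²` -/

open Classical in
/-- The product of two functions, if it is in `L²`. -/
def mulL (f g : L2) : L2 :=
  if h : MemLp (fun ξ => f ξ * g ξ) 2 (volume : Measure Torus) then h.toLp else 0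

theorem coeFn_mulL {f g : L2} (h : MemLp (fun ξ => f ξ * g ξ) 2 (volume : Measure Torus)) :
    mulL f g =ᵐ[volume] fun ξ => f ξ * g ξ := by
  rw [mulL, dif_pos h]; exact h.coeFn_toLp

theorem norm_toL2_sq (F : C(Torus, ℝ)) : ‖toL2 F‖ ^ 2 = ∫ ξ, F ξ ^ 2 := by
  rw [← real_inner_self_eq_norm_sq, inner_eq_integral]
  refine integral_congr_ae ?_
  filter_upwards [coeFn_toL2 F] with ξ h
  rw [h]; ring

theorem integral_abs_mul_le (F G : C(Torus, ℝ)) : ∫ ξ, |F ξ * G ξ| ≤ ‖toL2 F‖ * ‖toL2 G‖ := by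
  have e : ∫ ξ, |F ξ * G ξ| = inner ℝ |toL2 F| |toL2 G| := by
    rw [inner_eq_integral]
    refine integral_congr_ae ?_
    filter_upwards [coeFn_toL2 F, coeFn_toL2 G, Lp.coeFn_abs (toL2 F), Lp.coeFn_abs (toL2 G)]
      with ξ h1 h2 h3 h4
    rw [h3, h4, h1, h2, abs_mul]
  rw [e]
  refine (real_inner_le_norm _ _).trans ?_
  rw [norm_abs_eq_norm, norm_abs_eq_norm]

/-- The constant of the anisotropic product estimate. -/
def aniso (f g : L2) : ℝ := ‖f‖ ^ 2 + 2 * (‖f‖ * ‖g‖)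

theorem aniso_nonneg (f g : L2) : 0 ≤ aniso f g := by unfold aniso; positivity

/-- Fatou's lemma carries the estimate from trigonometric polynomials to the limit. The lower
integral is used because square integrability of the product is a consequence, not a hypothesis. -/
theorem lintegral_mul_sq_le {f fz h hx : L2} (hf : IsDz f fz) (hh : IsDx h hx) :
    ∫⁻ ξ, ‖f ξ * h ξ‖ₑ ^ 2 ≤ ENNReal.ofReal (aniso f fz * aniso h hx) := by
  -- Fatou needs a sequence, so one is chosen in the directed set of finite frequency sets. Two
  -- successive subsequences then make the partial sums of both f and h converge almost everywhere.
  obtain ⟨s, hs⟩ := (atTop : Filter (Finset (ℤ × ℤ))).exists_seq_tendsto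
  have hF := (tendstoInMeasure_of_tendsto_Lp ((tendsto_trunc f).comp hs))
  obtain ⟨n1, hn1, hF1⟩ := hF.exists_seq_tendsto_ae
  have hs1 := hs.comp hn1.tendsto_atTop
  have hH := (tendstoInMeasure_of_tendsto_Lp ((tendsto_trunc h).comp hs1))
  obtain ⟨n2, hn2, hH2⟩ := hH.exists_seq_tendsto_ae
  set r : ℕ → Finset (ℤ × ℤ) := fun n => s (n1 (n2 n)) with hr
  have hrt : Tendsto r atTop atTop := hs1.comp hn2.tendsto_atTop
  have hlim : ∀ᵐ ξ : Torus, Tendsto (fun n => ‖truncC (r n) f ξ * truncC (r n) h ξ‖ₑ ^ 2) atTop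
      (𝓝 (‖f ξ * h ξ‖ₑ ^ 2)) := by
    have a1 : ∀ᵐ ξ : Torus, ∀ n, toL2 (truncC (r n) f) ξ = truncC (r n) f ξ :=
      ae_all_iff.2 fun n => coeFn_toL2 _
    have a2 : ∀ᵐ ξ : Torus, ∀ n, toL2 (truncC (r n) h) ξ = truncC (r n) h ξ :=
      ae_all_iff.2 fun n => coeFn_toL2 _
    filter_upwards [hF1, hH2, a1, a2] with ξ h1 h2 h3 h4
    have h1' := h1.comp hn2.tendsto_atTop
    have h5 : Tendsto (fun n => truncC (r n) f ξ * truncC (r n) h ξ) atTop (𝓝 (f ξ * h ξ)) := by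
      refine Tendsto.mul (h1'.congr fun n => ?_) (h2.congr fun n => ?_)
      · exact h3 n
      · exact h4 n
    exact ((ENNReal.continuous_pow 2).tendsto _).comp h5.enorm
  have hbound : ∀ n, ∫⁻ ξ, ‖truncC (r n) f ξ * truncC (r n) h ξ‖ₑ ^ 2 ≤
      ENNReal.ofReal (aniso (toL2 (truncC (r n) f)) (toL2 (truncC (r n) fz)) *
        aniso (toL2 (truncC (r n) h)) (toL2 (truncC (r n) hx))) := by
    intro n
    have e : ∫⁻ ξ, ‖truncC (r n) f ξ * truncC (r n) h ξ‖ₑ ^ 2 =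
        ENNReal.ofReal (∫ ξ, (truncC (r n) f ξ * truncC (r n) h ξ) ^ 2) := by
      rw [ofReal_integral_eq_lintegral_ofReal (integrable_of_continuous (by fun_prop))
        (Eventually.of_forall fun _ => sq_nonneg _)]
      refine lintegral_congr fun ξ => ?_
      rw [← sq_abs, ENNReal.ofReal_pow (abs_nonneg _), Real.enorm_eq_ofReal_abs]
    rw [e]
    refine ENNReal.ofReal_le_ofReal ((integral_sq_mul_sq_le (hf.truncC _) (hh.truncC _)).trans ?_)
    unfold aniso
    rw [norm_toL2_sq, norm_toL2_sq]
    have h1 := integral_abs_mul_le (truncC (r n) f) (truncC (r n) fz)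
    have h2 := integral_abs_mul_le (truncC (r n) h) (truncC (r n) hx)
    gcongr
  have hconv : Tendsto (fun n => ENNReal.ofReal (aniso (toL2 (truncC (r n) f))
      (toL2 (truncC (r n) fz)) * aniso (toL2 (truncC (r n) h)) (toL2 (truncC (r n) hx)))) atTop
      (𝓝 (ENNReal.ofReal (aniso f fz * aniso h hx))) := by
    have t : ∀ g : L2, Tendsto (fun n => ‖toL2 (truncC (r n) g)‖) atTop (𝓝 ‖g‖) := fun g =>
      ((tendsto_trunc g).comp hrt).norm
    refine ENNReal.tendsto_ofReal (Tendsto.mul ?_ ?_)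
    · exact ((t f).pow 2).add (((t f).mul (t fz)).const_mul 2)
    · exact ((t h).pow 2).add (((t h).mul (t hx)).const_mul 2)
  calc ∫⁻ ξ, ‖f ξ * h ξ‖ₑ ^ 2
      = ∫⁻ ξ, liminf (fun n => ‖truncC (r n) f ξ * truncC (r n) h ξ‖ₑ ^ 2) atTop := by
        refine lintegral_congr_ae ?_
        filter_upwards [hlim] with ξ h1
        exact h1.liminf_eq.symm
    _ ≤ liminf (fun n => ∫⁻ ξ, ‖truncC (r n) f ξ * truncC (r n) h ξ‖ₑ ^ 2) atTop :=
        lintegral_liminf_le fun n => by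
          have : Continuous fun ξ => truncC (r n) f ξ * truncC (r n) h ξ := by fun_prop
          exact this.measurable.enorm.pow_const 2
    _ ≤ liminf (fun n => ENNReal.ofReal (aniso (toL2 (truncC (r n) f))
      (toL2 (truncC (r n) fz)) * aniso (toL2 (truncC (r n) h)) (toL2 (truncC (r n) hx)))) atTop :=
        liminf_le_liminf (Eventually.of_forall hbound)
    _ = _ := hconv.liminf_eq

theorem IsDz.memLp_mul {f fz h hx : L2} (hf : IsDz f fz) (hh : IsDx h hx) :
    MemLp (fun ξ => f ξ * h ξ) 2 (volume : Measure Torus) := by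
  refine ⟨(Lp.aestronglyMeasurable f).mul (Lp.aestronglyMeasurable h), ?_⟩
  rw [eLpNorm_lt_top_iff_lintegral_rpow_enorm_lt_top (by simp) (by simp)]
  simpa using (lintegral_mul_sq_le hf hh).trans_lt ENNReal.ofReal_lt_top

theorem IsDz.norm_mulL_sq_le {f fz h hx : L2} (hf : IsDz f fz) (hh : IsDx h hx) :
    ‖mulL f h‖ ^ 2 ≤ aniso f fz * aniso h hx := by
  have hm := hf.memLp_mul hh
  rw [← real_inner_self_eq_norm_sq, inner_eq_integral]
  have e : ∫ ξ, mulL f h ξ * mulL f h ξ = ∫ ξ, (f ξ * h ξ) ^ 2 := by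
    refine integral_congr_ae ?_
    filter_upwards [coeFn_mulL hm] with ξ h
    rw [h]; ring
  rw [e, integral_eq_lintegral_of_nonneg_ae (Eventually.of_forall fun _ => sq_nonneg _)
    (hm.1.pow 2)]
  refine ENNReal.toReal_le_of_le_ofReal (mul_nonneg (aniso_nonneg _ _) (aniso_nonneg _ _)) ?_
  refine le_trans (le_of_eq (lintegral_congr fun ξ => ?_)) (lintegral_mul_sq_le hf hh)
  rw [← sq_abs, ENNReal.ofReal_pow (abs_nonneg _), Real.enorm_eq_ofReal_abs]

/-! ### Trilinear forms -/

theorem inner_mulL {f h : L2} (hm : MemLp (fun ξ => f ξ * h ξ) 2 (volume : Measure Torus))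
    (m : L2) : inner ℝ (mulL f h) m = ∫ ξ, f ξ * h ξ * m ξ := by
  rw [inner_eq_integral]
  refine integral_congr_ae ?_
  filter_upwards [coeFn_mulL hm] with ξ h
  rw [h]

/-- Two ways of writing `∫ f g m` as a scalar product agree. -/
theorem inner_mulL_comm {f h m : L2} (h1 : MemLp (fun ξ => f ξ * h ξ) 2 (volume : Measure Torus))
    (h2 : MemLp (fun ξ => m ξ * h ξ) 2 (volume : Measure Torus)) :
    inner ℝ (mulL f h) m = inner ℝ (mulL m h) f := by
  rw [inner_mulL h1, inner_mulL h2]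
  exact integral_congr_ae (Eventually.of_forall fun ξ => by ring)

open Classical in
theorem mulL_comm (f h : L2) : mulL f h = mulL h f := by
  have e : (fun ξ => f ξ * h ξ) = fun ξ => h ξ * f ξ := funext fun ξ => mul_comm _ _
  have key : ∀ F G : Torus → ℝ, F = G → (if h : MemLp F 2 (volume : Measure Torus)
      then h.toLp else 0) = (if h : MemLp G 2 (volume : Measure Torus) then h.toLp else 0) := by
    rintro F _ rfl; rfl
  exact key _ _ e

theorem mulL_sub_left {f f' h : L2} (h1 : MemLp (fun ξ => f ξ * h ξ) 2 (volume : Measure Torus))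
    (h2 : MemLp (fun ξ => f' ξ * h ξ) 2 (volume : Measure Torus))
    (h3 : MemLp (fun ξ => (f - f') ξ * h ξ) 2 (volume : Measure Torus)) :
    mulL (f - f') h = mulL f h - mulL f' h := by
  apply Lp.ext
  filter_upwards [coeFn_mulL h1, coeFn_mulL h2, coeFn_mulL h3, Lp.coeFn_sub f f',
    Lp.coeFn_sub (mulL f h) (mulL f' h)] with ξ e1 e2 e3 e4 e5
  rw [e3, e5, e4, Pi.sub_apply, Pi.sub_apply, e1, e2]; ring

theorem mulL_sub_right {f h h' : L2} (h1 : MemLp (fun ξ => f ξ * h ξ) 2 (volume : Measure Torus))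
    (h2 : MemLp (fun ξ => f ξ * h' ξ) 2 (volume : Measure Torus))
    (h3 : MemLp (fun ξ => f ξ * (h - h') ξ) 2 (volume : Measure Torus)) :
    mulL f (h - h') = mulL f h - mulL f h' := by
  rw [mulL_comm f, mulL_comm f, mulL_comm f]
  exact mulL_sub_left (by simpa only [mul_comm] using h1) (by simpa only [mul_comm] using h2)
    (by simpa only [mul_comm] using h3)

theorem mulL_toL2 (F G : C(Torus, ℝ)) : mulL (toL2 F) (toL2 G) = toL2 (F * G) := by
  have e : (fun ξ => toL2 F ξ * toL2 G ξ) =ᵐ[volume] toL2 (F * G) := by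
    filter_upwards [coeFn_toL2 F, coeFn_toL2 G, coeFn_toL2 (F * G)] with ξ h1 h2 h3
    rw [h1, h2, h3]; rfl
  have hm := (memLp_congr_ae e).2 (Lp.memLp _)
  exact Lp.ext ((coeFn_mulL hm).trans e)

theorem inner_toL2 (F G : C(Torus, ℝ)) : inner ℝ (toL2 F) (toL2 G) = ∫ ξ, F ξ * G ξ := by
  rw [inner_eq_integral]
  refine integral_congr_ae ?_
  filter_upwards [coeFn_toL2 F, coeFn_toL2 G] with ξ h1 h2
  rw [h1, h2]

theorem tendsto_aniso_zero {f fz : L2} : Tendsto (fun s => aniso (toL2 (truncC s f) - f)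
    (toL2 (truncC s fz) - fz)) atTop (𝓝 0) := by
  have t : ∀ g : L2, Tendsto (fun s => ‖toL2 (truncC s g) - g‖) atTop (𝓝 0) := fun g =>
    tendsto_iff_norm_sub_tendsto_zero.1 (tendsto_trunc g)
  have := ((t f).pow 2).add (((t f).mul (t fz)).const_mul 2)
  simpa [aniso] using this

theorem tendsto_aniso {f fz : L2} : Tendsto (fun s => aniso (toL2 (truncC s f))
    (toL2 (truncC s fz))) atTop (𝓝 (aniso f fz)) := by
  have t : ∀ g : L2, Tendsto (fun s => ‖toL2 (truncC s g)‖) atTop (𝓝 ‖g‖) := fun g =>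
    (tendsto_trunc g).norm
  exact ((t f).pow 2).add (((t f).mul (t fz)).const_mul 2)

/-- The anisotropic estimate, applied to the differences in each factor, makes the product
continuous for the graph norm of ∂z in the first factor and of ∂x in the second. Truncation commutes
with derivatives, so both graph norms converge. -/
theorem tendsto_mulL_trunc {f fz h hx : L2} (hf : IsDz f fz) (hh : IsDx h hx) :
    Tendsto (fun s => mulL (toL2 (truncC s f)) (toL2 (truncC s h))) atTop (𝓝 (mulL f h)) := by
  have key : ∀ s, ‖mulL (toL2 (truncC s f)) (toL2 (truncC s h)) - mulL f h‖ ≤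
      √(aniso (toL2 (truncC s f) - f) (toL2 (truncC s fz) - fz) *
        aniso (toL2 (truncC s h)) (toL2 (truncC s hx))) +
      √(aniso f fz * aniso (toL2 (truncC s h) - h) (toL2 (truncC s hx) - hx)) := by
    intro s
    have hfs := (hf.truncC s).isDz
    have hhs := (hh.truncC s).isDx
    have e : mulL (toL2 (truncC s f)) (toL2 (truncC s h)) - mulL f h =
        mulL (toL2 (truncC s f) - f) (toL2 (truncC s h)) +
          mulL f (toL2 (truncC s h) - h) := by
      rw [mulL_sub_left (hfs.memLp_mul hhs) (hf.memLp_mul hhs) ((hfs.sub hf).memLp_mul hhs),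
        mulL_sub_right (hf.memLp_mul hhs) (hf.memLp_mul hh) (hf.memLp_mul (hhs.sub hh))]
      abel
    rw [e]
    refine (norm_add_le _ _).trans (add_le_add ?_ ?_)
    · exact Real.le_sqrt_of_sq_le ((hfs.sub hf).norm_mulL_sq_le hhs)
    · exact Real.le_sqrt_of_sq_le (hf.norm_mulL_sq_le (hhs.sub hh))
  rw [tendsto_iff_norm_sub_tendsto_zero]
  refine squeeze_zero (fun _ => norm_nonneg _) key ?_
  have t1 := (tendsto_aniso_zero (f := f) (fz := fz)).mul (tendsto_aniso (f := h) (fz := hx))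
  have t2 := (tendsto_aniso_zero (f := h) (fz := hx)).const_mul (aniso f fz)
  have := (t1.sqrt).add t2.sqrt
  simpa using this

theorem tendsto_inner_mulL_trunc {f fz h hx : L2} (hf : IsDz f fz) (hh : IsDx h hx) (m : L2) :
    Tendsto (fun s => ∫ ξ, truncC s f ξ * truncC s h ξ * truncC s m ξ) atTop
      (𝓝 (inner ℝ (mulL f h) m)) := by
  refine ((tendsto_mulL_trunc hf hh).inner (tendsto_trunc m)).congr fun s => ?_
  rw [mulL_toL2, inner_toL2]
  rfl

/-- The integral of `∂(p q r)/∂z` vanishes. -/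
theorem trilinear_z {p pz q qz qx r rz rx : L2} (hp : IsDz p pz) (hq : IsDz q qz)
    (hqx : IsDx q qx) (hr : IsDz r rz) (hrx : IsDx r rx) :
    inner ℝ (mulL q r) pz + inner ℝ (mulL p r) qz + inner ℝ (mulL p q) rz = 0 := by
  -- In each term the two undifferentiated functions form the L² product and the differentiated one
  -- is only paired with it, so no integrability of triple products is needed beyond the anisotropic
  -- estimate.
  have t := ((tendsto_inner_mulL_trunc hq hrx pz).add (tendsto_inner_mulL_trunc hp hrx qz)).add
    (tendsto_inner_mulL_trunc hp hqx rz)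
  refine tendsto_nhds_unique t (tendsto_const_nhds.congr fun s => ?_)
  have h := (((hp.truncC s).mul (hq.truncC s)).mul (hr.truncC s)).integral_eq_zero
  rw [← integral_add (integrable_of_continuous (by fun_prop))
    (integrable_of_continuous (by fun_prop)), ← integral_add
    (integrable_of_continuous (by fun_prop)) (integrable_of_continuous (by fun_prop)), ← h]
  refine integral_congr_ae (Eventually.of_forall fun ξ => ?_)
  simp only [ContinuousMap.add_apply, ContinuousMap.mul_apply]
  ring

/-- The integral of `∂(p q r)/∂x` vanishes. -/
theorem trilinear_x {p px pz q qz qx r rx : L2} (hpx : IsDx p px) (hp : IsDz p pz)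
    (hqx : IsDx q qx) (hq : IsDz q qz) (hrx : IsDx r rx) :
    inner ℝ (mulL q r) px + inner ℝ (mulL p r) qx + inner ℝ (mulL p q) rx = 0 := by
  have t := ((tendsto_inner_mulL_trunc hq hrx px).add (tendsto_inner_mulL_trunc hp hrx qx)).add
    (tendsto_inner_mulL_trunc hp hqx rx)
  refine tendsto_nhds_unique t (tendsto_const_nhds.congr fun s => ?_)
  have h := (((hpx.truncC s).mul (hqx.truncC s)).mul (hrx.truncC s)).integral_eq_zero
  rw [← integral_add (integrable_of_continuous (by fun_prop))
    (integrable_of_continuous (by fun_prop)), ← integral_add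
    (integrable_of_continuous (by fun_prop)) (integrable_of_continuous (by fun_prop)), ← h]
  refine integral_congr_ae (Eventually.of_forall fun ξ => ?_)
  simp only [ContinuousMap.add_apply, ContinuousMap.mul_apply]
  ring

/-- Transport by the divergence-free field `(U, W)` is skew-symmetric. -/
theorem transport_eq_zero {U Ux Uz W g gx gz : L2} (hUx : IsDx U Ux) (hUz : IsDz U Uz)
    (hW : IsDz W (-Ux)) (hgx : IsDx g gx) (hgz : IsDz g gz) :
    inner ℝ (mulL U g) gx + inner ℝ (mulL W g) gz = 0 := by
  -- These integrate ∂x(U g²) and ∂z(W g²). Since W_z = -U_x, the terms with g² U_x cancel in the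
  -- sum.
  have h1 := trilinear_x hUx hUz hgx hgz hgx
  have h2 := trilinear_z hW hgz hgx hgz hgx
  rw [inner_neg_right] at h2
  linarith

/-- The nonlinear term `U Uₓ + W U_z` is orthogonal to `U_zz`. -/
theorem nonlinear_inner_zz {U Ux Uz Uxz Uzz W : L2} (hUx : IsDx U Ux) (hUz : IsDz U Uz)
    (hUzx : IsDx Uz Uxz) (hUzz : IsDz Uz Uzz) (hW : IsDz W (-Ux)) :
    inner ℝ (mulL Ux U + mulL W Uz) Uzz = 0 := by
  have hUxz := hUx.mixed hUz hUzx
  -- With I the integral of U_x U_z², `h2` gives ∫ W U_z U_zz = I/2, `h3` then gives ∫ U U_z U_xz =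
  -- -I/2, and `h1` gives ∫ U U_x U_zz = I/2 - I = -I/2. The two halves cancel.
  have h1 := trilinear_z hUxz hUz hUx hUzz hUzx
  have h2 := trilinear_z hW hUzz hUzx hUzz hUzx
  have h3 := transport_eq_zero hUx hUz hW hUzx hUzz
  have h4 := inner_mulL_comm (hUxz.memLp_mul hUzx) (hUzz.memLp_mul hUzx)
  rw [inner_neg_right] at h2
  rw [inner_add_left]
  linarith

/-- The difference of the nonlinear terms of `U` and `u`, tested with `U - u`. -/
theorem nonlinear_sub_inner {U Ux Uz Uxz W u ux uz uxz uxx w : L2} (hUx : IsDx U Ux)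
    (hUz : IsDz U Uz) (hUzx : IsDx Uz Uxz) (hW : IsDz W (-Ux)) (hux : IsDx u ux)
    (huz : IsDz u uz) (huzx : IsDx uz uxz) (huxx : IsDx ux uxx) (hw : IsDz w (-ux)) :
    inner ℝ (mulL Ux U + mulL W Uz) (U - u) - inner ℝ (mulL ux u + mulL w uz) (U - u) =
      inner ℝ (mulL (U - u) ux) (U - u) + inner ℝ (mulL (U - u) uz) (W - w) := by
  have hUxz := hUx.mixed hUz hUzx
  have huxz := hux.mixed huz huzx
  set v := U - u with hv
  have hvx : IsDx v (Ux - ux) := hUx.sub hux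
  have hvz : IsDz v (Uz - uz) := hUz.sub huz
  -- The difference of the nonlinear terms is (U v_x + W v_z) + (v u_x + (W - w) u_z); the first
  -- bracket is the transport of v and drops out against v. The remaining work is to regroup scalar
  -- products into pairs whose product is known to be in L².
  have h0 := transport_eq_zero hUx hUz hW hvx hvz
  have s1 : MemLp (fun ξ => v ξ * U ξ) 2 (volume : Measure Torus) := hvz.memLp_mul hUx
  have s2 : MemLp (fun ξ => U ξ * v ξ) 2 (volume : Measure Torus) := hUz.memLp_mul hvx
  have s3 : MemLp (fun ξ => v ξ * W ξ) 2 (volume : Measure Torus) := by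
    simpa only [mul_comm] using hW.memLp_mul hvx
  have s4 : MemLp (fun ξ => Uz ξ * W ξ) 2 (volume : Measure Torus) := by
    simpa only [mul_comm] using hW.memLp_mul hUzx
  have s5 : MemLp (fun ξ => ux ξ * v ξ) 2 (volume : Measure Torus) := huxz.memLp_mul hvx
  have s6 : MemLp (fun ξ => u ξ * ux ξ) 2 (volume : Measure Torus) := huz.memLp_mul huxx
  have s7 : MemLp (fun ξ => v ξ * ux ξ) 2 (volume : Measure Torus) := hvz.memLp_mul huxx
  have s8 : MemLp (fun ξ => v ξ * uz ξ) 2 (volume : Measure Torus) := hvz.memLp_mul huzx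
  have s9 : MemLp (fun ξ => uz ξ * v ξ) 2 (volume : Measure Torus) := by
    simpa only [mul_comm] using s8
  have s10 : MemLp (fun ξ => W ξ * v ξ) 2 (volume : Measure Torus) := hW.memLp_mul hvx
  have s11 : MemLp (fun ξ => w ξ * uz ξ) 2 (volume : Measure Torus) := hw.memLp_mul huzx
  have e1 : inner ℝ (mulL Ux U) v = inner ℝ (mulL U v) Ux := by
    rw [inner_mulL_comm (hUxz.memLp_mul hUx) s1, mulL_comm]
  have e2 : inner ℝ (mulL W Uz) v = inner ℝ (mulL W v) Uz := by
    rw [mulL_comm W, inner_mulL_comm s4 s3, mulL_comm]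
  have e3 : inner ℝ (mulL U v) ux = inner ℝ (mulL v ux) U := by
    rw [inner_mulL_comm s2 s5, mulL_comm]
  have e4 : inner ℝ (mulL ux u) v = inner ℝ (mulL v ux) u := by
    rw [mulL_comm, inner_mulL_comm s6 s7]
  have e5 : inner ℝ (mulL W v) uz = inner ℝ (mulL v uz) W := by
    rw [inner_mulL_comm s10 s9, mulL_comm]
  have e6 : inner ℝ (mulL w uz) v = inner ℝ (mulL v uz) w := inner_mulL_comm s11 s8
  rw [inner_add_left, inner_add_left, e1, e2, e4, e6, inner_sub_right (mulL v uz), ← e5]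
  rw [inner_sub_right, inner_sub_right, e3] at h0
  have e7 : inner ℝ (mulL v ux) v = inner ℝ (mulL v ux) U - inner ℝ (mulL v ux) u := by
    rw [← inner_sub_right]
  rw [e7]
  linarith

/-! ### Fubini's theorem on the torus -/

instance : IsProbabilityMeasure (volume : Measure UnitAddCircle) := ⟨UnitAddCircle.measure_univ⟩

theorem lintegral_torus {F : Torus → ℝ≥0∞} (hF : AEMeasurable F volume) :
    ∫⁻ ξ, F ξ = ∫⁻ x : UnitAddCircle, ∫⁻ z : UnitAddCircle, F (x, z) := lintegral_prod F hF

theorem integral_torus {F : Torus → ℝ} (hF : Integrable F volume) :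
    ∫ ξ, F ξ = ∫ x : UnitAddCircle, ∫ z : UnitAddCircle, F (x, z) := integral_prod F hF

/-! ### The vertical primitive -/

theorem measurable_rep : Measurable rep :=
  measurable_subtype_coe.comp (AddCircle.measurableEquivIco 1 0).measurable

theorem rep_coe {s : ℝ} (hs : s ∈ Ico (0 : ℝ) 1) : rep (s : UnitAddCircle) = s := by
  have h := AddCircle.coe_equivIco_mk_apply (p := (1 : ℝ)) s
  rw [rep, h, div_one, mul_one, Int.fract_eq_self.2 hs]

/-- The kernel of the vertical primitive. -/
def ker (s z : UnitAddCircle) : ℝ := if rep s ≤ rep z then 1 else 0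

theorem measurable_ker : Measurable (fun p : UnitAddCircle × UnitAddCircle => ker p.1 p.2) :=
  Measurable.ite (measurableSet_le (measurable_rep.comp measurable_fst)
    (measurable_rep.comp measurable_snd)) measurable_const measurable_const

theorem abs_ker_le (s z : UnitAddCircle) : ‖ker s z‖ ≤ 1 := by
  unfold ker; split_ifs <;> simp

theorem integral_zero_rep (F : UnitAddCircle → ℝ) (z : UnitAddCircle) :
    ∫ s in (0 : ℝ)..(rep z), F s = ∫ s, ker s z * F s := by
  have hz := rep_mem z
  rw [integral_circle, intervalIntegral.integral_of_le zero_le_one,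
    intervalIntegral.integral_of_le hz.1, integral_Ioc_eq_integral_Ioo (y := 1)]
  have e1 : ∀ s ∈ Ioo (0 : ℝ) 1, ker (s : UnitAddCircle) z * F s =
      (Iic (rep z)).indicator (fun s : ℝ => F s) s := by
    intro s hs
    rw [ker, rep_coe ⟨hs.1.le, hs.2⟩, indicator_apply]
    simp only [mem_Iic]
    split_ifs <;> simp
  rw [setIntegral_congr_fun measurableSet_Ioo e1, setIntegral_indicator measurableSet_Iic]
  congr 2
  ext s
  simp only [mem_Ioc, mem_inter_iff, mem_Ioo, mem_Iic]
  have := hz.2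
  constructor
  · rintro ⟨h1, h2⟩; exact ⟨⟨h1, by linarith⟩, h2⟩
  · rintro ⟨⟨h1, _⟩, h2⟩; exact ⟨h1, h2⟩

/-- The same kernel integrated in its other variable. This identifies the adjoint of the vertical
primitive as integration from z up to 1. -/
theorem integral_rep_one (F : UnitAddCircle → ℝ) (s : UnitAddCircle) :
    ∫ z in (rep s)..1, F z = ∫ z, ker s z * F z := by
  have hz := rep_mem s
  rw [integral_circle, intervalIntegral.integral_of_le zero_le_one,
    intervalIntegral.integral_of_le hz.2.le, integral_Ioc_eq_integral_Ioo (x := 0)]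
  have e1 : ∀ z ∈ Ioo (0 : ℝ) 1, ker s (z : UnitAddCircle) * F z =
      (Ici (rep s)).indicator (fun s : ℝ => F s) z := by
    intro z hz
    rw [ker, rep_coe ⟨hz.1.le, hz.2⟩, indicator_apply]
    simp only [mem_Ici]
    split_ifs <;> simp
  rw [setIntegral_congr_fun measurableSet_Ioo e1, setIntegral_indicator measurableSet_Ici]
  refine setIntegral_congr_set ?_
  have n1 : ∀ᵐ x : ℝ, x ≠ rep s := by simp [ae_iff]
  have n2 : ∀ᵐ x : ℝ, x ≠ 1 := by simp [ae_iff]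
  filter_upwards [n1, n2] with z h1 h2
  refine propext ?_
  change z ∈ Ioc (rep s) 1 ↔ z ∈ Ioo 0 1 ∩ Ici (rep s)
  simp only [mem_Ioc, mem_inter_iff, mem_Ioo, mem_Ici]
  constructor
  · rintro ⟨h3, h4⟩
    exact ⟨⟨hz.1.trans_lt h3, lt_of_le_of_ne h4 h2⟩, h3.le⟩
  · rintro ⟨⟨_, h4⟩, h5⟩
    exact ⟨lt_of_le_of_ne h5 (Ne.symm h1), h4.le⟩

theorem primZ_eq (f : Torus → ℝ) (ξ : Torus) : primZ f ξ = ∫ s, ker s ξ.2 * f (ξ.1, s) :=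
  integral_zero_rep (fun s => f (ξ.1, s)) ξ.2

/-- Functions that agree almost everywhere have the same vertical primitive. -/
theorem primZ_congr {f g : Torus → ℝ} (h : f =ᵐ[volume] g) : primZ f =ᵐ[volume] primZ g := by
  have h1 : ∀ᵐ x : UnitAddCircle, ∀ᵐ z : UnitAddCircle, f (x, z) = g (x, z) :=
    Measure.ae_ae_of_ae_prod h
  have h2 : ∀ᵐ ξ : Torus, ∀ᵐ z : UnitAddCircle, f (ξ.1, z) = g (ξ.1, z) :=
    Measure.quasiMeasurePreserving_fst.ae h1
  filter_upwards [h2] with ξ hξ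
  rw [primZ_eq, primZ_eq]
  refine integral_congr_ae ?_
  filter_upwards [hξ] with s hs
  rw [hs]

theorem ae_integrable_slice {f : Torus → ℝ} (h : Integrable f volume) :
    ∀ᵐ x : UnitAddCircle, Integrable (fun z => f (x, z)) volume := h.prod_right_ae

theorem integrable_L2 (f : L2) : Integrable f volume := (Lp.memLp f).integrable (by norm_num)

theorem Integrable.ker_mul {F : UnitAddCircle → ℝ} (hF : Integrable F volume) (z : UnitAddCircle) :
    Integrable (fun s => ker s z * F s) volume := by
  refine hF.bdd_mul (c := 1) ?_ (Eventually.of_forall fun s => abs_ker_le s z)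
  exact (measurable_ker.comp (measurable_id.prodMk measurable_const)).aestronglyMeasurable

theorem primZ_add (f g : L2) :
    primZ (fun ξ => f ξ + g ξ) =ᵐ[volume] fun ξ => primZ f ξ + primZ g ξ := by
  have h1 := Measure.quasiMeasurePreserving_fst (μ := (volume : Measure UnitAddCircle))
    (ν := (volume : Measure UnitAddCircle)).ae (ae_integrable_slice (integrable_L2 f))
  have h2 := Measure.quasiMeasurePreserving_fst (μ := (volume : Measure UnitAddCircle))
    (ν := (volume : Measure UnitAddCircle)).ae (ae_integrable_slice (integrable_L2 g))
  filter_upwards [h1, h2] with ξ i1 i2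
  simp only [primZ_eq]
  rw [← integral_add (Integrable.ker_mul i1 _) (Integrable.ker_mul i2 _)]
  simp only [mul_add]

theorem primZ_const_mul (c : ℝ) (f : Torus → ℝ) (ξ : Torus) :
    primZ (fun ξ => c * f ξ) ξ = c * primZ f ξ := by
  simp only [primZ, intervalIntegral.integral_const_mul]

theorem stronglyMeasurable_primZ (f : L2) : StronglyMeasurable (primZ f) := by
  have e : primZ f = fun ξ => ∫ s, ker s ξ.2 * f (ξ.1, s) := funext fun ξ => primZ_eq f ξ
  rw [e]
  have hf : Measurable f := (Lp.stronglyMeasurable f).measurable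
  have : Measurable fun p : Torus × UnitAddCircle => ker p.2 p.1.2 * f (p.1.1, p.2) :=
    (measurable_ker.comp (measurable_snd.prodMk (measurable_snd.comp measurable_fst))).mul
      (hf.comp ((measurable_fst.comp measurable_fst).prodMk measurable_snd))
  exact this.stronglyMeasurable.integral_prod_right

/-- At each point the primitive is at most the L¹ norm of f on the whole vertical circle, hence at
most its L² norm there, as the circle has measure 1. This bound is independent of z, so integrating
it over the torus costs nothing. -/
theorem eLpNorm_primZ_le (f : L2) :
    eLpNorm (primZ f) 2 (volume : Measure Torus) ≤ eLpNorm f 2 (volume : Measure Torus) := by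
  have hf : Measurable f := (Lp.stronglyMeasurable f).measurable
  have key : ∀ ξ : Torus, ‖primZ f ξ‖ₑ ^ (2 : ℝ) ≤ ∫⁻ s, ‖f (ξ.1, s)‖ₑ ^ (2 : ℝ) := by
    intro ξ
    have h1 : ‖primZ f ξ‖ₑ ≤ eLpNorm (fun s => f (ξ.1, s)) 1 volume := by
      rw [primZ_eq, eLpNorm_one_eq_lintegral_enorm]
      refine (enorm_integral_le_lintegral_enorm _).trans (lintegral_mono fun s => ?_)
      rw [enorm_mul]
      refine mul_le_of_le_one_left' ?_
      rw [← ofReal_norm]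
      exact ENNReal.ofReal_le_one.2 (abs_ker_le _ _)
    have h2 : eLpNorm (fun s => f (ξ.1, s)) 1 volume ≤ eLpNorm (fun s => f (ξ.1, s)) 2 volume :=
      eLpNorm_le_eLpNorm_of_exponent_le (by norm_num)
        (hf.comp (measurable_const.prodMk measurable_id)).aestronglyMeasurable
    have h3 := eLpNorm_eq_lintegral_rpow_enorm_toReal (p := 2) (by simp) (by simp)
      (f := fun s => f (ξ.1, s)) (μ := (volume : Measure UnitAddCircle))
    have h4 := ENNReal.rpow_le_rpow (h1.trans (h2.trans h3.le)) (z := 2) (by norm_num)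
    rw [ENNReal.toReal_ofNat, ← ENNReal.rpow_mul, one_div, inv_mul_cancel₀ (by norm_num),
      ENNReal.rpow_one] at h4
    exact h4
  rw [eLpNorm_eq_lintegral_rpow_enorm_toReal (by simp) (by simp),
    eLpNorm_eq_lintegral_rpow_enorm_toReal (by simp) (by simp)]
  refine ENNReal.rpow_le_rpow ?_ (by norm_num)
  simp only [ENNReal.toReal_ofNat]
  have m1 : Measurable fun ξ : Torus => ‖f ξ‖ₑ ^ (2 : ℝ) := hf.enorm.pow_const _
  calc ∫⁻ ξ, ‖primZ f ξ‖ₑ ^ (2 : ℝ) ≤ ∫⁻ ξ : Torus, ∫⁻ s, ‖f (ξ.1, s)‖ₑ ^ (2 : ℝ) :=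
        lintegral_mono key
    _ = ∫⁻ x : UnitAddCircle, ∫⁻ s : UnitAddCircle, ‖f (x, s)‖ₑ ^ (2 : ℝ) := by
        rw [lintegral_torus (F := fun ξ : Torus => ∫⁻ s, ‖f (ξ.1, s)‖ₑ ^ (2 : ℝ))
          ((m1.lintegral_prod_right'.comp measurable_fst).aemeasurable)]
        simp
    _ = ∫⁻ ξ, ‖f ξ‖ₑ ^ (2 : ℝ) := by
        rw [lintegral_torus m1.aemeasurable]

theorem memLp_primZ (f : L2) : MemLp (primZ f) 2 (volume : Measure Torus) :=
  ⟨(stronglyMeasurable_primZ f).aestronglyMeasurable,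
    (eLpNorm_primZ_le f).trans_lt (Lp.memLp f).2⟩

/-- The vertical primitive as a bounded operator on `L²`. -/
def primL : L2 →L[ℝ] L2 :=
  LinearMap.mkContinuous
    { toFun := fun f => (memLp_primZ f).toLp
      map_add' := fun f g => by
        rw [← MemLp.toLp_add]
        exact (MemLp.toLp_eq_toLp_iff _ _).2
          ((primZ_congr (Lp.coeFn_add f g)).trans (primZ_add f g))
      map_smul' := fun c f => by
        rw [RingHom.id_apply, ← MemLp.toLp_const_smul]
        refine (MemLp.toLp_eq_toLp_iff _ _).2 ((primZ_congr (Lp.coeFn_smul c f)).trans ?_)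
        exact Eventually.of_forall fun ξ => primZ_const_mul c f ξ }
    1 fun f => by
      rw [one_mul]
      change ‖(memLp_primZ f).toLp‖ ≤ _
      rw [Lp.norm_toLp, Lp.norm_def]
      exact ENNReal.toReal_mono (Lp.eLpNorm_ne_top f) (eLpNorm_primZ_le f)

theorem coeFn_primL (f : L2) : primL f =ᵐ[volume] primZ f := (memLp_primZ f).coeFn_toLp

theorem coeFn_primL_primL (f : L2) : primL (primL f) =ᵐ[volume] primZ (primZ f) :=
  (coeFn_primL _).trans (primZ_congr (coeFn_primL f))

theorem integrable_L2_mul (f : L2) (g : C(Torus, ℝ)) : Integrable (fun ξ => f ξ * g ξ) volume := by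
  refine (integrable_mul_L2 f (toL2 g)).congr ?_
  filter_upwards [coeFn_toL2 g] with ξ h
  rw [h]

/-- Fubini's theorem for the vertical primitive. -/
theorem integral_primL_mul (f : L2) (g : C(Torus, ℝ)) :
    ∫ ξ, primL f ξ * g ξ = ∫ ξ, f ξ * ∫ h in (rep ξ.2)..1, g (ξ.1, (h : UnitAddCircle)) := by
  have hf : Measurable f := (Lp.stronglyMeasurable f).measurable
  have hg : Measurable g := g.continuous.measurable
  have eK : ∀ ξ : Torus, ∫ h in (rep ξ.2)..1, g (ξ.1, (h : UnitAddCircle)) =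
      ∫ z, ker ξ.2 z * g (ξ.1, z) := fun ξ => integral_rep_one (fun z => g (ξ.1, z)) ξ.2
  simp only [eK]
  have mK : StronglyMeasurable fun ξ : Torus => ∫ z, ker ξ.2 z * g (ξ.1, z) := by
    have : Measurable fun p : Torus × UnitAddCircle => ker p.1.2 p.2 * g (p.1.1, p.2) :=
      (measurable_ker.comp ((measurable_snd.comp measurable_fst).prodMk measurable_snd)).mul
        (hg.comp ((measurable_fst.comp measurable_fst).prodMk measurable_snd))
    exact this.stronglyMeasurable.integral_prod_right
  have bK : ∀ ξ : Torus, ‖∫ z, ker ξ.2 z * g (ξ.1, z)‖ ≤ ‖g‖ := by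
    intro ξ
    have := norm_integral_le_of_norm_le_const (μ := (volume : Measure UnitAddCircle)) (C := ‖g‖)
      (f := fun z => ker ξ.2 z * g (ξ.1, z)) (Eventually.of_forall fun z => by
        rw [norm_mul]
        calc _ ≤ 1 * ‖g‖ := mul_le_mul (abs_ker_le _ _) (g.norm_coe_le_norm _) (norm_nonneg _)
              zero_le_one
          _ = _ := one_mul _)
    simpa using this
  have i2 : Integrable (fun ξ : Torus => f ξ * ∫ z, ker ξ.2 z * g (ξ.1, z)) volume :=
    (integrable_L2 f).mul_bdd (c := ‖g‖) mK.aestronglyMeasurable (Eventually.of_forall bK)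
  have i1 : Integrable (fun ξ => primZ f ξ * g ξ) volume := by
    refine (integrable_L2_mul (primL f) g).congr ?_
    filter_upwards [coeFn_primL f] with ξ h
    rw [h]
  have e0 : ∫ ξ, primL f ξ * g ξ = ∫ ξ, primZ f ξ * g ξ :=
    integral_congr_ae (by filter_upwards [coeFn_primL f] with ξ h; rw [h])
  rw [e0, integral_torus i1, integral_torus i2]
  refine integral_congr_ae ?_
  filter_upwards [ae_integrable_slice (integrable_L2 f)] with x hx
  have i3 : Integrable (fun p : UnitAddCircle × UnitAddCircle =>
      f (x, p.2) * (ker p.2 p.1 * g (x, p.1))) ((volume : Measure UnitAddCircle).prod volume) := by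
    refine (hx.comp_snd (volume : Measure UnitAddCircle)).mul_bdd (c := ‖g‖) ?_
      (Eventually.of_forall fun p => ?_)
    · exact ((measurable_ker.comp measurable_swap).mul (hg.comp
        (measurable_const.prodMk measurable_fst))).aestronglyMeasurable
    · rw [norm_mul]
      calc _ ≤ 1 * ‖g‖ := mul_le_mul (abs_ker_le _ _) (g.norm_coe_le_norm _) (norm_nonneg _)
            zero_le_one
        _ = _ := one_mul _
  calc ∫ z, primZ f (x, z) * g (x, z)
      = ∫ z, ∫ s, f (x, s) * (ker s z * g (x, z)) := by
        refine integral_congr_ae (Eventually.of_forall fun z => ?_)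
        simp only [primZ_eq]
        rw [← integral_mul_const]
        exact integral_congr_ae (Eventually.of_forall fun s => by ring)
    _ = ∫ s, ∫ z, f (x, s) * (ker s z * g (x, z)) := integral_integral_swap i3
    _ = ∫ s, f (x, s) * ∫ z, ker s z * g (x, z) := by
        simp only [integral_const_mul]

theorem integral_rep_one_deriv {F F' : C(Torus, ℝ)} (h : ClassicalDz F F') (ξ : Torus) :
    ∫ t in (rep ξ.2)..1, F' (ξ.1, (t : UnitAddCircle)) = F (ξ.1, 0) - F ξ := by
  rw [intervalIntegral.integral_eq_sub_of_hasDerivAt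
    (f := fun t : ℝ => F (ξ.1, (t : UnitAddCircle)))
    (fun t _ => by simpa using h (ξ.1, 0) t)
    (Continuous.intervalIntegrable (by fun_prop) _ _), coe_rep]
  have : ((1 : ℝ) : UnitAddCircle) = 0 := AddCircle.coe_period 1
  rw [this]

/-- The vertical mean of `f` vanishes. -/
def MeanFree (f : L2) : Prop := ∀ n : ℤ, ca (n, 0) f = 0 ∧ sb (n, 0) f = 0

/-- The Fourier coefficients of `f` are even in the vertical frequency. -/
def EvenCoeff (f : L2) : Prop :=
  ∀ k : ℤ × ℤ, ca (k.1, -k.2) f = ca k f ∧ sb (k.1, -k.2) f = sb k f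

theorem expo_fst_zero (k : ℤ × ℤ) (x z : UnitAddCircle) :
    expo k (x, 0) = expo (k.1, 0) (x, z) := by
  simp [expo_apply]

/-- Moving the primitive onto ∂z of the mode k leaves the mode at z = 1 minus the mode itself. The
boundary part is the mode (k₁, 0), whose coefficient in f vanishes by hypothesis; without it the
primitive would jump across z = 0. -/
theorem MeanFree.isDz_primL {f : L2} (h : MeanFree f) : IsDz (primL f) f := by
  intro k
  have hc : ∀ ξ : Torus, cs k (ξ.1, 0) = cs (k.1, 0) ξ := fun ξ => by
    rw [cs_apply, cs_apply, expo_fst_zero k ξ.1 ξ.2]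
  have hs : ∀ ξ : Torus, sn k (ξ.1, 0) = sn (k.1, 0) ξ := fun ξ => by
    rw [sn_apply, sn_apply, expo_fst_zero k ξ.1 ξ.2]
  have d1 : ClassicalDz (cs k) (-(2 * Real.pi * k.2) • sn k) := fun ξ t => hasDerivAt_cs_z k ξ t
  have d2 : ClassicalDz (sn k) ((2 * Real.pi * k.2) • cs k) := fun ξ t => hasDerivAt_sn_z k ξ t
  have e1 := integral_primL_mul f (-(2 * Real.pi * k.2) • sn k)
  have e2 := integral_primL_mul f ((2 * Real.pi * k.2) • cs k)
  simp only [integral_rep_one_deriv d1, hc, mul_sub] at e1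
  simp only [integral_rep_one_deriv d2, hs, mul_sub] at e2
  rw [integral_sub (integrable_mul_cs f _) (integrable_mul_cs f _), ← ca_eq, ← ca_eq,
    (h k.1).1] at e1
  rw [integral_sub (integrable_mul_sn f _) (integrable_mul_sn f _), ← sb_eq, ← sb_eq,
    (h k.1).2] at e2
  simp only [ContinuousMap.smul_apply, smul_eq_mul, mul_left_comm (primL f _), integral_const_mul,
    ← ca_eq, ← sb_eq] at e1 e2
  constructor <;> linarith

/-! ### Reflection -/

theorem measurePreserving_reflect :
    MeasurePreserving (fun ξ : Torus => (ξ.1, -ξ.2)) volume volume :=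
  (MeasurePreserving.id (volume : Measure UnitAddCircle)).prod
    (Measure.measurePreserving_neg (volume : Measure UnitAddCircle))

theorem integral_reflect (F : Torus → ℝ) : ∫ ξ : Torus, F (ξ.1, -ξ.2) = ∫ ξ, F ξ :=
  measurePreserving_reflect.integral_comp
    ((Homeomorph.refl UnitAddCircle).prodCongr (Homeomorph.neg UnitAddCircle)).measurableEmbedding F

theorem expo_reflect (k : ℤ × ℤ) (ξ : Torus) : expo k (ξ.1, -ξ.2) = expo (k.1, -k.2) ξ := by
  simp [expo_apply, fourier_apply]

/-- The reflection `f(x, -z)`. -/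
def reflect (f : L2) : L2 := Lp.compMeasurePreserving _ measurePreserving_reflect f

theorem coeFn_reflect (f : L2) : reflect f =ᵐ[volume] fun ξ => f (ξ.1, -ξ.2) :=
  Lp.coeFn_compMeasurePreserving f measurePreserving_reflect

theorem ca_reflect (k : ℤ × ℤ) (f : L2) : ca k (reflect f) = ca (k.1, -k.2) f := by
  rw [ca_eq, ca_eq, ← integral_reflect]
  refine integral_congr_ae ?_
  have h := measurePreserving_reflect.quasiMeasurePreserving.ae (coeFn_reflect f)
  filter_upwards [h] with ξ h
  rw [h, cs_apply, cs_apply, expo_reflect]; simp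

theorem sb_reflect (k : ℤ × ℤ) (f : L2) : sb k (reflect f) = sb (k.1, -k.2) f := by
  rw [sb_eq, sb_eq, ← integral_reflect]
  refine integral_congr_ae ?_
  have h := measurePreserving_reflect.quasiMeasurePreserving.ae (coeFn_reflect f)
  filter_upwards [h] with ξ h
  rw [h, sn_apply, sn_apply, expo_reflect]; simp

theorem EvenZ.evenCoeff {f : L2} (h : EvenZ f) : EvenCoeff f := by
  have e : reflect f = f := Lp.ext ((coeFn_reflect f).trans h)
  intro k
  rw [← ca_reflect, ← sb_reflect, e]
  exact ⟨rfl, rfl⟩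

theorem EvenCoeff.evenZ {f : L2} (h : EvenCoeff f) : EvenZ f := by
  have e : reflect f = f := ext_coeff (fun k => by rw [ca_reflect, (h k).1])
    (fun k => by rw [sb_reflect, (h k).2])
  have := coeFn_reflect f
  rw [e] at this
  exact this.symm

theorem IsDx.evenCoeff {f g : L2} (h : IsDx f g) (hf : EvenCoeff f) : EvenCoeff g := by
  intro k
  rw [(h k).1, (h k).2, (h (k.1, -k.2)).1, (h (k.1, -k.2)).2, (hf k).1, (hf k).2]
  exact ⟨rfl, rfl⟩

theorem IsDx.meanFree {f g : L2} (h : IsDx f g) (hf : MeanFree f) : MeanFree g := by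
  intro n
  rw [(h (n, 0)).1, (h (n, 0)).2, (hf n).1, (hf n).2]
  simp

theorem rep_neg {z : UnitAddCircle} (hz : z ≠ 0) : rep (-z) = 1 - rep z := by
  have h := rep_mem z
  have h0 : rep z ≠ 0 := fun h0 => hz (by rw [← coe_rep z, h0]; simp)
  have e : -z = ((1 - rep z : ℝ) : UnitAddCircle) := by
    rw [AddCircle.coe_sub, coe_rep, show ((1 : ℝ) : UnitAddCircle) = 0 from AddCircle.coe_period 1,
      zero_sub]
  have h1 : 0 < rep z := lt_of_le_of_ne h.1 (Ne.symm h0)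
  rw [e, rep_coe ⟨by linarith [h.2], by linarith⟩]

theorem ae_snd_ne_zero : ∀ᵐ ξ : Torus, ξ.2 ≠ 0 := by
  refine (Measure.quasiMeasurePreserving_snd (μ := (volume : Measure UnitAddCircle))
    (ν := (volume : Measure UnitAddCircle))).ae (p := fun z => z ≠ 0) ?_
  have h := AddCircle.volume_closedBall (1 : ℝ) (x := 0) 0
  simpa [ae_iff] using h

/-- An even function is orthogonal to an odd one. -/
theorem integral_even_mul_odd {f : L2} (hf : EvenZ f) {c : Torus → ℝ}
    (hc : ∀ ξ : Torus, c (ξ.1, -ξ.2) = c ξ) :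
    ∫ ξ : Torus, f ξ * ((1 / 2 - rep ξ.2) * c ξ) = 0 := by
  have h := integral_reflect fun ξ => f ξ * ((1 / 2 - rep ξ.2) * c ξ)
  have e : ∫ ξ : Torus, f (ξ.1, -ξ.2) * ((1 / 2 - rep (-ξ.2)) * c (ξ.1, -ξ.2)) =
      ∫ ξ : Torus, -(f ξ * ((1 / 2 - rep ξ.2) * c ξ)) := by
    refine integral_congr_ae ?_
    filter_upwards [hf, ae_snd_ne_zero] with ξ h1 h2
    rw [h1, hc, rep_neg h2]; ring
  rw [integral_neg] at e
  dsimp only at h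
  linarith

/-- Against a function of x alone, the adjoint primitive is multiplication by 1 - z = (1/2 - z) +
1/2. The first part is odd and is killed by evenness of f, the second by the vanishing pairing of f
with c. -/
theorem integral_primL_mul_horizontal {f : L2} (hf : EvenZ f) {c : C(Torus, ℝ)}
    (hc : ∀ ξ η : Torus, ξ.1 = η.1 → c ξ = c η) (h0 : ∫ ξ, f ξ * c ξ = 0) :
    ∫ ξ, primL f ξ * c ξ = 0 := by
  rw [integral_primL_mul]
  have e : ∀ ξ : Torus, f ξ * ∫ h in (rep ξ.2)..1, c (ξ.1, (h : UnitAddCircle)) =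
      f ξ * ((1 / 2 - rep ξ.2) * c ξ) + 1 / 2 * (f ξ * c ξ) := by
    intro ξ
    have : ∀ h : ℝ, c (ξ.1, (h : UnitAddCircle)) = c ξ := fun h => hc _ _ rfl
    simp only [this, intervalIntegral.integral_const, smul_eq_mul]
    ring
  have i2 := integrable_L2_mul f c
  have i1 : Integrable (fun ξ : Torus => f ξ * ((1 / 2 - rep ξ.2) * c ξ)) volume := by
    have : Integrable (fun ξ : Torus => (1 / 2 - rep ξ.2) * (f ξ * c ξ)) volume := by
      refine i2.bdd_mul (c := 1) ?_ (Eventually.of_forall fun ξ => ?_)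
      · exact ((measurable_rep.comp measurable_snd).const_sub _).aestronglyMeasurable
      · have := rep_mem ξ.2
        rw [Real.norm_eq_abs, abs_le]
        constructor <;> linarith [this.1, this.2]
    exact this.congr (Eventually.of_forall fun ξ => by ring)
  simp only [e]
  rw [integral_add i1 (i2.const_mul _), integral_const_mul, h0,
    integral_even_mul_odd hf fun ξ => hc _ _ rfl]
  simp

/-- This is where the symmetry in z enters: it makes the vertical velocity free of vertical mean, so
that a second primitive is again periodic and the frequencies k₂ = 0 of w vanish. -/
theorem MeanFree.primL {f : L2} (h : MeanFree f) (he : EvenCoeff f) : MeanFree (primL f) := by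
  have hx : ∀ (n : ℤ) (ξ η : Torus), ξ.1 = η.1 → expo (n, 0) ξ = expo (n, 0) η := by
    intro n ξ η e
    simp [expo_apply, e]
  intro n
  rw [ca_eq, sb_eq]
  constructor
  · refine integral_primL_mul_horizontal he.evenZ (fun ξ η e => ?_) ?_
    · rw [cs_apply, cs_apply, hx n ξ η e]
    · rw [← ca_eq, (h n).1]
  · refine integral_primL_mul_horizontal he.evenZ (fun ξ η e => ?_) ?_
    · rw [sn_apply, sn_apply, hx n ξ η e]
    · rw [← sb_eq, (h n).2]

/-! ### Vertical velocity and pressure in terms of Fourier coefficients -/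

/-- The ratio `k₁ / k₂` of the frequencies, `0` if `k₂ = 0`. -/
def ratio (k : ℤ × ℤ) : ℝ := k.1 / k.2

/-- The vertical velocity as an element of `L²`. -/
def vertL (f : L2) : L2 := -primL (Dx f)

theorem coeFn_vertL (f : L2) : vertL f =ᵐ[volume] vertVel f := by
  filter_upwards [Lp.coeFn_neg (primL (Dx f)), coeFn_primL (Dx f)] with ξ h1 h2
  rw [vertL, h1, Pi.neg_apply, h2]; rfl

theorem isDz_vertL {f : L2} (h : MeanFree (Dx f)) : IsDz (vertL f) (-Dx f) := by
  have h1 := h.isDz_primL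
  intro k
  rw [vertL, map_neg, map_neg, map_neg, map_neg, (h1 k).1, (h1 k).2]
  constructor <;> ring

/-- For k₂ ≠ 0 this is W_z = -U_x divided by 2πk₂. For k₂ = 0 the convention that `ratio` is 0
agrees with the vanishing vertical mean of the velocity. -/
theorem coeff_vertL {f : L2} (hx : IsDx f (Dx f)) (h : MeanFree (Dx f)) (he : EvenCoeff (Dx f))
    (k : ℤ × ℤ) : ca k (vertL f) = -(ratio k * ca k f) ∧ sb k (vertL f) = -(ratio k * sb k f) := by
  by_cases hk : k.2 = 0
  · have h1 := h.primL he k.1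
    have e : ((k.1, 0) : ℤ × ℤ) = k := Prod.ext rfl hk.symm
    rw [e] at h1
    simp [vertL, h1.1, h1.2, ratio, hk]
  · have h1 := (isDz_vertL h) k
    rw [map_neg, map_neg, (hx k).1, (hx k).2] at h1
    have hk' : (k.2 : ℝ) ≠ 0 := by exact_mod_cast hk
    have hpi := Real.pi_ne_zero
    unfold ratio
    constructor
    · field_simp
      have := h1.2
      have h3 : (2 * Real.pi) * (k.2 * ca k (vertL f) + k.1 * ca k f) = 0 := by linarith
      have := (mul_eq_zero.1 h3).resolve_left (by positivity)
      linarith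
    · field_simp
      have := h1.1
      have h3 : (2 * Real.pi) * (k.2 * sb k (vertL f) + k.1 * sb k f) = 0 := by linarith
      have := (mul_eq_zero.1 h3).resolve_left (by positivity)
      linarith

/-- Frequencies that are present in a velocity field. -/
def Good (k : ℤ × ℤ) : Prop := k.2 ≠ 0 ∨ k.1 = 0

/-- A frequency that is not `Good` has k₂ = 0 and k₁ ≠ 0, where the mean-free condition on ∂f/∂x
reads 2πk₁ times the coefficient equals 0. The momentum equation thus need not be examined there,
which is fortunate as the pressure has no simple symbol at those frequencies. -/
theorem coeff_eq_zero {f fx : L2} (hx : IsDx f fx) (h : MeanFree fx) {k : ℤ × ℤ} (hk : ¬ Good k) :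
    ca k f = 0 ∧ sb k f = 0 := by
  simp only [Good, not_or, not_not] at hk
  have e : ((k.1, 0) : ℤ × ℤ) = k := Prod.ext rfl hk.1.symm
  have h1 := h k.1
  rw [e, (hx k).1, (hx k).2] at h1
  have hk' : (2 * Real.pi * k.1 : ℝ) ≠ 0 := by
    have : (k.1 : ℝ) ≠ 0 := by exact_mod_cast hk.2
    have := Real.pi_ne_zero
    positivity
  exact ⟨(mul_eq_zero.1 (neg_eq_zero.1 h1.2)).resolve_left hk', (mul_eq_zero.1 h1.1).resolve_left hk'⟩

/-- The Fourier coefficients of the double primitive of `f`. -/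
theorem coeff_primL_primL {f : L2} (h : MeanFree f) (he : EvenCoeff f) (k : ℤ × ℤ) :
    (2 * Real.pi * k.2) ^ 2 * ca k (primL (primL f)) = -ca k f ∧
      (2 * Real.pi * k.2) ^ 2 * sb k (primL (primL f)) = -sb k f := by
  have h1 := h.isDz_primL k
  have h2 := (h.primL he).isDz_primL k
  rw [h1.1, h1.2, h2.1, h2.2]
  constructor <;> ring

theorem integral_cs_vertical {k : ℤ × ℤ} (hk : k.2 ≠ 0) (x : UnitAddCircle) :
    ∫ z, cs k (x, z) = 0 := by
  have h := integral_deriv_circle (f := fun z => sn k (x, z))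
    (f' := fun z => 2 * Real.pi * k.2 * cs k (x, z)) (by fun_prop)
    (fun t => by simpa using hasDerivAt_sn_z k (x, 0) t)
  rw [integral_const_mul] at h
  have hk' : (2 * Real.pi * k.2 : ℝ) ≠ 0 := by
    have : (k.2 : ℝ) ≠ 0 := by exact_mod_cast hk
    have := Real.pi_ne_zero
    positivity
  exact (mul_eq_zero.1 h).resolve_left hk'

theorem integral_sn_vertical {k : ℤ × ℤ} (hk : k.2 ≠ 0) (x : UnitAddCircle) :
    ∫ z, sn k (x, z) = 0 := by
  have h := integral_deriv_circle (f := fun z => cs k (x, z))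
    (f' := fun z => -(2 * Real.pi * k.2) * sn k (x, z)) (by fun_prop)
    (fun t => by simpa using hasDerivAt_cs_z k (x, 0) t)
  rw [integral_const_mul] at h
  have hk' : (-(2 * Real.pi * k.2) : ℝ) ≠ 0 := by
    have : (k.2 : ℝ) ≠ 0 := by exact_mod_cast hk
    have := Real.pi_ne_zero
    exact neg_ne_zero.2 (by positivity)
  exact (mul_eq_zero.1 h).resolve_left hk'

theorem integrable_vertical_mean {B : Torus → ℝ} (hB : Integrable B volume) :
    Integrable (fun ξ : Torus => ∫ z', B (ξ.1, z')) volume :=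
  (hB.integral_prod_left).comp_fst (volume : Measure UnitAddCircle)

theorem Integrable.mul_cont {B : Torus → ℝ} (hB : Integrable B volume) (e : C(Torus, ℝ)) :
    Integrable (fun ξ => B ξ * e ξ) volume :=
  hB.mul_bdd (c := ‖e‖) e.continuous.aestronglyMeasurable
    (Eventually.of_forall fun ξ => e.norm_coe_le_norm ξ)

/-- Testing a function of the form of the pressure with a function of zero vertical mean. -/
theorem integral_pressure_mul (c : ℝ) (A : L2) {A' B : Torus → ℝ} (hA : A =ᵐ[volume] A')
    (hB : Integrable B volume) (e : C(Torus, ℝ)) (he : ∀ x, ∫ z, e (x, z) = 0) :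
    ∫ ξ : Torus, (c * A' ξ + ∫ z', B (ξ.1, z')) * e ξ = c * ∫ ξ, A ξ * e ξ := by
  have i1 : Integrable (fun ξ => A ξ * e ξ) volume := Integrable.mul_cont (integrable_L2 A) e
  have i2 := Integrable.mul_cont (integrable_vertical_mean hB) e
  have e1 : ∫ ξ : Torus, (c * A' ξ + ∫ z', B (ξ.1, z')) * e ξ =
      ∫ ξ : Torus, (c * (A ξ * e ξ) + (∫ z', B (ξ.1, z')) * e ξ) := by
    refine integral_congr_ae ?_
    filter_upwards [hA] with ξ h
    rw [h]; ring
  rw [e1, integral_add (i1.const_mul c) i2, integral_const_mul, integral_torus i2]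
  simp only [integral_const_mul, he, mul_zero, integral_zero, add_zero]

theorem integral_pressure (c : ℝ) (A : L2) {A' B : Torus → ℝ} (hA : A =ᵐ[volume] A')
    (hB : Integrable B volume) :
    ∫ ξ : Torus, (c * A' ξ + ∫ z', B (ξ.1, z')) = c * (∫ ξ, A ξ) + ∫ ξ, B ξ := by
  have i2 := integrable_vertical_mean hB
  have e1 : ∫ ξ : Torus, (c * A' ξ + ∫ z', B (ξ.1, z')) =
      ∫ ξ : Torus, (c * A ξ + (∫ z', B (ξ.1, z'))) := by
    refine integral_congr_ae ?_
    filter_upwards [hA] with ξ h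
    rw [h]
  rw [e1, integral_add ((integrable_L2 A).const_mul c) i2, integral_const_mul, integral_torus i2,
    integral_torus hB]
  simp

theorem integrable_primZ_primZ (f : L2) : Integrable (primZ (primZ f)) volume :=
  (integrable_L2 (primL (primL f))).congr (coeFn_primL_primL f)

theorem integrable_pressure_mean (ε₂ : ℝ) (f : L2) :
    Integrable (fun ξ : Torus => - ε₂ * primZ (primZ (Dx f)) ξ - f ξ ^ 2) volume := by
  refine ((integrable_primZ_primZ _).const_mul _).sub ?_
  exact (integrable_mul_L2 f f).congr (Eventually.of_forall fun ξ => by ring)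

/-- The pressure of `f` tested with `∂φ/∂x` for trigonometric `φ`. -/
theorem integral_pressure_dX {ε₂ : ℝ} {f : L2} (hx : IsDx f (Dx f)) (h : MeanFree (Dx f))
    (he : EvenCoeff (Dx f)) {k : ℤ × ℤ} (hk : Good k) :
    ∫ ξ, pressure ε₂ f ξ * dX (cs k) ξ = -(ε₂ * ratio k ^ 2 * ca k f) ∧
      ∫ ξ, pressure ε₂ f ξ * dX (sn k) ξ = -(ε₂ * ratio k ^ 2 * sb k f) := by
  simp only [dX_cs, dX_sn]
  by_cases h1 : k.1 = 0
  · simp [h1, ratio]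
  have h2 : k.2 ≠ 0 := hk.resolve_right h1
  have hk' : (k.2 : ℝ) ≠ 0 := by exact_mod_cast h2
  have hpi := Real.pi_ne_zero
  -- As k₂ ≠ 0, the test function has zero vertical mean, so the part of the pressure that depends
  -- on x alone, including the quadratic term, disappears.
  have e1 := integral_pressure_mul ε₂ _ (coeFn_primL_primL (Dx f)) (integrable_pressure_mean ε₂ f)
    (cs k) (integral_cs_vertical h2)
  have e2 := integral_pressure_mul ε₂ _ (coeFn_primL_primL (Dx f)) (integrable_pressure_mean ε₂ f)
    (sn k) (integral_sn_vertical h2)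
  rw [← ca_eq] at e1
  rw [← sb_eq] at e2
  obtain ⟨c1, c2⟩ := coeff_primL_primL h he k
  rw [(hx k).1] at c1
  rw [(hx k).2] at c2
  simp only [mul_left_comm (pressure ε₂ f _), integral_const_mul]
  change ∫ ξ, pressure ε₂ f ξ * cs k ξ = _ at e1
  change ∫ ξ, pressure ε₂ f ξ * sn k ξ = _ at e2
  rw [e1, e2]
  set p := ca k (primL (primL (Dx f)))
  set q := sb k (primL (primL (Dx f)))
  have p' : p = -(2 * Real.pi * k.1 * sb k f) / (2 * Real.pi * k.2) ^ 2 := by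
    rw [eq_div_iff (by positivity)]; linarith
  have q' : q = (2 * Real.pi * k.1 * ca k f) / (2 * Real.pi * k.2) ^ 2 := by
    rw [eq_div_iff (by positivity)]; linarith
  rw [p', q', ratio]
  constructor <;> field_simp

theorem integrable_pressureX_mean (ε₂ : ℝ) (f : L2) :
    Integrable (fun ξ : Torus => - ε₂ * primZ (primZ (Dx (Dx f))) ξ - 2 * f ξ * Dx f ξ) volume := by
  refine ((integrable_primZ_primZ _).const_mul _).sub ?_
  exact ((integrable_mul_L2 f (Dx f)).const_mul 2).congr (Eventually.of_forall fun ξ => by ring)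

theorem cs_zero (ξ : Torus) : cs 0 ξ = 1 := by simp [cs_apply, expo_apply]

theorem sn_zero (ξ : Torus) : sn 0 ξ = 0 := by simp [sn_apply, expo_apply]

/-- The Fourier coefficients of the pressure gradient of `f`. -/
theorem integral_pressureX_mul {ε₂ : ℝ} {f : L2} (hx : IsDx f (Dx f)) (hxx : IsDx (Dx f) (Dx (Dx f)))
    (h : MeanFree (Dx f)) (he : EvenCoeff (Dx f)) {k : ℤ × ℤ} (hk : Good k) :
    ∫ ξ, pressureX ε₂ f ξ * cs k ξ = ε₂ * ratio k ^ 2 * ca k f ∧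
      ∫ ξ, pressureX ε₂ f ξ * sn k ξ = ε₂ * ratio k ^ 2 * sb k f := by
  by_cases h2 : k.2 = 0
  · have h1 : k.1 = 0 := hk.resolve_left (not_not.2 h2)
    have h0 : k = 0 := Prod.ext h1 h2
    subst h0
    have e := integral_pressure ε₂ _ (coeFn_primL_primL (Dx (Dx f)))
      (integrable_pressureX_mean ε₂ f)
    have e2 : ∫ ξ, (primL (primL (Dx (Dx f)))) ξ = ∫ ξ, primZ (primZ (Dx (Dx f))) ξ :=
      integral_congr_ae (coeFn_primL_primL _)
    have e3 : ∫ ξ, f ξ * Dx f ξ = 0 := by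
      have := hx.inner_left hx
      rw [real_inner_comm] at this
      rw [← inner_eq_integral]; linarith
    have e4 : ∫ ξ, 2 * f ξ * Dx f ξ = 0 := by
      simp only [mul_assoc, integral_const_mul, e3, mul_zero]
    rw [integral_sub ((integrable_primZ_primZ _).const_mul _)
      (((integrable_mul_L2 f (Dx f)).const_mul 2).congr (Eventually.of_forall fun ξ => by ring)),
      integral_const_mul, e4, e2] at e
    change ∫ ξ, pressureX ε₂ f ξ = _ at e
    simp only [cs_zero, sn_zero, mul_one, mul_zero, integral_zero, ratio]
    rw [e]
    constructor <;> simp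
  · have hk' : (k.2 : ℝ) ≠ 0 := by exact_mod_cast h2
    have hpi := Real.pi_ne_zero
    have e1 := integral_pressure_mul ε₂ _ (coeFn_primL_primL (Dx (Dx f)))
      (integrable_pressureX_mean ε₂ f) (cs k) (integral_cs_vertical h2)
    have e2 := integral_pressure_mul ε₂ _ (coeFn_primL_primL (Dx (Dx f)))
      (integrable_pressureX_mean ε₂ f) (sn k) (integral_sn_vertical h2)
    rw [← ca_eq] at e1
    rw [← sb_eq] at e2
    obtain ⟨c1, c2⟩ := coeff_primL_primL (hxx.meanFree h) (hxx.evenCoeff he) k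
    rw [(hxx k).1, (hx k).2] at c1
    rw [(hxx k).2, (hx k).1] at c2
    change ∫ ξ, pressureX ε₂ f ξ * cs k ξ = _ at e1
    change ∫ ξ, pressureX ε₂ f ξ * sn k ξ = _ at e2
    rw [e1, e2]
    set p := ca k (primL (primL (Dx (Dx f))))
    set q := sb k (primL (primL (Dx (Dx f))))
    have p' : p = (2 * Real.pi * k.1) ^ 2 * ca k f / (2 * Real.pi * k.2) ^ 2 := by
      rw [eq_div_iff (by positivity)]; linarith
    have q' : q = (2 * Real.pi * k.1) ^ 2 * sb k f / (2 * Real.pi * k.2) ^ 2 := by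
      rw [eq_div_iff (by positivity)]; linarith
    rw [p', q', ratio]
    constructor <;> field_simp

theorem ZeroMeanDx.meanFree {f : L2} (h : ZeroMeanDx f) : MeanFree (Dx f) := by
  have key : ∀ e : C(Torus, ℝ), (∀ x z, e (x, z) = e (x, 0)) →
      ∫ ξ, Dx f ξ * e ξ = 0 := by
    intro e he
    rw [integral_torus (Integrable.mul_cont (integrable_L2 _) e)]
    rw [integral_congr_ae (g := fun _ => (0 : ℝ)) ?_, integral_zero]
    filter_upwards [h] with x hx
    simp only [he x, integral_mul_const, hx, zero_mul]
  intro n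
  rw [ca_eq, sb_eq]
  refine ⟨key _ fun x z => ?_, key _ fun x z => ?_⟩
  · simp [cs_apply, expo_apply]
  · simp [sn_apply, expo_apply]

/-! ### Multiplication by a continuous function -/

theorem memLp_mul_cont (e : C(Torus, ℝ)) (f : L2) :
    MemLp (fun ξ => e ξ * f ξ) 2 (volume : Measure Torus) :=
  (Lp.memLp f).of_le_mul (c := ‖e‖)
    (e.continuous.aestronglyMeasurable.mul (Lp.aestronglyMeasurable f))
    (Eventually.of_forall fun ξ => by
      rw [norm_mul]
      exact mul_le_mul_of_nonneg_right (e.norm_coe_le_norm ξ) (norm_nonneg _))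

/-- Multiplication by a continuous function as a bounded operator on `L²`. -/
def mulC (e : C(Torus, ℝ)) : L2 →L[ℝ] L2 :=
  LinearMap.mkContinuous
    { toFun := fun f => (memLp_mul_cont e f).toLp
      map_add' := fun f g => by
        rw [← MemLp.toLp_add]
        refine (MemLp.toLp_eq_toLp_iff _ _).2 ?_
        filter_upwards [Lp.coeFn_add f g] with ξ h
        change e ξ * (f + g) ξ = e ξ * f ξ + e ξ * g ξ
        rw [h, Pi.add_apply, mul_add]
      map_smul' := fun c f => by
        rw [RingHom.id_apply, ← MemLp.toLp_const_smul]
        refine (MemLp.toLp_eq_toLp_iff _ _).2 ?_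
        filter_upwards [Lp.coeFn_smul c f] with ξ h
        change e ξ * (c • f) ξ = c * (e ξ * f ξ)
        rw [h, Pi.smul_apply, smul_eq_mul, mul_left_comm] }
    ‖e‖ fun f => by
      refine Lp.norm_le_mul_norm_of_ae_le_mul (c := ‖e‖) ?_
      filter_upwards [(memLp_mul_cont e f).coeFn_toLp] with ξ h
      simp only [LinearMap.coe_mk, AddHom.coe_mk]
      rw [h, norm_mul]
      exact mul_le_mul_of_nonneg_right (e.norm_coe_le_norm ξ) (norm_nonneg _)

theorem coeFn_mulC (e : C(Torus, ℝ)) (f : L2) : mulC e f =ᵐ[volume] fun ξ => e ξ * f ξ :=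
  (memLp_mul_cont e f).coeFn_toLp

/-- Written as a scalar product of one factor with a bounded operator applied to the other, a
coefficient of a product is visibly measurable in time when both factors are; measurability of
`mulL` itself is never needed. -/
theorem coeff_mulL {f h : L2} (hm : MemLp (fun ξ => f ξ * h ξ) 2 (volume : Measure Torus))
    {e : C(Torus, ℝ)} {l : L2 →L[ℝ] ℝ} (hl : ∀ f, l f = ∫ ξ, f ξ * e ξ) :
    l (mulL f h) = inner ℝ f (mulC e h) := by
  rw [hl, inner_eq_integral]
  refine integral_congr_ae ?_
  filter_upwards [coeFn_mulL hm, coeFn_mulC e h] with ξ h1 h2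
  rw [h1, h2]; ring

/-! ### Absolutely continuous functions of time -/

/-- `y` is a primitive of the integrable function `g` on `[0,T]`. -/
def HasPrim (T : ℝ) (y g : ℝ → ℝ) : Prop :=
  IntervalIntegrable g volume 0 T ∧ ∀ t ∈ Icc 0 T, y t = y 0 + ∫ s in (0 : ℝ)..t, g s

theorem setIntegral_Ioo_eq {T : ℝ} (hT : 0 < T) (f : ℝ → ℝ) :
    ∫ t in Ioo 0 T, f t = ∫ t in (0 : ℝ)..T, f t := by
  rw [intervalIntegral.integral_of_le hT.le, integral_Ioc_eq_integral_Ioo]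

theorem intervalIntegrable_of_Ioo {T : ℝ} (hT : 0 < T) {f : ℝ → ℝ}
    (h : Integrable f (volume.restrict (Ioo 0 T))) : IntervalIntegrable f volume 0 T := by
  rw [intervalIntegrable_iff_integrableOn_Ioo_of_le hT.le]
  exact h

theorem IntervalIntegrable.mono_time {T t : ℝ} {f : ℝ → ℝ} (h : IntervalIntegrable f volume 0 T)
    (ht : t ∈ Icc 0 T) : IntervalIntegrable f volume 0 t :=
  h.mono_set (by
    rw [uIcc_of_le ht.1, uIcc_of_le (ht.1.trans ht.2)]
    exact Icc_subset_Icc_right ht.2)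

theorem ae_time_of_ae_Ioo {T t : ℝ} (ht : t ∈ Icc 0 T) {p : ℝ → Prop}
    (h : ∀ᵐ s ∂(volume.restrict (Ioo 0 T)), p s) :
    ∀ᵐ s ∂(volume.restrict (Ioc 0 t)), p s := by
  rw [restrict_Ioo_eq_restrict_Ioc] at h
  exact ae_restrict_of_ae_restrict_of_subset (Ioc_subset_Ioc_right ht.2) h

theorem integral_congr_time {T t : ℝ} (ht : t ∈ Icc 0 T) {f g : ℝ → ℝ}
    (h : ∀ᵐ s ∂(volume.restrict (Ioo 0 T)), f s = g s) :
    ∫ s in (0 : ℝ)..t, f s = ∫ s in (0 : ℝ)..t, g s := by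
  rw [intervalIntegral.integral_of_le ht.1, intervalIntegral.integral_of_le ht.1]
  exact integral_congr_ae (ae_time_of_ae_Ioo ht h)

theorem integral_mono_time {T t : ℝ} (ht : t ∈ Icc 0 T) {f g : ℝ → ℝ}
    (hf : IntervalIntegrable f volume 0 T) (hg : IntervalIntegrable g volume 0 T)
    (h : ∀ᵐ s ∂(volume.restrict (Ioo 0 T)), f s ≤ g s) :
    ∫ s in (0 : ℝ)..t, f s ≤ ∫ s in (0 : ℝ)..t, g s := by
  rw [intervalIntegral.integral_of_le ht.1, intervalIntegral.integral_of_le ht.1]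
  exact integral_mono_ae (IntervalIntegrable.mono_time hf ht).1
    (IntervalIntegrable.mono_time hg ht).1 (ae_time_of_ae_Ioo ht h)

theorem continuousOn_primitive {T : ℝ} (hT : 0 < T) {g : ℝ → ℝ}
    (hg : IntervalIntegrable g volume 0 T) :
    ContinuousOn (fun t => ∫ s in (0 : ℝ)..t, g s) (Icc 0 T) := by
  have := intervalIntegral.continuousOn_primitive_interval' hg (left_mem_uIcc)
  rwa [uIcc_of_le hT.le] at this

theorem HasPrim.continuousOn {T : ℝ} (hT : 0 < T) {y g : ℝ → ℝ} (h : HasPrim T y g) :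
    ContinuousOn y (Icc 0 T) :=
  ((continuousOn_primitive hT h.1).const_add (y 0)).congr h.2

theorem HasPrim.add {T : ℝ} {y g y' g' : ℝ → ℝ} (h : HasPrim T y g) (h' : HasPrim T y' g') :
    HasPrim T (fun t => y t + y' t) (fun t => g t + g' t) := by
  refine ⟨h.1.add h'.1, fun t ht => ?_⟩
  rw [intervalIntegral.integral_add (IntervalIntegrable.mono_time h.1 ht)
    (IntervalIntegrable.mono_time h'.1 ht)]
  linarith [h.2 t ht, h'.2 t ht]

theorem HasPrim.const_mul {T : ℝ} {y g : ℝ → ℝ} (c : ℝ) (h : HasPrim T y g) :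
    HasPrim T (fun t => c * y t) (fun t => c * g t) := by
  refine ⟨h.1.const_mul c, fun t ht => ?_⟩
  rw [intervalIntegral.integral_const_mul]
  simp only [h.2 t ht]
  ring

theorem HasPrim.congr {T : ℝ} (hT : 0 < T) {y g g' : ℝ → ℝ} (h : HasPrim T y g)
    (h' : ∀ᵐ t ∂(volume.restrict (Ioo 0 T)), g t = g' t) : HasPrim T y g' := by
  refine ⟨intervalIntegrable_of_Ioo hT ?_, fun t ht => ?_⟩
  · exact ((intervalIntegrable_iff_integrableOn_Ioo_of_le hT.le).1 h.1).congr h'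
  · rw [h.2 t ht, integral_congr_time ht h']

/-- Primitives of integrable functions are absolutely continuous, so integration by parts applies to
them. The functions y and y' are replaced by their primitive formulas because nothing is known about
them outside [0,T]. -/
theorem HasPrim.mul {T : ℝ} (hT : 0 < T) {y g y' g' : ℝ → ℝ} (h : HasPrim T y g)
    (h' : HasPrim T y' g') :
    HasPrim T (fun t => y t * y' t) (fun t => g t * y' t + y t * g' t) := by
  have c := h.continuousOn hT
  have c' := h'.continuousOn hT
  rw [← uIcc_of_le hT.le] at c c'
  refine ⟨(h.1.mul_continuousOn c').add (h'.1.continuousOn_mul c), fun t ht => ?_⟩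
  have i1 := IntervalIntegrable.mono_time h.1 ht
  have i2 := IntervalIntegrable.mono_time h'.1 ht
  have a1 : AbsolutelyContinuousOnInterval (fun x => y 0 + ∫ s in (0 : ℝ)..x, g s) 0 t :=
    (contDiff_const.contDiffOn.absolutelyContinuousOnInterval).fun_add
      (i1.absolutelyContinuousOnInterval_intervalIntegral (by simp))
  have a2 : AbsolutelyContinuousOnInterval (fun x => y' 0 + ∫ s in (0 : ℝ)..x, g' s) 0 t :=
    (contDiff_const.contDiffOn.absolutelyContinuousOnInterval).fun_add
      (i2.absolutelyContinuousOnInterval_intervalIntegral (by simp))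
  have e := a1.integral_deriv_mul_eq_sub a2
  simp only [intervalIntegral.integral_same, add_zero] at e
  rw [← h.2 t ht, ← h'.2 t ht] at e
  have e2 : ∫ s in (0 : ℝ)..t, (g s * y' s + y s * g' s) = y t * y' t - y 0 * y' 0 := by
    rw [← e]
    refine intervalIntegral.integral_congr_ae ?_
    filter_upwards [i1.ae_hasDerivAt_integral, i2.ae_hasDerivAt_integral] with x hx1 hx2 hx
    have hx' := uIoc_subset_uIcc hx
    have hxt : x ∈ Icc 0 T := by
      rw [uIcc_of_le ht.1] at hx'
      exact ⟨hx'.1, hx'.2.trans ht.2⟩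
    rw [((hx1 hx' 0 left_mem_uIcc).const_add (y 0)).deriv,
      ((hx2 hx' 0 left_mem_uIcc).const_add (y' 0)).deriv, h.2 x hxt, h'.2 x hxt]
  rw [e2]; ring

/-- A smooth compactly supported function of zero mean is the derivative of a test function. -/
theorem exists_isTimeTest_deriv {T : ℝ} (hT : 0 < T) {ψ : ℝ → ℝ} (hψ : IsTimeTest T ψ)
    (h0 : ∫ t, ψ t = 0) : ∃ η, IsTimeTest T η ∧ deriv η = ψ := by
  obtain ⟨hs, hc, hsub⟩ := hψ
  -- The point T/2 is added only to keep the compact set nonempty when ψ vanishes identically, so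
  -- that it has a least and a greatest element.
  have hK : IsCompact (insert (T / 2) (tsupport ψ)) := hc.isCompact.insert _
  have hKT : insert (T / 2) (tsupport ψ) ⊆ Ioo 0 T :=
    insert_subset ⟨by linarith, by linarith⟩ hsub
  obtain ⟨a, ha⟩ := hK.exists_isLeast (insert_nonempty _ _)
  obtain ⟨b, hb⟩ := hK.exists_isGreatest (insert_nonempty _ _)
  have hψ0 : ∀ t, t ∉ Icc a b → ψ t = 0 := fun t ht => by
    by_contra hne
    have : t ∈ tsupport ψ := subset_tsupport _ hne
    exact ht ⟨ha.2 (mem_insert_of_mem _ this), hb.2 (mem_insert_of_mem _ this)⟩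
  have ha0 := (hKT ha.1).1
  have hbT := (hKT hb.1).2
  let η : ℝ → ℝ := fun t => ∫ s in (0 : ℝ)..t, ψ s
  have hd : ∀ t, HasDerivAt η (ψ t) t := fun t => hs.continuous.integral_hasStrictDerivAt 0 t |>.hasDerivAt
  have hderiv : deriv η = ψ := funext fun t => (hd t).deriv
  have hsupp : Function.support η ⊆ Icc a b := by
    intro t ht
    by_contra hnot
    refine ht ?_
    rcases lt_or_ge t a with hta | hta
    · refine (intervalIntegral.integral_congr (g := fun _ => (0 : ℝ)) fun s hs' => ?_).trans (by simp)
      refine hψ0 s fun hs2 => ?_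
      have : s ≤ max 0 t := hs'.2
      have h3 : max 0 t < a := max_lt ha0 hta
      linarith [hs2.1]
    · have htb : b < t := lt_of_not_ge fun h => hnot ⟨hta, h⟩
      change ∫ s in (0 : ℝ)..t, ψ s = 0
      rw [intervalIntegral.integral_eq_integral_of_support_subset, h0]
      intro s hs2
      have hs3 : s ∈ Icc a b := by
        by_contra h; exact hs2 (hψ0 s h)
      exact ⟨ha0.trans_le hs3.1, hs3.2.trans htb.le⟩
  refine ⟨η, ⟨?_, ?_, ?_⟩, hderiv⟩
  · rw [contDiff_infty_iff_deriv, hderiv]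
    exact ⟨fun t => (hd t).differentiableAt, hs⟩
  · exact HasCompactSupport.of_support_subset_isCompact isCompact_Icc hsupp
  · exact (closure_minimal hsupp isClosed_Icc).trans (Icc_subset_Ioo ha0 hbT)

theorem IsTimeTest.zero {T : ℝ} {η : ℝ → ℝ} (h : IsTimeTest T η) {t : ℝ} (ht : t ∉ Ioo 0 T) :
    η t = 0 := image_eq_zero_of_notMem_tsupport fun h' => ht (h.2.2 h')

/-- A continuous function with zero weak derivative is constant. -/
theorem eq_of_weak_deriv_zero {T : ℝ} (hT : 0 < T) {y : ℝ → ℝ} (hy : ContinuousOn y (Icc 0 T))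
    (h : ∀ η, IsTimeTest T η → ∫ t in Ioo 0 T, deriv η t * y t = 0) {t : ℝ} (ht : t ∈ Icc 0 T) :
    y t = y 0 := by
  -- Du Bois-Reymond: θ is a fixed test function of mass 1, so ψ - (∫ψ)θ has zero mean and is the
  -- derivative of a test function. Pairing it with y shows that y acts on test functions as the
  -- constant C.
  let θb : ContDiffBump (T / 2) := ⟨T / 8, T / 4, by linarith, by linarith⟩
  set θ : ℝ → ℝ := θb.normed volume with hθ
  have hθt : IsTimeTest T θ := by
    refine ⟨θb.contDiff_normed, θb.hasCompactSupport_normed, ?_⟩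
    rw [hθ, θb.tsupport_normed_eq, Real.closedBall_eq_Icc]
    refine Icc_subset_Ioo ?_ ?_
    · change 0 < T / 2 - T / 4; linarith
    · change T / 2 + T / 4 < T; linarith
  have hθ1 : ∫ t, θ t = 1 := θb.integral_normed
  have iy : IntegrableOn y (Ioo 0 T) := (hy.integrableOn_Icc).mono_set Ioo_subset_Icc_self
  have imul : ∀ ψ : ℝ → ℝ, Continuous ψ → IntegrableOn (fun t => ψ t * y t) (Ioo 0 T) := fun ψ hψ =>
    ((hψ.continuousOn.mul hy).integrableOn_Icc).mono_set Ioo_subset_Icc_self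
  set C := ∫ t in Ioo 0 T, θ t * y t with hC
  have full : ∀ ψ : ℝ → ℝ, IsTimeTest T ψ → ∫ t in Ioo 0 T, ψ t * y t = (∫ t, ψ t) * C := by
    intro ψ hψ
    set c := ∫ t, ψ t with hc
    have hψθ : IsTimeTest T (fun t => ψ t - c * θ t) := by
      refine ⟨hψ.1.sub (contDiff_const.mul hθt.1), hψ.2.1.sub (hθt.2.1.mul_left), ?_⟩
      refine (tsupport_sub _ _).trans (union_subset hψ.2.2 ?_)
      exact (tsupport_mul_subset_right).trans hθt.2.2
    obtain ⟨η, hη, hd⟩ := exists_isTimeTest_deriv hT hψθ (by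
      rw [integral_sub (hψ.1.continuous.integrable_of_hasCompactSupport hψ.2.1)
        ((hθt.1.continuous.integrable_of_hasCompactSupport hθt.2.1).const_mul c),
        integral_const_mul, hθ1]
      simp [hc])
    have h1 := h η hη
    rw [hd] at h1
    simp only [sub_mul, mul_assoc] at h1
    rw [integral_sub (imul ψ hψ.1.continuous) ((imul θ hθt.1.continuous).const_mul c),
      integral_const_mul] at h1
    linarith
  have hae : ∀ᵐ t, t ∈ Ioo 0 T → y t - C = 0 := by
    refine isOpen_Ioo.ae_eq_zero_of_integral_contDiff_smul_eq_zero
      ((iy.sub (integrableOn_const (by simp))).locallyIntegrableOn) fun ψ h1 h2 h3 => ?_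
    have hψ : IsTimeTest T ψ := ⟨h1, h2, h3⟩
    have e : ∫ t, ψ t • (y t - C) = ∫ t in Ioo 0 T, ψ t • (y t - C) :=
      (setIntegral_eq_integral_of_forall_compl_eq_zero fun t ht => by
        rw [hψ.zero ht, zero_smul]).symm
    have e2 : ∫ t, ψ t = ∫ t in Ioo 0 T, ψ t :=
      (setIntegral_eq_integral_of_forall_compl_eq_zero fun t ht => hψ.zero ht).symm
    rw [e]
    simp only [smul_eq_mul, mul_sub]
    rw [integral_sub (imul ψ h1.continuous)
      ((h1.continuous.integrable_of_hasCompactSupport h2).integrableOn.mul_const C),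
      full ψ hψ, integral_mul_const, e2, sub_self]
  have heq : EqOn y (fun _ => C) (Icc 0 T) := by
    refine Measure.eqOn_Icc_of_ae_eq volume hT.ne ?_ hy continuousOn_const
    rw [← restrict_Ioo_eq_restrict_Icc]
    filter_upwards [ae_restrict_of_ae hae, ae_restrict_mem measurableSet_Ioo] with t h1 h2
    linarith [h1 h2]
  rw [heq ht, heq (left_mem_Icc.2 hT.le)]

/-- A continuous function with an integrable weak derivative is a primitive of it. -/
theorem HasPrim.of_weak {T : ℝ} (hT : 0 < T) {y g : ℝ → ℝ} (hy : ContinuousOn y (Icc 0 T))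
    (hg : Integrable g (volume.restrict (Ioo 0 T)))
    (h : ∀ η, IsTimeTest T η → ∫ t in Ioo 0 T, deriv η t * y t = -∫ t in Ioo 0 T, η t * g t) :
    HasPrim T y g := by
  have ig := intervalIntegrable_of_Ioo hT hg
  refine ⟨ig, fun t ht => ?_⟩
  have hG : HasPrim T (fun t => ∫ s in (0 : ℝ)..t, g s) g := ⟨ig, fun t _ => by simp⟩
  have cG := continuousOn_primitive hT ig
  -- The difference of y and the primitive of g has zero weak derivative; the boundary terms in the
  -- integration by parts vanish because η is zero at 0 and T.
  have key := eq_of_weak_deriv_zero hT (y := fun t => y t - ∫ s in (0 : ℝ)..t, g s) (hy.sub cG)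
    (fun η hη => ?_) ht
  · simp only [intervalIntegral.integral_same, sub_zero] at key
    linarith
  · have cd : Continuous (deriv η) := hη.1.continuous_deriv (by simp)
    have hηp : HasPrim T η (deriv η) := by
      refine ⟨cd.intervalIntegrable _ _, fun t _ => ?_⟩
      rw [intervalIntegral.integral_deriv_eq_sub (fun x _ => hη.1.differentiable (by simp) x)
        (cd.intervalIntegrable _ _)]
      ring
    have e := (hηp.mul hT hG).2 T (right_mem_Icc.2 hT.le)
    beta_reduce at e
    rw [hη.zero (t := T) (by simp), hη.zero (t := 0) (by simp)] at e
    have cG' : ContinuousOn (fun t => ∫ s in (0 : ℝ)..t, g s) (uIcc 0 T) := by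
      rwa [uIcc_of_le hT.le]
    rw [intervalIntegral.integral_add ((cd.intervalIntegrable _ _).mul_continuousOn cG')
      (ig.continuousOn_mul hη.1.continuous.continuousOn), zero_mul, zero_mul,
      ← setIntegral_Ioo_eq hT (fun x => deriv η x * ∫ s in (0 : ℝ)..x, g s),
      ← setIntegral_Ioo_eq hT (fun x => η x * g x)] at e
    simp only [mul_sub]
    rw [integral_sub, h η hη]
    · linarith
    · exact ((cd.continuousOn.mul hy).integrableOn_Icc).mono_set Ioo_subset_Icc_self
    · exact ((cd.continuousOn.mul cG).integrableOn_Icc).mono_set Ioo_subset_Icc_self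

/-- An inequality between continuous functions that holds almost everywhere holds everywhere. -/
theorem le_of_ae_le {T : ℝ} (hT : 0 < T) {f g : ℝ → ℝ} (hf : ContinuousOn f (Icc 0 T))
    (hg : ContinuousOn g (Icc 0 T)) (h : ∀ᵐ t ∂(volume.restrict (Ioo 0 T)), f t ≤ g t) {t : ℝ}
    (ht : t ∈ Icc 0 T) : f t ≤ g t := by
  have : EqOn (fun t => max (f t) (g t)) g (Icc 0 T) := by
    refine Measure.eqOn_Icc_of_ae_eq volume hT.ne ?_ (hf.sup hg) hg
    rw [← restrict_Ioo_eq_restrict_Icc]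
    filter_upwards [h] with t h
    exact max_eq_right h
  exact max_eq_right_iff.1 (this ht)

theorem HasPrim.pow {T : ℝ} (hT : 0 < T) {y g : ℝ → ℝ} (h : HasPrim T y g) (n : ℕ) :
    HasPrim T (fun t => y t ^ (n + 1)) (fun t => (n + 1) * (g t * y t ^ n)) := by
  induction n with
  | zero => simpa using h
  | succ n ih =>
    have := ih.mul hT h
    refine HasPrim.congr hT ?_ (g := fun t => (n + 1) * (g t * y t ^ n) * y t + y t ^ (n + 1) * g t)
      (Eventually.of_forall fun t => by push_cast; ring)
    simpa only [pow_succ] using this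

/-- Grönwall's inequality with an integrable coefficient. -/
theorem gronwall {T : ℝ} (hT : 0 < T) {y Φ : ℝ → ℝ} {δ : ℝ} (hδ : 0 ≤ δ)
    (hy : ContinuousOn y (Icc 0 T)) (hΦ : IntervalIntegrable Φ volume 0 T)
    (hΦ0 : ∀ t, 0 ≤ Φ t)
    (h : ∀ t ∈ Icc 0 T, y t ≤ δ + ∫ s in (0 : ℝ)..t, Φ s * y s) {t : ℝ} (ht : t ∈ Icc 0 T) :
    y t ≤ δ * Real.exp (∫ s in (0 : ℝ)..t, Φ s) := by
  obtain ⟨K, hK⟩ := isCompact_Icc.exists_bound_of_continuousOn hy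
  set Ψ : ℝ → ℝ := fun t => ∫ s in (0 : ℝ)..t, Φ s with hΨ
  have hΨp : HasPrim T Ψ Φ := ⟨hΦ, fun t _ => by simp [hΨ]⟩
  have hΨ0 : ∀ t ∈ Icc 0 T, 0 ≤ Ψ t := fun t ht =>
    intervalIntegral.integral_nonneg ht.1 fun s _ => hΦ0 s
  have cΨ : ContinuousOn Ψ (Icc 0 T) := continuousOn_primitive hT hΦ
  have cΨ' : ∀ n : ℕ, ContinuousOn (fun t => Ψ t ^ n) (uIcc 0 T) := fun n => by
    rw [uIcc_of_le hT.le]; exact cΨ.pow n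
  have ipow : ∀ n : ℕ, ∀ t ∈ Icc 0 T,
      ∫ s in (0 : ℝ)..t, Φ s * (Ψ s ^ n / n.factorial) = Ψ t ^ (n + 1) / (n + 1).factorial := by
    intro n t ht
    have e := (hΨp.pow hT n).2 t ht
    rw [intervalIntegral.integral_const_mul] at e
    have h0 : Ψ 0 = 0 := by simp [hΨ]
    beta_reduce at e
    rw [h0, zero_pow (Nat.succ_ne_zero n), zero_add] at e
    simp only [← mul_div_assoc]
    rw [intervalIntegral.integral_div, e, Nat.factorial_succ]
    have : (n.factorial : ℝ) ≠ 0 := by positivity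
    push_cast
    field_simp
  have iint : ∀ n : ℕ, IntervalIntegrable (fun s => Φ s * (Ψ s ^ n / n.factorial)) volume 0 T :=
    fun n => hΦ.mul_continuousOn ((cΨ' n).div_const _)
  have iy : IntervalIntegrable (fun s => Φ s * y s) volume 0 T :=
    hΦ.mul_continuousOn (by rwa [uIcc_of_le hT.le])
  -- Iterating the integral inequality n times yields a partial sum of the exponential series and a
  -- remainder KΨⁿ/n!, which tends to 0. No derivative of y is taken.
  have key : ∀ n : ℕ, ∀ t ∈ Icc 0 T, y t ≤
      δ * (∑ j ∈ Finset.range n, Ψ t ^ j / j.factorial) + K * (Ψ t ^ n / n.factorial) := by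
    intro n
    induction n with
    | zero => intro t ht; simpa using (le_abs_self _).trans (hK t ht)
    | succ n ih =>
      intro t ht
      have isum : IntervalIntegrable (fun s => ∑ j ∈ Finset.range n,
          Φ s * (Ψ s ^ j / j.factorial)) volume 0 T := by
        have := IntervalIntegrable.sum (Finset.range n) fun j _ => iint j
        rwa [show (∑ j ∈ Finset.range n, fun s => Φ s * (Ψ s ^ j / j.factorial)) = fun s =>
          ∑ j ∈ Finset.range n, Φ s * (Ψ s ^ j / j.factorial) from funext fun s => by simp] at this
      have h1 : ∫ s in (0 : ℝ)..t, Φ s * y s ≤ ∫ s in (0 : ℝ)..t,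
          (δ * (∑ j ∈ Finset.range n, Φ s * (Ψ s ^ j / j.factorial)) +
            K * (Φ s * (Ψ s ^ n / n.factorial))) := by
        refine intervalIntegral.integral_mono_on ht.1 (IntervalIntegrable.mono_time iy ht)
          (IntervalIntegrable.mono_time ((isum.const_mul δ).add ((iint n).const_mul K)) ht)
          fun s hs => ?_
        have := mul_le_mul_of_nonneg_left (ih s ⟨hs.1, hs.2.trans ht.2⟩) (hΦ0 s)
        rw [← Finset.mul_sum]
        linarith
      rw [intervalIntegral.integral_add (IntervalIntegrable.mono_time (isum.const_mul δ) ht)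
        (IntervalIntegrable.mono_time ((iint n).const_mul K) ht),
        intervalIntegral.integral_const_mul, intervalIntegral.integral_const_mul, ipow n t ht,
        intervalIntegral.integral_finsetSum fun j _ => IntervalIntegrable.mono_time (iint j) ht,
        Finset.sum_congr rfl fun j _ => ipow j t ht] at h1
      rw [Finset.sum_range_succ']
      simp only [pow_zero, Nat.factorial_zero, Nat.cast_one, div_one]
      linarith [h t ht]
  have lim : Tendsto (fun n : ℕ => δ * Real.exp (Ψ t) + K * (Ψ t ^ n / n.factorial)) atTop
      (𝓝 (δ * Real.exp (Ψ t) + K * 0)) :=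
    tendsto_const_nhds.add ((FloorSemiring.tendsto_pow_div_factorial_atTop (Ψ t)).const_mul K)
  rw [mul_zero, add_zero] at lim
  refine ge_of_tendsto lim (Eventually.of_forall fun n => (key n t ht).trans ?_)
  have := Real.sum_le_exp_of_nonneg (hΨ0 t ht) n
  gcongr

/-! ### Instantaneous estimates -/

/-- The regularity of a velocity field at a fixed time. -/
structure Reg (f : L2) : Prop where
  dx : IsDx f (Dx f)
  dz : IsDz f (Dz f)
  dzx : IsDx (Dz f) (Dx (Dz f))
  dzz : IsDz (Dz f) (Dz (Dz f))
  mean : MeanFree (Dx f)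
  even : EvenCoeff (Dx f)

theorem Reg.of_weak {f : L2} (h1 : DxInL2 f) (h2 : DzInL2 f) (h3 : DxInL2 (Dz f))
    (h4 : DzInL2 (Dz f)) (h5 : ZeroMeanDx f) (h6 : EvenZ f) : Reg f :=
  ⟨h1.isDx, h2.isDz, h3.isDx, h4.isDz, h5.meanFree, h1.isDx.evenCoeff h6.evenCoeff⟩

theorem Reg.dxz {f : L2} (h : Reg f) : IsDz (Dx f) (Dx (Dz f)) := h.dx.mixed h.dz h.dzx

theorem Reg.vert {f : L2} (h : Reg f) : IsDz (vertL f) (-Dx f) := isDz_vertL h.mean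

/-- The quadratic term `f fₓ + w f_z`. -/
def quad (f : L2) : L2 := mulL (Dx f) f + mulL (vertL f) (Dz f)

/-- The terms of the momentum equation other than the time derivative and the pressure. -/
def force (ν ε₁ : ℝ) (f : L2) : L2 := -(ν • Dz (Dz f)) + quad f + ε₁ • f

theorem Reg.coeFn_force {f : L2} (h : Reg f) (ν ε₁ : ℝ) :
    force ν ε₁ f =ᵐ[volume] fun ξ => -ν * Dz (Dz f) ξ + f ξ * Dx f ξ
      + vertVel f ξ * Dz f ξ + ε₁ * f ξ := by
  filter_upwards [Lp.coeFn_add (-(ν • Dz (Dz f)) + quad f) (ε₁ • f),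
    Lp.coeFn_add (-(ν • Dz (Dz f))) (quad f), Lp.coeFn_neg (ν • Dz (Dz f)),
    Lp.coeFn_smul ν (Dz (Dz f)), Lp.coeFn_smul ε₁ f,
    Lp.coeFn_add (mulL (Dx f) f) (mulL (vertL f) (Dz f)), coeFn_mulL (h.dxz.memLp_mul h.dx),
    coeFn_mulL (h.vert.memLp_mul h.dzx), coeFn_vertL f] with ξ e1 e2 e3 e4 e5 e6 e7 e8 e9
  rw [force, e1, Pi.add_apply, e2, Pi.add_apply, e3, Pi.neg_apply, e4, e5, Pi.smul_apply,
    Pi.smul_apply, quad, e6, Pi.add_apply, e7, e8, e9, smul_eq_mul, smul_eq_mul]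
  ring

theorem norm_vertL_le (f : L2) : ‖vertL f‖ ≤ ‖Dx f‖ := by
  rw [vertL, norm_neg]
  have h1 : ‖primL (Dx f)‖ ≤ 1 * ‖Dx f‖ :=
    primL.le_of_opNorm_le (LinearMap.mkContinuous_norm_le _ zero_le_one _) _
  linarith

theorem aniso_le {f g : L2} {C : ℝ} (hf : ‖f‖ ≤ C) (hg : ‖g‖ ≤ C) : aniso f g ≤ 3 * C ^ 2 := by
  unfold aniso
  have h1 : ‖f‖ ^ 2 ≤ C ^ 2 := pow_le_pow_left₀ (norm_nonneg _) hf 2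
  have h2 : ‖f‖ * ‖g‖ ≤ C * C := mul_le_mul hf hg (norm_nonneg _) ((norm_nonneg _).trans hf)
  nlinarith

theorem norm_mulL_le {f fz h hx : L2} (hf : IsDz f fz) (hh : IsDx h hx) {C : ℝ} (h1 : ‖f‖ ≤ C)
    (h2 : ‖fz‖ ≤ C) (h3 : ‖h‖ ≤ C) (h4 : ‖hx‖ ≤ C) : ‖mulL f h‖ ≤ 3 * C ^ 2 := by
  refine le_of_sq_le_sq ?_ (by positivity)
  refine (hf.norm_mulL_sq_le hh).trans ?_
  rw [sq (3 * C ^ 2)]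
  exact mul_le_mul (aniso_le h1 h2) (aniso_le h3 h4) (aniso_nonneg _ _) (by positivity)

/-- A crude bound, needed only for integrability in time and for domination of frequency sums. The
constant C may depend on α and does not enter the final estimate. -/
theorem Reg.norm_force_le {f : L2} (h : Reg f) {ν ε₁ C : ℝ} (hν : 0 < ν) (hε₁ : 0 < ε₁)
    (h1 : ‖f‖ ≤ C) (h2 : ‖Dx f‖ ≤ C) (h3 : ‖Dz f‖ ≤ C) (h4 : ‖Dx (Dz f)‖ ≤ C)
    (h5 : ‖Dz (Dz f)‖ ≤ C) : ‖force ν ε₁ f‖ ≤ ν * C + 6 * C ^ 2 + ε₁ * C := by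
  have e1 := norm_mulL_le h.dxz h.dx h2 h4 h1 h2
  have e2 := norm_mulL_le h.vert h.dzx ((norm_vertL_le f).trans h2) (by rwa [norm_neg]) h3 h4
  have e3 : ‖ν • Dz (Dz f)‖ ≤ ν * C := by
    rw [norm_smul, Real.norm_of_nonneg hν.le]; gcongr
  have e4 : ‖ε₁ • f‖ ≤ ε₁ * C := by
    rw [norm_smul, Real.norm_of_nonneg hε₁.le]; gcongr
  have e5 : ‖quad f‖ ≤ 6 * C ^ 2 := by
    refine (norm_add_le _ _).trans ?_
    linarith
  unfold force
  refine (norm_add_le _ _).trans (add_le_add ((norm_add_le _ _).trans (add_le_add ?_ e5)) e4)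
  rwa [norm_neg]

/-- The force tested with `f_zz`. -/
theorem Reg.inner_force_zz {f : L2} (h : Reg f) (ν ε₁ : ℝ) :
    inner ℝ (force ν ε₁ f) (Dz (Dz f)) = -(ν * ‖Dz (Dz f)‖ ^ 2) - ε₁ * ‖Dz f‖ ^ 2 := by
  have h1 : inner ℝ (quad f) (Dz (Dz f)) = 0 := nonlinear_inner_zz h.dx h.dz h.dzx h.dzz h.vert
  have h2 := h.dz.inner_left h.dzz
  rw [real_inner_self_eq_norm_sq] at h2
  rw [force, inner_add_left, inner_add_left, h1, inner_neg_left, inner_smul_left, inner_smul_left,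
    real_inner_self_eq_norm_sq]
  simp only [conj_trivial]
  linear_combination ε₁ * h2

/-- The difference of two forces, tested with the difference of the velocities. -/
theorem Reg.inner_force_sub {U u : L2} (hU : Reg U) (hu : Reg u) (hxx : IsDx (Dx u) (Dx (Dx u)))
    (ν ε₁ : ℝ) :
    inner ℝ (force ν ε₁ U) (U - u) - inner ℝ (force ν ε₁ u) (U - u) =
      ν * ‖Dz U - Dz u‖ ^ 2 + ε₁ * ‖U - u‖ ^ 2 + inner ℝ (mulL (U - u) (Dx u)) (U - u)
        + inner ℝ (mulL (U - u) (Dz u)) (vertL U - vertL u) := by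
  have h1 : inner ℝ (quad U) (U - u) - inner ℝ (quad u) (U - u) = _ :=
    nonlinear_sub_inner hU.dx hU.dz hU.dzx hU.vert hu.dx hu.dz hu.dzx hxx hu.vert
  have h2 := (hU.dz.sub hu.dz).inner_left (hU.dzz.sub hu.dzz)
  rw [real_inner_self_eq_norm_sq, real_inner_comm] at h2
  have h3 : ‖U - u‖ ^ 2 = inner ℝ U (U - u) - inner ℝ u (U - u) := by
    rw [← real_inner_self_eq_norm_sq, inner_sub_left]
  rw [inner_sub_left] at h2
  simp only [force, inner_add_left, inner_neg_left, inner_smul_left, conj_trivial]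
  linear_combination h1 + (-ν) * h2 - ε₁ * h3

theorem Reg.dot_vertL {U u : L2} (hU : Reg U) (hu : Reg u) (k : ℤ × ℤ) :
    dot k (vertL U) (vertL u) = ratio k ^ 2 * dot k U u := by
  simp only [dot, (coeff_vertL hU.dx hU.mean hU.even k).1, (coeff_vertL hU.dx hU.mean hU.even k).2,
    (coeff_vertL hu.dx hu.mean hu.even k).1, (coeff_vertL hu.dx hu.mean hu.even k).2]
  ring

/-- A pressure gradient tested with a divergence-free field. -/
theorem inner_pressure_eq {ε₂ : ℝ} {q U u : L2} (hU : Reg U) (hu : Reg u)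
    (hq : ∀ k, Good k → ca k q = ε₂ * ratio k ^ 2 * ca k u ∧ sb k q = ε₂ * ratio k ^ 2 * sb k u) :
    inner ℝ q (U - u) = ε₂ * inner ℝ (vertL u) (vertL U - vertL u) := by
  refine (hasSum_dot q (U - u)).unique
    (((hasSum_dot (vertL u) (vertL U - vertL u)).mul_left ε₂).congr_fun fun k => ?_)
  rw [dot_sub_right, dot_sub_right, hu.dot_vertL hU, hu.dot_vertL hu]
  -- Outside the good frequencies nothing is assumed about q, but U and u have no component there.
  by_cases hk : Good k
  · simp only [dot, (hq k hk).1, (hq k hk).2]; ring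
  · have h1 := coeff_eq_zero hU.dx hU.mean hk
    have h2 := coeff_eq_zero hu.dx hu.mean hk
    simp only [dot, h1, h2]; simp

/-- The coefficient in Grönwall's inequality. -/
def growth (ν b : ℝ) (u : L2) : ℝ :=
  1 / 2 + 1 / ν + (2 * ‖Dx u‖ ^ 2 + ‖Dx (Dx u)‖ ^ 2) / 2 + (b + 4 * b ^ 2 / ν)

theorem growth_nonneg {ν b : ℝ} (hν : 0 < ν) (hb : 0 ≤ b) (u : L2) : 0 ≤ growth ν b u := by
  unfold growth; positivity

/-- Young's inequality on the cross term. It costs a quarter of the viscosity and is applied once to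
each nonlinear term, so half of the viscosity survives. -/
theorem aniso_mul_le {v vz : L2} {ν b : ℝ} (hν : 0 < ν) :
    b * aniso v vz ≤ ν / 4 * ‖vz‖ ^ 2 + (b + 4 * b ^ 2 / ν) * ‖v‖ ^ 2 := by
  have h : 0 ≤ (ν / 2 * ‖vz‖ - 2 * b * ‖v‖) ^ 2 / ν := by positivity
  have e : (ν / 2 * ‖vz‖ - 2 * b * ‖v‖) ^ 2 / ν =
      ν / 4 * ‖vz‖ ^ 2 - 2 * b * (‖v‖ * ‖vz‖) + 4 * b ^ 2 / ν * ‖v‖ ^ 2 := by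
    field_simp; ring
  unfold aniso
  linarith

/-- The energy production in the equation for the difference. -/
theorem Reg.energy_le {ν ε₁ ε₂ b A : ℝ} (hν : 0 < ν) (hε₁ : 0 < ε₁) (hε₂ : 0 < ε₂) {U u ut q : L2}
    (hU : Reg U) (hu : Reg u) (hxx : IsDx (Dx u) (Dx (Dx u)))
    (hq : ∀ k, Good k → ca k q = ε₂ * ratio k ^ 2 * ca k u ∧ sb k q = ε₂ * ratio k ^ 2 * sb k u)
    (hut : ut = -force ν ε₁ u - q) (hb : aniso (Dz u) (Dx (Dz u)) ≤ 4 * ε₂ * b)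
    (hA : ‖Dz (Dz U)‖ ≤ A) (α : ℝ) :
    -inner ℝ (force ν ε₁ U) (U - u) - ε₂ * inner ℝ (vertL U) (vertL U - vertL u)
      - inner ℝ ut (U - u) + α ^ 2 * inner ℝ (Dz (Dz U)) ut ≤
    -(ν / 2 * ‖Dz U - Dz u‖ ^ 2) + growth ν b u * ‖U - u‖ ^ 2 + α ^ 2 * A * ‖ut‖ := by
  have hvz := hU.dz.sub hu.dz
  have e1 := hU.inner_force_sub hu hxx ν ε₁
  have e2 := inner_pressure_eq hU hu hq
  have e3 : inner ℝ ut (U - u) = -inner ℝ (force ν ε₁ u) (U - u) - inner ℝ q (U - u) := by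
    rw [hut, inner_sub_left, inner_neg_left]
  have e4 : ‖vertL U - vertL u‖ ^ 2 = inner ℝ (vertL U) (vertL U - vertL u) -
      inner ℝ (vertL u) (vertL U - vertL u) := by
    rw [← real_inner_self_eq_norm_sq, inner_sub_left]
  have e5 : inner ℝ (Dz (Dz U)) ut ≤ A * ‖ut‖ :=
    (real_inner_le_norm _ _).trans (mul_le_mul_of_nonneg_right hA (norm_nonneg _))
  have e6 : α ^ 2 * inner ℝ (Dz (Dz U)) ut ≤ α ^ 2 * (A * ‖ut‖) :=
    mul_le_mul_of_nonneg_left e5 (sq_nonneg _)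
  set v := U - u
  set vz := Dz U - Dz u
  set wd := vertL U - vertL u
  have n1 := hvz.norm_mulL_sq_le hxx
  have n2 := hvz.norm_mulL_sq_le hu.dzx
  have i1 := abs_real_inner_le_norm (mulL v (Dx u)) v
  have i2 := abs_real_inner_le_norm (mulL v (Dz u)) wd
  have a1 := neg_abs_le (inner ℝ (mulL v (Dx u)) v)
  have a2 := neg_abs_le (inner ℝ (mulL v (Dz u)) wd)
  have hAv := aniso_nonneg v vz
  -- the term with `uₓ`
  have f1 : ‖mulL v (Dx u)‖ * ‖v‖ ≤ 1 / 2 * aniso v vz +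
      aniso (Dx u) (Dx (Dx u)) / 2 * ‖v‖ ^ 2 := by
    have hB := aniso_nonneg (Dx u) (Dx (Dx u))
    have hs : √(aniso v vz) ^ 2 = aniso v vz := Real.sq_sqrt hAv
    have ht : √(aniso (Dx u) (Dx (Dx u))) ^ 2 = aniso (Dx u) (Dx (Dx u)) := Real.sq_sqrt hB
    have h3 : ‖mulL v (Dx u)‖ ≤ √(aniso v vz) * √(aniso (Dx u) (Dx (Dx u))) := by
      rw [← Real.sqrt_mul hAv]
      exact Real.le_sqrt_of_sq_le n1
    have h4 := mul_le_mul_of_nonneg_right h3 (norm_nonneg v)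
    have h5 := sq_nonneg (√(aniso v vz) - √(aniso (Dx u) (Dx (Dx u))) * ‖v‖)
    rw [sub_sq, mul_pow, hs, ht] at h5
    linarith
  have f2 : aniso (Dx u) (Dx (Dx u)) ≤ 2 * ‖Dx u‖ ^ 2 + ‖Dx (Dx u)‖ ^ 2 := by
    have := sq_nonneg (‖Dx u‖ - ‖Dx (Dx u)‖)
    rw [sub_sq] at this
    unfold aniso
    linarith
  have f3 := aniso_mul_le (v := v) (vz := vz) (b := 1 / 2) hν
  -- the term with `u_z`
  have g1 : ‖mulL v (Dz u)‖ * ‖wd‖ ≤ ε₂ * ‖wd‖ ^ 2 + b * aniso v vz := by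
    have h3 : ‖mulL v (Dz u)‖ ^ 2 ≤ 4 * ε₂ * (b * aniso v vz) := by
      refine n2.trans ((mul_le_mul_of_nonneg_left hb hAv).trans (le_of_eq (by ring)))
    -- Young's inequality with the weight for which ‖W - w‖² gets the coefficient ε₂, exactly the
    -- available vertical damping; hence the factor 4ε₂ in the hypothesis on b.
    have h4 : 0 ≤ (2 * ε₂ * ‖wd‖ - ‖mulL v (Dz u)‖) ^ 2 := sq_nonneg _
    have h5 : 4 * ε₂ * (‖mulL v (Dz u)‖ * ‖wd‖) ≤ 4 * ε₂ * (ε₂ * ‖wd‖ ^ 2 + b * aniso v vz) := by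
      rw [sub_sq] at h4
      linarith
    exact le_of_mul_le_mul_left h5 (by positivity)
  have g2 := aniso_mul_le (v := v) (vz := vz) (b := b) hν
  have f4 : aniso (Dx u) (Dx (Dx u)) / 2 * ‖v‖ ^ 2 ≤
      (2 * ‖Dx u‖ ^ 2 + ‖Dx (Dx u)‖ ^ 2) / 2 * ‖v‖ ^ 2 := by gcongr
  have f5 : (1 / 2 + 4 * (1 / 2) ^ 2 / ν : ℝ) = 1 / 2 + 1 / ν := by ring
  rw [f5] at f3
  have p1 : 0 ≤ ε₁ * ‖v‖ ^ 2 := by positivity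
  have e7 : growth ν b u * ‖v‖ ^ 2 = (1 / 2 + 1 / ν) * ‖v‖ ^ 2 +
      (2 * ‖Dx u‖ ^ 2 + ‖Dx (Dx u)‖ ^ 2) / 2 * ‖v‖ ^ 2 + (b + 4 * b ^ 2 / ν) * ‖v‖ ^ 2 := by
    unfold growth; ring
  have e8 : ε₂ * ‖wd‖ ^ 2 = ε₂ * inner ℝ (vertL U) wd - ε₂ * inner ℝ (vertL u) wd := by
    rw [e4]; ring
  have e9 : α ^ 2 * (A * ‖ut‖) = α ^ 2 * A * ‖ut‖ := by ring
  rw [e7]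
  -- The balance: `f3` and `g2` take ν/4 each out of ν‖v_z‖², `g1` uses up ε₂‖W - w‖² from `e8`, and
  -- the damping ε₁‖v‖² is dropped. The coefficients of ‖v‖² add up to `growth`.
  clear e4 e5 n1 n2 hAv e7 hb hA hut hq
  linarith

/-! ### Energy identities -/

theorem LpL2.exists_bound {T : ℝ} {v : ℝ → L2} (h : LpL2 T ⊤ v) :
    ∃ C : ℝ, ∀ᵐ t ∂(volume.restrict (Ioo 0 T)), ‖v t‖ ≤ C := by
  refine ⟨(eLpNorm v ⊤ (volume.restrict (Ioo 0 T))).toReal, ?_⟩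
  have h2 := MemLp.eLpNorm_lt_top h
  rw [eLpNorm_exponent_top] at h2 ⊢
  filter_upwards [ae_le_eLpNormEssSup (f := v) (μ := volume.restrict (Ioo 0 T))] with t ht
  have := ENNReal.toReal_mono h2.ne ht
  rwa [toReal_enorm] at this

/-- The passage to the limit in a sum of primitives. -/
theorem hasSum_hasPrim {T : ℝ} (hT : 0 < T) {ι : Type*} [Countable ι] {y g : ι → ℝ → ℝ}
    {Y₀ : ℝ} {G b : ℝ → ℝ} (h : ∀ k, HasPrim T (y k) (g k))
    (hg : ∀ᵐ s ∂(volume.restrict (Ioo 0 T)), HasSum (fun k => g k s) (G s))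
    (hb : ∀ᵐ s ∂(volume.restrict (Ioo 0 T)), ∀ S : Finset ι, |∑ k ∈ S, g k s| ≤ b s)
    (hbi : Integrable b (volume.restrict (Ioo 0 T))) (h0 : HasSum (fun k => y k 0) Y₀) :
    IntervalIntegrable G volume 0 T ∧ ∀ t ∈ Icc 0 T, ∀ Y, HasSum (fun k => y k t) Y →
      Y = Y₀ + ∫ s in (0 : ℝ)..t, G s := by
  have isum : ∀ S : Finset ι, IntervalIntegrable (fun s => ∑ k ∈ S, g k s) volume 0 T := by
    intro S
    have := IntervalIntegrable.sum S fun k _ => (h k).1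
    rwa [show (∑ k ∈ S, g k) = fun s => ∑ k ∈ S, g k s from funext fun s => by simp] at this
  have imeas : ∀ S : Finset ι, AEStronglyMeasurable (fun s => ∑ k ∈ S, g k s)
      (volume.restrict (Ioo 0 T)) := fun S =>
    ((intervalIntegrable_iff_integrableOn_Ioo_of_le hT.le).1 (isum S)).1
  have hG : Integrable G (volume.restrict (Ioo 0 T)) := by
    refine hbi.mono' (aestronglyMeasurable_of_tendsto_ae atTop imeas hg) ?_
    filter_upwards [hg, hb] with s h1 h2
    exact le_of_tendsto (h1.norm) (Eventually.of_forall fun S => h2 S)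
  refine ⟨intervalIntegrable_of_Ioo hT hG, fun t ht Y hY => ?_⟩
  have lim : Tendsto (fun S : Finset ι => ∫ s in (0 : ℝ)..t, ∑ k ∈ S, g k s) atTop
      (𝓝 (∫ s in (0 : ℝ)..t, G s)) := by
    simp only [intervalIntegral.integral_of_le ht.1]
    refine tendsto_integral_filter_of_dominated_convergence b
      (Eventually.of_forall fun S => (IntervalIntegrable.mono_time (isum S) ht).1.1)
      (Eventually.of_forall fun S => (ae_time_of_ae_Ioo ht hb).mono fun s hs => hs S)
      (IntervalIntegrable.mono_time (intervalIntegrable_of_Ioo hT hbi) ht).1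
      (ae_time_of_ae_Ioo ht hg)
  have h0' : Tendsto (fun S : Finset ι => ∑ k ∈ S, y k 0) atTop (𝓝 Y₀) := h0
  refine tendsto_nhds_unique hY ((h0'.add lim).congr fun S => ?_)
  rw [intervalIntegral.integral_finsetSum fun k _ => IntervalIntegrable.mono_time (h k).1 ht,
    ← Finset.sum_add_distrib]
  exact Finset.sum_congr rfl fun k _ => ((h k).2 t ht).symm

theorem HasPrim.congr_fun {T : ℝ} {y y' g : ℝ → ℝ} (h : HasPrim T y g) (h' : ∀ t, y' t = y t) :
    HasPrim T y' g := by rwa [show y' = y from funext h']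

/-- A continuous function that vanishes almost everywhere has derivative zero. -/
theorem HasPrim.of_ae_zero {T : ℝ} (hT : 0 < T) {y g : ℝ → ℝ} (hy : ContinuousOn y (Icc 0 T))
    (h : ∀ᵐ t ∂(volume.restrict (Ioo 0 T)), y t = 0 ∧ g t = 0) : HasPrim T y g := by
  have hg : g =ᵐ[volume.restrict (Ioo 0 T)] fun _ => 0 := h.mono fun t ht => ht.2
  refine HasPrim.of_weak hT hy ((integrable_zero _ _ _).congr hg.symm) fun η _ => ?_
  rw [integral_eq_zero_of_ae, integral_eq_zero_of_ae, neg_zero]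
  · filter_upwards [h] with t ht
    simp [ht.2]
  · filter_upwards [h] with t ht
    simp [ht.1]

/-- The symbol of `1 - α² ∂_z²`. -/
def lam (α : ℝ) (k : ℤ × ℤ) : ℝ := 1 + α ^ 2 * (2 * Real.pi * k.2) ^ 2

theorem lam_pos (α : ℝ) (k : ℤ × ℤ) : 0 < lam α k := by unfold lam; positivity

/-- `l` is a Fourier coefficient of frequency `k`, the integral against `e`. -/
structure IsMode (k : ℤ × ℤ) (e : C(Torus, ℝ)) (l : L2 →L[ℝ] ℝ) : Prop where
  smooth : IsSmooth e
  eq : ∀ f, l f = ∫ ξ, f ξ * e ξ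
  dzz : ∀ f, Reg f → l (Dz (Dz f)) = -((2 * Real.pi * k.2) ^ 2 * l f)
  pressure : ∀ ε₂ f, Reg f → ∫ ξ, pressure ε₂ f ξ * dX e ξ = -(ε₂ * ratio k ^ 2 * l f)

theorem isMode_cs {k : ℤ × ℤ} (hk : Good k) : IsMode k (cs k) (ca k) where
  smooth := isSmooth_cs k
  eq := ca_eq k
  dzz f h := by rw [(h.dzz k).1, (h.dz k).2]; ring
  pressure ε₂ f h := (integral_pressure_dX h.dx h.mean h.even hk).1

theorem isMode_sn {k : ℤ × ℤ} (hk : Good k) : IsMode k (sn k) (sb k) where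
  smooth := isSmooth_sn k
  eq := sb_eq k
  dzz f h := by rw [(h.dzz k).2, (h.dz k).1]; ring
  pressure ε₂ f h := (integral_pressure_dX h.dx h.mean h.even hk).2

/-- Puts the coefficient of the force in a form that is measurable in time term by term. -/
theorem IsMode.force {k : ℤ × ℤ} {e : C(Torus, ℝ)} {l : L2 →L[ℝ] ℝ} (hm : IsMode k e l) {f : L2}
    (h : Reg f) (ν ε₁ : ℝ) : l (force ν ε₁ f) = -(ν * l (Dz (Dz f))) +
      (inner ℝ (Dx f) (mulC e f) + inner ℝ (vertL f) (mulC e (Dz f))) + ε₁ * l f := by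
  rw [HNS.force, quad, map_add, map_add, map_add, map_neg, map_smul, map_smul,
    coeff_mulL (h.dxz.memLp_mul h.dx) hm.eq, coeff_mulL (h.vert.memLp_mul h.dzx) hm.eq, smul_eq_mul,
    smul_eq_mul]

/-! ### The regularized system: equations for the modes and the vertical energy -/

section Voigt

variable {ν ε₁ ε₂ α T : ℝ} {U₀ : L2} {U : ℝ → L2}

theorem IsVoigtStrongSolution.reg (h : IsVoigtStrongSolution ν ε₁ ε₂ α T U₀ U) :
    ∀ᵐ t ∂(volume.restrict (Ioo 0 T)), Reg (U t) := by
  filter_upwards [h.zeroMean, h.memLinftyH1.2.1.1, h.memLinftyH1.2.2.1, h.dz_memLinftyH1.2.1.1,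
    h.dz_memLinftyH1.2.2.1, ae_restrict_mem measurableSet_Ioo] with t h1 h2 h3 h4 h5 h6
  exact Reg.of_weak h2 h3 h4 h5 h1 (h.even t (Ioo_subset_Icc_self h6))

theorem IsVoigtStrongSolution.exists_bound (h : IsVoigtStrongSolution ν ε₁ ε₂ α T U₀ U) :
    ∃ C : ℝ, ∀ᵐ t ∂(volume.restrict (Ioo 0 T)), ‖U t‖ ≤ C ∧ ‖Dx (U t)‖ ≤ C ∧ ‖Dz (U t)‖ ≤ C ∧
      ‖Dx (Dz (U t))‖ ≤ C ∧ ‖Dz (Dz (U t))‖ ≤ C := by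
  obtain ⟨C1, h1⟩ := h.memLinftyH1.1.exists_bound
  obtain ⟨C2, h2⟩ := h.memLinftyH1.2.1.2.exists_bound
  obtain ⟨C3, h3⟩ := h.memLinftyH1.2.2.2.exists_bound
  obtain ⟨C4, h4⟩ := h.dz_memLinftyH1.2.1.2.exists_bound
  obtain ⟨C5, h5⟩ := h.dz_memLinftyH1.2.2.2.exists_bound
  refine ⟨max C1 (max C2 (max C3 (max C4 C5))), ?_⟩
  filter_upwards [h1, h2, h3, h4, h5] with t h1 h2 h3 h4 h5
  simp only [le_max_iff]
  tauto

/-- The equation for a Fourier coefficient of a solution of the regularized system. -/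
theorem IsVoigtStrongSolution.mode (h : IsVoigtStrongSolution ν ε₁ ε₂ α T U₀ U) (hν : 0 < ν)
    (hε₁ : 0 < ε₁) (hT : 0 < T) {k : ℤ × ℤ} {e : C(Torus, ℝ)} {l : L2 →L[ℝ] ℝ}
    (hm : IsMode k e l) :
    HasPrim T (fun t => lam α k * l (U t))
      (fun t => -(l (force ν ε₁ (U t)) + ε₂ * ratio k ^ 2 * l (U t))) := by
  obtain ⟨C, hC⟩ := h.exists_bound
  have cl : ContinuousOn (fun t => l (U t)) (Icc 0 T) := l.continuous.comp_continuousOn h.continuousOn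
  have il : Integrable (fun t => l (U t)) (volume.restrict (Ioo 0 T)) :=
    (cl.integrableOn_Icc).mono_set Ioo_subset_Icc_self
  have iF : Integrable (fun t => l (force ν ε₁ (U t))) (volume.restrict (Ioo 0 T)) := by
    refine Integrable.of_bound (C := ‖l‖ * (ν * C + 6 * C ^ 2 + ε₁ * C)) ?_ ?_
    · have mU := h.memLinftyH1.1.1
      have mx := h.memLinftyH1.2.1.2.1
      have mz := h.memLinftyH1.2.2.2.1
      have mzz := h.dz_memLinftyH1.2.2.2.1
      have mw : AEStronglyMeasurable (fun t => vertL (U t)) (volume.restrict (Ioo 0 T)) :=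
        (primL.continuous.comp_aestronglyMeasurable mx).neg
      have key : AEStronglyMeasurable (fun t => -(ν * l (Dz (Dz (U t)))) +
          (inner ℝ (Dx (U t)) (mulC e (U t)) + inner ℝ (vertL (U t)) (mulC e (Dz (U t)))) +
            ε₁ * l (U t)) (volume.restrict (Ioo 0 T)) := by
        refine (((l.continuous.comp_aestronglyMeasurable mzz).const_mul ν).neg.add
          ((mx.inner ((mulC e).continuous.comp_aestronglyMeasurable mU)).add
            (mw.inner ((mulC e).continuous.comp_aestronglyMeasurable mz)))).add
          ((l.continuous.comp_aestronglyMeasurable mU).const_mul ε₁)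
      refine key.congr ?_
      filter_upwards [h.reg] with t ht
      exact (hm.force ht ν ε₁).symm
    · filter_upwards [h.reg, hC] with t ht ⟨h1, h2, h3, h4, h5⟩
      refine (l.le_opNorm _).trans (mul_le_mul_of_nonneg_left ?_ (norm_nonneg _))
      exact ht.norm_force_le hν hε₁ h1 h2 h3 h4 h5
  refine HasPrim.of_weak hT (cl.const_mul _) (iF.add (il.const_mul _)).neg fun η hη => ?_
  have key := h.equation η hη e hm.smooth
  have cd : Continuous (deriv η) := hη.1.continuous_deriv (by simp)
  have e1 : ∀ᵐ t ∂(volume.restrict (Ioo 0 T)),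
      (- deriv η t * (∫ ξ, (U t ξ - α ^ 2 * Dz (Dz (U t)) ξ) * e ξ)
        + η t * ((∫ ξ, (- ν * Dz (Dz (U t)) ξ + U t ξ * Dx (U t) ξ
              + vertVel (U t) ξ * Dz (U t) ξ + ε₁ * U t ξ) * e ξ)
            - ∫ ξ, pressure ε₂ (U t) ξ * dX e ξ)) =
      -(deriv η t * (lam α k * l (U t))) +
        η t * (l (force ν ε₁ (U t)) + ε₂ * ratio k ^ 2 * l (U t)) := by
    filter_upwards [h.reg] with t ht
    rw [hm.pressure _ _ ht]
    have a1 : ∫ ξ, (U t ξ - α ^ 2 * Dz (Dz (U t)) ξ) * e ξ = lam α k * l (U t) := by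
      simp only [sub_mul, mul_assoc]
      rw [integral_sub (Integrable.mul_cont (integrable_L2 _) e) ((Integrable.mul_cont (integrable_L2 _) e).const_mul _), integral_const_mul,
        ← hm.eq, ← hm.eq, hm.dzz _ ht, lam]
      ring
    have a2 : ∫ ξ, (- ν * Dz (Dz (U t)) ξ + U t ξ * Dx (U t) ξ
              + vertVel (U t) ξ * Dz (U t) ξ + ε₁ * U t ξ) * e ξ = l (force ν ε₁ (U t)) := by
      rw [hm.eq]
      refine integral_congr_ae ?_
      filter_upwards [ht.coeFn_force ν ε₁] with ξ hξ
      rw [hξ]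
    rw [a1, a2]
    ring
  rw [integral_congr_ae e1, integral_add, integral_neg] at key
  · rw [show (fun t => η t * -(l (force ν ε₁ (U t)) + ε₂ * ratio k ^ 2 * l (U t))) = fun t =>
      -(η t * (l (force ν ε₁ (U t)) + ε₂ * ratio k ^ 2 * l (U t))) from funext fun t => by ring,
      integral_neg]
    linarith
  · exact (((cd.continuousOn.mul (cl.const_mul _)).integrableOn_Icc).mono_set
      Ioo_subset_Icc_self).neg
  · have i1 := intervalIntegrable_of_Ioo hT (iF.add (il.const_mul (ε₂ * ratio k ^ 2)))
    have := i1.continuousOn_mul hη.1.continuous.continuousOn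
    exact (intervalIntegrable_iff_integrableOn_Ioo_of_le hT.le).1 this

theorem IsVoigtStrongSolution.continuousOn_clm (h : IsVoigtStrongSolution ν ε₁ ε₂ α T U₀ U)
    (l : L2 →L[ℝ] ℝ) : ContinuousOn (fun t => l (U t)) (Icc 0 T) :=
  l.continuous.comp_continuousOn h.continuousOn

/-- The weight (2πk₂)² amounts to testing with -U_zz. On good frequencies it turns the pressure
symbol ε₂(k₁/k₂)² into ε₂(2πk₁)², so the pressure dissipates ‖U_x‖². -/
theorem IsVoigtStrongSolution.dot_self (h : IsVoigtStrongSolution ν ε₁ ε₂ α T U₀ U) (hν : 0 < ν)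
    (hε₁ : 0 < ε₁) (hT : 0 < T) (k : ℤ × ℤ) :
    HasPrim T (fun t => (2 * Real.pi * k.2) ^ 2 * (lam α k * dot k (U t) (U t)))
      (fun t => 2 * dot k (force ν ε₁ (U t)) (Dz (Dz (U t))) -
        2 * ε₂ * dot k (Dx (U t)) (Dx (U t))) := by
  have hl := (lam_pos α k).ne'
  by_cases hk : Good k
  · have single : ∀ {e : C(Torus, ℝ)} {l : L2 →L[ℝ] ℝ}, IsMode k e l →
        HasPrim T (fun t => lam α k * l (U t) ^ 2) (fun t => (-2) *
          (l (force ν ε₁ (U t)) * l (U t) + ε₂ * ratio k ^ 2 * (l (U t) * l (U t)))) := by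
      intro e l hm
      have h1 := h.mode hν hε₁ hT hm
      -- The equation governs λ times the coefficient, so its square carries λ²; dividing once by λ
      -- leaves the energy with the single weight λ.
      have h2 := (h1.mul hT h1).const_mul (lam α k)⁻¹
      convert h2 using 2
      · field_simp
      · field_simp; ring
    have h3 := ((single (isMode_cs hk)).add (single (isMode_sn hk))).const_mul
      ((2 * Real.pi * k.2) ^ 2)
    refine (h3.congr_fun fun t => ?_).congr hT ?_
    · simp only [dot]; ring
    filter_upwards [h.reg] with t ht
    have hr : (2 * Real.pi * k.2) ^ 2 * ratio k ^ 2 = (2 * Real.pi * k.1) ^ 2 := by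
      rcases hk with hk | hk
      · have : (k.2 : ℝ) ≠ 0 := by exact_mod_cast hk
        rw [ratio]; field_simp
      · simp [ratio, hk]
    simp only [dot, (isMode_cs hk).dzz _ ht, (isMode_sn hk).dzz _ ht, (ht.dx k).1, (ht.dx k).2]
    linear_combination (-2) * ε₂ * (ca k (U t) ^ 2 + sb k (U t) ^ 2) * hr
  · refine HasPrim.of_ae_zero hT ?_ ?_
    · have c1 := h.continuousOn_clm (ca k)
      have c2 := h.continuousOn_clm (sb k)
      exact (((c1.mul c1).add (c2.mul c2)).const_mul _).const_mul _
    · filter_upwards [h.reg] with t ht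
      have h0 := coeff_eq_zero ht.dx ht.mean hk
      simp [dot, h0, (ht.dx k).1, (ht.dx k).2, (ht.dzz k).1, (ht.dzz k).2, (ht.dz k).1, (ht.dz k).2]

/-- The bound for the vertical derivatives that does not depend on the horizontal ones. -/
theorem IsVoigtStrongSolution.dz_energy_le (h : IsVoigtStrongSolution ν ε₁ ε₂ α T U₀ U)
    (hν : 0 < ν) (hε₁ : 0 < ε₁) (hε₂ : 0 < ε₂) (hT : 0 < T) (hz : IsDz U₀ (Dz U₀))
    (hzz : IsDz (Dz U₀) (Dz (Dz U₀))) :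
    ∀ᵐ t ∂(volume.restrict (Ioo 0 T)), ‖Dz (U t)‖ ^ 2 + α ^ 2 * ‖Dz (Dz (U t))‖ ^ 2 ≤
      ‖Dz U₀‖ ^ 2 + α ^ 2 * ‖Dz (Dz U₀)‖ ^ 2 := by
  obtain ⟨C, hC⟩ := h.exists_bound
  have hsum : ∀ {f : L2}, IsDz f (Dz f) → IsDz (Dz f) (Dz (Dz f)) →
      HasSum (fun k : ℤ × ℤ => (2 * Real.pi * k.2) ^ 2 * (lam α k * dot k f f))
        (‖Dz f‖ ^ 2 + α ^ 2 * ‖Dz (Dz f)‖ ^ 2) := by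
    intro f h1 h2
    rw [← real_inner_self_eq_norm_sq, ← real_inner_self_eq_norm_sq]
    refine ((hasSum_dot _ _).add ((hasSum_dot _ _).mul_left (α ^ 2))).congr_fun fun k => ?_
    rw [h2.dot_self, h1.dot_self, lam]; ring
  set F := ν * C + 6 * C ^ 2 + ε₁ * C
  obtain ⟨-, key⟩ := hasSum_hasPrim hT (fun k => h.dot_self hν hε₁ hT k)
    (G := fun t => 2 * inner ℝ (force ν ε₁ (U t)) (Dz (Dz (U t))) -
      2 * ε₂ * inner ℝ (Dx (U t)) (Dx (U t))) (b := fun _ => (F ^ 2 + C ^ 2) + 2 * ε₂ * C ^ 2)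
    (Eventually.of_forall fun t => ((hasSum_dot _ _).mul_left 2).sub
      ((hasSum_dot _ _).mul_left (2 * ε₂))) (by
      filter_upwards [h.reg, hC] with t ht ⟨h1, h2, h3, h4, h5⟩ S
      have hF : ‖force ν ε₁ (U t)‖ ≤ F := ht.norm_force_le hν hε₁ h1 h2 h3 h4 h5
      have b1 := abs_sum_dot_le S (force ν ε₁ (U t)) (Dz (Dz (U t)))
      have b2 := abs_sum_dot_le S (Dx (U t)) (Dx (U t))
      have s1 := pow_le_pow_left₀ (norm_nonneg _) hF 2
      have s2 := pow_le_pow_left₀ (norm_nonneg _) h2 2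
      have s5 := pow_le_pow_left₀ (norm_nonneg _) h5 2
      rw [Finset.sum_sub_distrib, ← Finset.mul_sum, ← Finset.mul_sum]
      refine (abs_sub _ _).trans ?_
      rw [abs_mul, abs_mul, abs_of_pos (by positivity : (0 : ℝ) < 2),
        abs_of_pos (by positivity : 0 < 2 * ε₂)]
      refine add_le_add (by linarith) (mul_le_mul_of_nonneg_left (by linarith) (by positivity)))
    (integrable_const _) (by
      simp only [h.initial]
      exact hsum hz hzz)
  filter_upwards [h.reg, ae_restrict_mem measurableSet_Ioo] with t ht htm
  have htI := Ioo_subset_Icc_self htm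
  rw [key t htI _ (hsum ht.dz ht.dzz)]
  -- Viscosity, linear damping and vertical damping each contribute a nonpositive term, the
  -- nonlinearity none.
  have : ∫ s in (0 : ℝ)..t, (2 * inner ℝ (force ν ε₁ (U s)) (Dz (Dz (U s))) -
      2 * ε₂ * inner ℝ (Dx (U s)) (Dx (U s))) ≤ 0 := by
    rw [intervalIntegral.integral_of_le htI.1]
    refine integral_nonpos_of_ae ?_
    filter_upwards [ae_time_of_ae_Ioo htI h.reg] with s hs
    rw [hs.inner_force_zz, real_inner_self_eq_norm_sq]
    have p1 : 0 ≤ ν * ‖Dz (Dz (U s))‖ ^ 2 := by positivity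
    have p2 : 0 ≤ ε₁ * ‖Dz (U s)‖ ^ 2 := by positivity
    have p3 : 0 ≤ 2 * ε₂ * ‖Dx (U s)‖ ^ 2 := by positivity
    change _ ≤ (0 : ℝ)
    linarith
  linarith

end Voigt

/-! ### The difference of the two solutions -/

section Strong

variable {ν ε₁ ε₂ α T : ℝ} {u₀ U₀ : L2} {u U ut : ℝ → L2}

theorem IsStrongSolution.reg (h : IsStrongSolution ν ε₁ ε₂ T u₀ u) :
    ∀ᵐ t ∂(volume.restrict (Ioo 0 T)), Reg (u t) ∧ IsDx (Dx (u t)) (Dx (Dx (u t))) := by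
  filter_upwards [h.zeroMean, h.memLinftyH1.2.1.1, h.memLinftyH1.2.2.1, h.memL2H2.2.2.2.1.1,
    h.memL2H2.2.2.2.2.1, ae_restrict_mem measurableSet_Ioo, h.memL2H2.2.1.2.1.1]
    with t h1 h2 h3 h4 h5 h6 h7
  exact ⟨Reg.of_weak h2 h3 h4 h5 h1 (h.even t (Ioo_subset_Icc_self h6)), h7.isDx⟩

theorem IsStrongSolution.exists_bound (h : IsStrongSolution ν ε₁ ε₂ T u₀ u) :
    ∃ C : ℝ, 0 ≤ C ∧ ∀ᵐ t ∂(volume.restrict (Ioo 0 T)), ‖u t‖ ≤ C ∧ ‖Dx (u t)‖ ≤ C ∧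
      ‖Dz (u t)‖ ≤ C ∧ ‖Dx (Dz (u t))‖ ≤ C := by
  obtain ⟨C1, h1⟩ := h.memLinftyH1.1.exists_bound
  obtain ⟨C2, h2⟩ := h.memLinftyH1.2.1.2.exists_bound
  obtain ⟨C3, h3⟩ := h.memLinftyH1.2.2.2.exists_bound
  obtain ⟨C4, h4⟩ := h.dxz_memLinftyL2.2.exists_bound
  refine ⟨max 0 (max C1 (max C2 (max C3 C4))), le_max_left _ _, ?_⟩
  filter_upwards [h1, h2, h3, h4, h.dxz_memLinftyL2.1, h.reg] with t h1 h2 h3 h4 h5 h6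
  rw [← h5.isDz.unique h6.1.dxz]
  simp only [le_max_iff]
  tauto

theorem HasWeakDt.hasPrim (hT : 0 < T) (hu : ContinuousOn u (Icc 0 T)) (hut : LpL2 T 2 ut)
    (h : HasWeakDt T u ut) (l : L2 →L[ℝ] ℝ) : HasPrim T (fun t => l (u t)) (fun t => l (ut t)) := by
  have iut : Integrable ut (volume.restrict (Ioo 0 T)) := MemLp.integrable (by norm_num) hut
  refine HasPrim.of_weak hT (l.continuous.comp_continuousOn hu) (l.integrable_comp iut)
    fun η hη => ?_
  have cd : Continuous (deriv η) := hη.1.continuous_deriv (by simp)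
  have i1 : Integrable (fun t => deriv η t • u t) (volume.restrict (Ioo 0 T)) :=
    ((cd.continuousOn.smul hu).integrableOn_Icc).mono_set Ioo_subset_Icc_self
  have i2 : Integrable (fun t => η t • ut t) (volume.restrict (Ioo 0 T)) := by
    obtain ⟨C, hC⟩ := hη.2.1.exists_bound_of_continuous hη.1.continuous
    exact iut.bdd_smul C hη.1.continuous.aestronglyMeasurable (Eventually.of_forall hC)
  have key := congrArg l (h η hη)
  rw [map_neg, ← l.integral_comp_comm i1, ← l.integral_comp_comm i2] at key
  simpa only [map_smul, smul_eq_mul] using key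

/-- The momentum equation of a strong solution, in terms of Fourier coefficients. -/
theorem IsStrongSolution.exists_pressure {f ft : L2} (hf : Reg f)
    (hxx : IsDx (Dx f) (Dx (Dx f)))
    (h : ∀ᵐ ξ : Torus, ft ξ - ν * Dz (Dz f) ξ + f ξ * Dx f ξ + vertVel f ξ * Dz f ξ
        + ε₁ * f ξ + pressureX ε₂ f ξ = 0) :
    ∃ q : L2, ft = -force ν ε₁ f - q ∧
      ∀ k, Good k → ca k q = ε₂ * ratio k ^ 2 * ca k f ∧ sb k q = ε₂ * ratio k ^ 2 * sb k f := by
  -- The pressure gradient is defined as what the equation leaves over, so its square integrability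
  -- comes for free; only its coefficients are computed from the formula.
  refine ⟨-force ν ε₁ f - ft, by abel, fun k hk => ?_⟩
  have e : (-force ν ε₁ f - ft : L2) =ᵐ[volume] pressureX ε₂ f := by
    filter_upwards [h, Lp.coeFn_sub (-force ν ε₁ f) ft, Lp.coeFn_neg (force ν ε₁ f),
      hf.coeFn_force ν ε₁] with ξ h1 h2 h3 h4
    rw [h2, Pi.sub_apply, h3, Pi.neg_apply, h4]
    linarith
  have key := integral_pressureX_mul (ε₂ := ε₂) hf.dx hxx hf.mean hf.even hk
  rw [ca_eq, sb_eq, ← key.1, ← key.2]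
  constructor <;>
  · refine integral_congr_ae ?_
    filter_upwards [e] with ξ h1
    rw [h1]

/-- The modulated energy of a frequency. -/
def modeEnergy (α : ℝ) (k : ℤ × ℤ) (U u : L2) : ℝ :=
  lam α k * (dot k U U / 2 - dot k U u) + dot k u u / 2

/-- Since λ = 1 + α²(2πk₂)², the part with 1 sums to ½‖U - u‖² and the part with α² to the
corrector; (2πk₂)² in the cross term becomes -∂_zz on U, so no second vertical derivative of u is
required. -/
theorem hasSum_modeEnergy (α : ℝ) {U Uz Uzz : L2} (u : L2) (hz : IsDz U Uz) (hzz : IsDz Uz Uzz) :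
    HasSum (fun k => modeEnergy α k U u)
      (‖U - u‖ ^ 2 / 2 + α ^ 2 * (‖Uz‖ ^ 2 / 2 + inner ℝ Uzz u)) := by
  rw [← real_inner_self_eq_norm_sq, ← real_inner_self_eq_norm_sq]
  refine (((hasSum_dot _ _).div_const 2).add ((((hasSum_dot _ _).div_const 2).add
    (hasSum_dot _ _)).mul_left (α ^ 2))).congr_fun fun k => ?_
  rw [hz.dot_self, modeEnergy, lam]
  simp only [dot, map_sub, (hzz k).1, (hzz k).2, (hz k).1, (hz k).2]
  ring

/-- The derivative pairs (λU)' with U - u and u' with -(λU - u). The latter bracket is U - u -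
α²U_zz in frequency space, which produces the two terms with `ut`. -/
theorem IsVoigtStrongSolution.modeEnergy (hU : IsVoigtStrongSolution ν ε₁ ε₂ α T U₀ U)
    (hu : IsStrongSolution ν ε₁ ε₂ T u₀ u) (hν : 0 < ν) (hε₁ : 0 < ε₁) (hT : 0 < T)
    (hut : LpL2 T 2 ut) (hdt : HasWeakDt T u ut) (k : ℤ × ℤ) :
    HasPrim T (fun t => modeEnergy α k (U t) (u t)) (fun t =>
      -dot k (force ν ε₁ (U t)) (U t - u t) - ε₂ * dot k (vertL (U t)) (vertL (U t) - vertL (u t))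
        - dot k (ut t) (U t - u t) + α ^ 2 * dot k (Dz (Dz (U t))) (ut t)) := by
  have hl := (lam_pos α k).ne'
  have hprim := fun l => hdt.hasPrim hT hu.continuousOn hut l
  by_cases hk : Good k
  · have single : ∀ {e : C(Torus, ℝ)} {l : L2 →L[ℝ] ℝ}, IsMode k e l →
        HasPrim T (fun t => lam α k * (l (U t) * l (U t) / 2 - l (U t) * l (u t)) +
            l (u t) * l (u t) / 2)
          (fun t => -(l (force ν ε₁ (U t)) + ε₂ * ratio k ^ 2 * l (U t)) * (l (U t) - l (u t)) -
            l (ut t) * (lam α k * l (U t) - l (u t))) := by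
      intro e l hm
      have h1 := hU.mode hν hε₁ hT hm
      have h2 := hprim l
      -- With y = λU and r = u at this mode, the energy is y²/(2λ) - yr + r²/2: products of the two
      -- functions whose primitives are known.
      have h3 := (((h1.mul hT h1).const_mul ((lam α k)⁻¹ / 2)).add
        ((h1.mul hT h2).const_mul (-1))).add ((h2.mul hT h2).const_mul (1 / 2))
      refine (h3.congr_fun fun t => ?_).congr hT (Eventually.of_forall fun t => ?_)
      · field_simp; ring
      · field_simp; ring
    refine (((single (isMode_cs hk)).add (single (isMode_sn hk))).congr_fun fun t => ?_).congr hT ?_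
    · simp only [HNS.modeEnergy, dot]; ring
    filter_upwards [hU.reg, hu.reg] with t ht ht'
    rw [dot_sub_right k (vertL (U t)), ht.dot_vertL ht, ht.dot_vertL ht'.1]
    simp only [dot, map_sub, (isMode_cs hk).dzz _ ht, (isMode_sn hk).dzz _ ht, lam]
    ring
  · refine HasPrim.of_ae_zero hT ?_ ?_
    · have c1 := hU.continuousOn_clm (ca k)
      have c2 := hU.continuousOn_clm (sb k)
      have c3 := (hprim (ca k)).continuousOn hT
      have c4 := (hprim (sb k)).continuousOn hT
      exact (((((c1.mul c1).add (c2.mul c2)).div_const 2).sub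
        ((c1.mul c3).add (c2.mul c4))).const_mul _).add (((c3.mul c3).add (c4.mul c4)).div_const 2)
    · filter_upwards [hU.reg, hu.reg] with t ht ht'
      have h0 := coeff_eq_zero ht.dx ht.mean hk
      have h1 := coeff_eq_zero ht'.1.dx ht'.1.mean hk
      rw [dot_sub_right k (vertL (U t)), ht.dot_vertL ht, ht.dot_vertL ht'.1]
      simp [HNS.modeEnergy, dot, h0, h1, (ht.dzz k).1, (ht.dzz k).2, (ht.dz k).1, (ht.dz k).2]

theorem abs_sum_dot_le_sq (S : Finset (ℤ × ℤ)) {f g : L2} {a b : ℝ} (hf : ‖f‖ ≤ a) (hg : ‖g‖ ≤ b) :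
    |∑ k ∈ S, dot k f g| ≤ (a ^ 2 + b ^ 2) / 2 := by
  have h1 := pow_le_pow_left₀ (norm_nonneg _) hf 2
  have h2 := pow_le_pow_left₀ (norm_nonneg _) hg 2
  have h3 := abs_sum_dot_le S f g
  linarith

theorem LpL2.integrable_norm_sq {v : ℝ → L2} (h : LpL2 T 2 v) :
    Integrable (fun t => ‖v t‖ ^ 2) (volume.restrict (Ioo 0 T)) :=
  (memLp_two_iff_integrable_sq_norm h.1).1 h

/-- The energy identity for the difference. -/
theorem IsVoigtStrongSolution.energy_identity (hU : IsVoigtStrongSolution ν ε₁ ε₂ α T U₀ U)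
    (hu : IsStrongSolution ν ε₁ ε₂ T u₀ u) (hν : 0 < ν) (hε₁ : 0 < ε₁) (hε₂ : 0 < ε₂) (hT : 0 < T)
    (hz : IsDz U₀ (Dz U₀)) (hzz : IsDz (Dz U₀) (Dz (Dz U₀)))
    (hut : LpL2 T 2 ut) (hdt : HasWeakDt T u ut) {G : ℝ → ℝ}
    (hG : ∀ t, G t = -inner ℝ (force ν ε₁ (U t)) (U t - u t)
      - ε₂ * inner ℝ (vertL (U t)) (vertL (U t) - vertL (u t))
      - inner ℝ (ut t) (U t - u t) + α ^ 2 * inner ℝ (Dz (Dz (U t))) (ut t)) :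
    IntervalIntegrable G volume 0 T ∧ ∀ᵐ t ∂(volume.restrict (Ioo 0 T)),
      ‖U t - u t‖ ^ 2 / 2 + α ^ 2 * (‖Dz (U t)‖ ^ 2 / 2 + inner ℝ (Dz (Dz (U t))) (u t)) =
      ‖U₀ - u₀‖ ^ 2 / 2 + α ^ 2 * (‖Dz U₀‖ ^ 2 / 2 + inner ℝ (Dz (Dz U₀)) u₀) +
        ∫ s in (0 : ℝ)..t, G s := by
  obtain ⟨C, hC⟩ := hU.exists_bound
  obtain ⟨c, -, hc⟩ := hu.exists_bound
  set F := ν * C + 6 * C ^ 2 + ε₁ * C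
  obtain ⟨iG, key⟩ := hasSum_hasPrim hT
    (fun k => hU.modeEnergy hu hν hε₁ hT hut hdt k) (G := G)
    (b := fun s => (F ^ 2 + (C + c) ^ 2) / 2 + ε₂ * ((C ^ 2 + (C + c) ^ 2) / 2) +
      (‖ut s‖ ^ 2 + (C + c) ^ 2) / 2 + α ^ 2 * ((C ^ 2 + ‖ut s‖ ^ 2) / 2))
    (Eventually.of_forall fun t => by
      rw [hG]
      exact (((hasSum_dot _ _).neg.sub ((hasSum_dot _ _).mul_left ε₂)).sub (hasSum_dot _ _)).add
        ((hasSum_dot _ _).mul_left (α ^ 2))) (by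
      filter_upwards [hU.reg, hC, hc] with t ht ⟨h1, h2, h3, h4, h5⟩ ⟨g1, g2, g3, g4⟩ S
      have hF : ‖force ν ε₁ (U t)‖ ≤ F := ht.norm_force_le hν hε₁ h1 h2 h3 h4 h5
      have hv : ‖U t - u t‖ ≤ C + c := (norm_sub_le _ _).trans (add_le_add h1 g1)
      have hW : ‖vertL (U t)‖ ≤ C := (norm_vertL_le _).trans h2
      have hw : ‖vertL (U t) - vertL (u t)‖ ≤ C + c :=
        (norm_sub_le _ _).trans (add_le_add hW ((norm_vertL_le _).trans g2))
      have b1 := abs_le.1 (abs_sum_dot_le_sq S hF hv)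
      have b2 := abs_le.1 (abs_sum_dot_le_sq S hW hw)
      have b3 := abs_le.1 (abs_sum_dot_le_sq S (le_refl ‖ut t‖) hv)
      have b4 := abs_le.1 (abs_sum_dot_le_sq S h5 (le_refl ‖ut t‖))
      rw [Finset.sum_add_distrib, Finset.sum_sub_distrib, Finset.sum_sub_distrib,
        Finset.sum_neg_distrib, ← Finset.mul_sum, ← Finset.mul_sum]
      have m1 := mul_le_mul_of_nonneg_left b2.1 hε₂.le
      have m2 := mul_le_mul_of_nonneg_left b2.2 hε₂.le
      have m3 := mul_le_mul_of_nonneg_left b4.1 (sq_nonneg α)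
      have m4 := mul_le_mul_of_nonneg_left b4.2 (sq_nonneg α)
      rw [abs_le]
      constructor <;> linarith [b1.1, b1.2, b3.1, b3.2])
    ((((integrable_const _).add (integrable_const _)).add
      ((hut.integrable_norm_sq.add (integrable_const _)).div_const 2)).add
      ((((integrable_const _).add hut.integrable_norm_sq).div_const 2).const_mul _)) (by
      simp only [hU.initial, hu.initial]
      exact hasSum_modeEnergy α u₀ hz hzz)
  refine ⟨iG, ?_⟩
  filter_upwards [hU.reg, ae_restrict_mem measurableSet_Ioo] with t ht htm
  exact key t (Ioo_subset_Icc_self htm) _ (hasSum_modeEnergy α _ ht.dz ht.dzz)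

end Strong

/-! ### Convergence -/

theorem integrable_growth {ν b T : ℝ} {u : ℝ → L2} (h1 : LpL2 T 2 fun t => Dx (u t))
    (h2 : LpL2 T 2 fun t => Dx (Dx (u t))) :
    Integrable (fun t => growth ν b (u t)) (volume.restrict (Ioo 0 T)) :=
  ((integrable_const _).add (((h1.integrable_norm_sq.const_mul 2).add
    h2.integrable_norm_sq).div_const 2)).add (integrable_const _)

/-- The bound degenerates as α tends to 0, but only at rate 1/α, while U_zz enters the modulated
energy balance with the factor α². -/
theorem IsVoigtStrongSolution.norm_dzz_le {ν ε₁ ε₂ α T M : ℝ} {U₀ : L2} {U : ℝ → L2}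
    (h : IsVoigtStrongSolution ν ε₁ ε₂ α T U₀ U) (hν : 0 < ν) (hε₁ : 0 < ε₁) (hε₂ : 0 < ε₂)
    (hT : 0 < T) (hα : 0 < α) (hz : IsDz U₀ (Dz U₀)) (hzz : IsDz (Dz U₀) (Dz (Dz U₀)))
    (hM : ‖Dz U₀‖ + α * ‖Dz (Dz U₀)‖ ≤ M) :
    ∀ᵐ t ∂(volume.restrict (Ioo 0 T)), ‖Dz (Dz (U t))‖ ≤ M / α := by
  have h0 : 0 ≤ ‖Dz U₀‖ := norm_nonneg _
  have h1 : 0 ≤ α * ‖Dz (Dz U₀)‖ := by positivity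
  filter_upwards [h.dz_energy_le hν hε₁ hε₂ hT hz hzz] with t ht
  rw [le_div_iff₀ hα]
  refine le_of_sq_le_sq ?_ (by linarith)
  have h2 : (‖Dz U₀‖ + α * ‖Dz (Dz U₀)‖) ^ 2 ≤ M ^ 2 := pow_le_pow_left₀ (by linarith) hM 2
  have h3 := mul_nonneg h0 h1
  have h4 := sq_nonneg ‖Dz (U t)‖
  rw [add_sq, mul_pow] at h2
  rw [mul_pow]
  linarith

/-- The bound for the difference, with a constant that depends on the strong solution only. -/
theorem IsStrongSolution.stability {ν ε₁ ε₂ T : ℝ} {u₀ : L2} {u : ℝ → L2}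
    (hu : IsStrongSolution ν ε₁ ε₂ T u₀ u) (hν : 0 < ν) (hε₁ : 0 < ε₁) (hε₂ : 0 < ε₂)
    (hT : 0 < T) :
    ∃ K J : ℝ, ∀ α ∈ Ioc (0 : ℝ) 1, ∀ (M : ℝ) (U₀ : L2) (U : ℝ → L2),
      IsVoigtStrongSolution ν ε₁ ε₂ α T U₀ U → IsDz U₀ (Dz U₀) → IsDz (Dz U₀) (Dz (Dz U₀)) →
      ‖Dz U₀‖ + α * ‖Dz (Dz U₀)‖ ≤ M →
      (∀ᵐ t ∂(volume.restrict (Ioo 0 T)),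
        ‖U t - u t‖ ^ 2 ≤ K * (‖U₀ - u₀‖ ^ 2 / 2 + α * (M ^ 2 / 2 + M * J))) ∧
      ∫ t in Ioo 0 T, ‖Dz (U t) - Dz (u t)‖ ^ 2 ≤
        K * (‖U₀ - u₀‖ ^ 2 / 2 + α * (M ^ 2 / 2 + M * J)) := by
  obtain ⟨c, hc0, hc⟩ := hu.exists_bound
  obtain ⟨ut, hut, hdt, heq⟩ := hu.equation
  -- Chosen so that 3c², the anisotropic constant of u_z when ‖u_z‖ and ‖u_xz‖ are at most c, equals
  -- 4ε₂b.
  set b : ℝ := 3 * c ^ 2 / (4 * ε₂) with hb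
  have hb0 : 0 ≤ b := by positivity
  set φ : ℝ → ℝ := fun t => growth ν b (u t) with hφ
  have hφ0 : ∀ t, 0 ≤ φ t := fun t => growth_nonneg hν hb0 _
  have iφ : IntervalIntegrable φ volume 0 T :=
    intervalIntegrable_of_Ioo hT (integrable_growth hu.memL2H2.2.1.1 hu.memL2H2.2.1.2.1.2)
  have iut : IntervalIntegrable (fun t => ‖ut t‖) volume 0 T :=
    intervalIntegrable_of_Ioo hT (MemLp.integrable (by norm_num) hut).norm
  set I : ℝ := ∫ t in (0 : ℝ)..T, 2 * φ t with hI
  have hI0 : 0 ≤ I := intervalIntegral.integral_nonneg hT.le fun t _ => by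
    have := hφ0 t; positivity
  set X : ℝ := Real.exp I with hX
  set Jt : ℝ := ∫ t in (0 : ℝ)..T, ‖ut t‖ with hJt
  have hJt0 : 0 ≤ Jt := intervalIntegral.integral_nonneg hT.le fun t _ => norm_nonneg _
  -- K combines the Grönwall factor for ‖v‖² with the factor obtained by reinserting that bound in
  -- the dissipation. J collects what multiplies αM: the corrector ⟨U_zz,u⟩ at time 0 (‖u₀‖) and at
  -- time t (c), and the time integral of ‖u_t‖.
  refine ⟨max (2 * X) (2 / ν * (1 + X * I)), ‖u₀‖ + c + Jt, fun α hα M U₀ U hU hz hzz hM => ?_⟩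
  have hM0 : 0 ≤ M := le_trans (by have := hα.1; positivity) hM
  set δ : ℝ := ‖U₀ - u₀‖ ^ 2 / 2 + α * (M ^ 2 / 2 + M * (‖u₀‖ + c + Jt)) with hδ
  have hδ0 : 0 ≤ δ := by have := hα.1; positivity
  have hA := hU.norm_dzz_le hν hε₁ hε₂ hT hα.1 hz hzz hM
  obtain ⟨iG, hE⟩ := hU.energy_identity hu hν hε₁ hε₂ hT hz hzz hut hdt (fun _ => rfl)
  have cv : ContinuousOn (fun t => ‖U t - u t‖ ^ 2) (Icc 0 T) :=
    (hU.continuousOn.sub hu.continuousOn).norm.pow 2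
  have cv' : ContinuousOn (fun t => ‖U t - u t‖ ^ 2) (uIcc 0 T) := by rwa [uIcc_of_le hT.le]
  have mvz : LpL2 T 2 fun t => Dz (U t) - Dz (u t) :=
    (MemLp.sub hU.memLinftyH1.2.2.2 hu.memLinftyH1.2.2.2).mono_exponent le_top
  have ivz : IntervalIntegrable (fun t => ‖Dz (U t) - Dz (u t)‖ ^ 2) volume 0 T :=
    intervalIntegrable_of_Ioo hT mvz.integrable_norm_sq
  have iφv : IntervalIntegrable (fun t => φ t * ‖U t - u t‖ ^ 2) volume 0 T :=
    iφ.mul_continuousOn cv'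
  -- the energy inequality
  have hae : ∀ᵐ t ∂(volume.restrict (Ioo 0 T)),
      ‖U t - u t‖ ^ 2 / 2 + ν / 2 * ∫ s in (0 : ℝ)..t, ‖Dz (U s) - Dz (u s)‖ ^ 2 ≤
        δ + ∫ s in (0 : ℝ)..t, φ s * ‖U s - u s‖ ^ 2 := by
    filter_upwards [hE, hA, hc, ae_restrict_mem measurableSet_Ioo] with t ht hAt hct htm
    have htI := Ioo_subset_Icc_self htm
    have hmono := integral_mono_time htI iG (((ivz.const_mul (-(ν / 2))).add iφv).add
      (iut.const_mul (α * M))) (by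
        filter_upwards [hU.reg, hu.reg, heq, hA, hc] with s hs hs' he hAs hcs
        obtain ⟨q, hq1, hq2⟩ := IsStrongSolution.exists_pressure hs'.1 hs'.2 he
        have hbs : aniso (Dz (u s)) (Dx (Dz (u s))) ≤ 4 * ε₂ * b := by
          refine (aniso_le hcs.2.2.1 hcs.2.2.2).trans (le_of_eq ?_)
          rw [hb]; field_simp
        refine (Reg.energy_le hν hε₁ hε₂ hs hs'.1 hs'.2 hq2 hq1 hbs hAs α).trans (le_of_eq ?_)
        have hα0 := hα.1.ne'
        have : α ^ 2 * (M / α) = α * M := by field_simp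
        rw [this, neg_mul])
    rw [intervalIntegral.integral_add
      ((IntervalIntegrable.mono_time (ivz.const_mul (-(ν / 2))) htI).add
        (IntervalIntegrable.mono_time iφv htI))
      (IntervalIntegrable.mono_time (iut.const_mul (α * M)) htI),
      intervalIntegral.integral_add (IntervalIntegrable.mono_time (ivz.const_mul (-(ν / 2))) htI)
        (IntervalIntegrable.mono_time iφv htI),
      intervalIntegral.integral_const_mul, intervalIntegral.integral_const_mul] at hmono
    have hJ : ∫ s in (0 : ℝ)..t, ‖ut s‖ ≤ Jt :=
      intervalIntegral.integral_mono_interval le_rfl htI.1 htI.2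
        (Eventually.of_forall fun _ => norm_nonneg _) iut
    have hα0 := hα.1
    have q1 : α * M * ∫ s in (0 : ℝ)..t, ‖ut s‖ ≤ α * M * Jt :=
      mul_le_mul_of_nonneg_left hJ (by positivity)
    -- The corrector has no sign, so the modulated energy controls ‖v‖²/2 only up to this error of
    -- order α.
    have q2 : -(α * M * c) ≤ α ^ 2 * inner ℝ (Dz (Dz (U t))) (u t) := by
      have r1 := neg_le_of_abs_le (abs_real_inner_le_norm (Dz (Dz (U t))) (u t))
      have r2 : ‖Dz (Dz (U t))‖ * ‖u t‖ ≤ M / α * c :=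
        mul_le_mul hAt hct.1 (norm_nonneg _) (by positivity)
      have r3 : α ^ 2 * (M / α * c) = α * M * c := by field_simp
      have r4 : α ^ 2 * -(M / α * c) ≤ α ^ 2 * inner ℝ (Dz (Dz (U t))) (u t) :=
        mul_le_mul_of_nonneg_left (by linarith) (sq_nonneg α)
      linarith
    have q3 : 0 ≤ α ^ 2 * (‖Dz (U t)‖ ^ 2 / 2) := by positivity
    have q4 : α ^ 2 * inner ℝ (Dz (Dz U₀)) u₀ ≤ α * M * ‖u₀‖ := by
      have r1 := real_inner_le_norm (Dz (Dz U₀)) u₀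
      have r2 : α * ‖Dz (Dz U₀)‖ ≤ M := by linarith [norm_nonneg (Dz U₀)]
      calc α ^ 2 * inner ℝ (Dz (Dz U₀)) u₀ ≤ α ^ 2 * (‖Dz (Dz U₀)‖ * ‖u₀‖) :=
            mul_le_mul_of_nonneg_left r1 (sq_nonneg α)
        _ = α * (α * ‖Dz (Dz U₀)‖) * ‖u₀‖ := by ring
        _ ≤ α * M * ‖u₀‖ := by gcongr
    have q5 : α ^ 2 * (‖Dz U₀‖ ^ 2 / 2) ≤ α * (M ^ 2 / 2) := by
      have r1 : ‖Dz U₀‖ ≤ M := by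
        have : 0 ≤ α * ‖Dz (Dz U₀)‖ := by positivity
        linarith
      have r2 : α ^ 2 ≤ α := by nlinarith [hα.2]
      gcongr
    rw [hδ]
    linarith
  -- The identity for the modulated energy needs U_zz at time t and so holds for almost every t;
  -- what is left after dropping the corrector is continuous in t.
  have hall : ∀ t ∈ Icc 0 T,
      ‖U t - u t‖ ^ 2 / 2 + ν / 2 * ∫ s in (0 : ℝ)..t, ‖Dz (U s) - Dz (u s)‖ ^ 2 ≤
        δ + ∫ s in (0 : ℝ)..t, φ s * ‖U s - u s‖ ^ 2 := fun t ht =>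
    le_of_ae_le hT ((cv.div_const 2).add (continuousOn_const.mul (continuousOn_primitive hT ivz)))
      ((continuousOn_primitive hT iφv).const_add δ) hae ht
  have hvz0 : ∀ t ∈ Icc 0 T, 0 ≤ ∫ s in (0 : ℝ)..t, ‖Dz (U s) - Dz (u s)‖ ^ 2 := fun t ht =>
    intervalIntegral.integral_nonneg ht.1 fun s _ => by positivity
  have hgr : ∀ t ∈ Icc 0 T, ‖U t - u t‖ ^ 2 ≤ 2 * δ * X := by
    intro t ht
    have h1 := gronwall hT (by positivity : 0 ≤ 2 * δ) cv (iφ.const_mul 2)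
      (fun t => by have := hφ0 t; positivity) (fun t ht => by
        have h2 := hall t ht
        have h3 := hvz0 t ht
        have h4 : 0 ≤ ν / 2 * ∫ s in (0 : ℝ)..t, ‖Dz (U s) - Dz (u s)‖ ^ 2 := by positivity
        simp only [mul_assoc]
        rw [intervalIntegral.integral_const_mul]
        linarith) ht
    refine h1.trans (mul_le_mul_of_nonneg_left (Real.exp_le_exp.2 ?_) (by positivity))
    exact intervalIntegral.integral_mono_interval le_rfl ht.1 ht.2
      (Eventually.of_forall fun s => by have := hφ0 s; positivity) (iφ.const_mul 2)
  constructor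
  · filter_upwards [ae_restrict_mem measurableSet_Ioo] with t ht
    refine (hgr t (Ioo_subset_Icc_self ht)).trans ?_
    rw [mul_right_comm]
    exact mul_le_mul_of_nonneg_right (le_max_left _ _) hδ0
  · have h1 := hall T (right_mem_Icc.2 hT.le)
    -- I integrates 2φ, so the factor 2 in the Grönwall bound 2δX is already contained in I.
    have h2 : ∫ s in (0 : ℝ)..T, φ s * ‖U s - u s‖ ^ 2 ≤ δ * X * I := by
      rw [hI, ← intervalIntegral.integral_const_mul]
      refine intervalIntegral.integral_mono_on hT.le iφv ((iφ.const_mul 2).const_mul _)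
        fun s hs => ?_
      refine (mul_le_mul_of_nonneg_left (hgr s hs) (hφ0 s)).trans (le_of_eq (by ring))
    rw [setIntegral_Ioo_eq hT (fun t => ‖Dz (U t) - Dz (u t)‖ ^ 2)]
    have h3 : 0 ≤ ‖U T - u T‖ ^ 2 / 2 := by positivity
    have h4 : ∫ s in (0 : ℝ)..T, ‖Dz (U s) - Dz (u s)‖ ^ 2 ≤ 2 / ν * (1 + X * I) * δ := by
      rw [show 2 / ν * (1 + X * I) * δ = (δ + δ * X * I) / (ν / 2) by field_simp,
        le_div_iff₀ (by positivity)]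
      linarith
    exact h4.trans (mul_le_mul_of_nonneg_right (le_max_right _ _) hδ0)

theorem eLpNorm_top_le {T A : ℝ} {v : ℝ → L2}
    (h : ∀ᵐ t ∂(volume.restrict (Ioo 0 T)), ‖v t‖ ^ 2 ≤ A) :
    eLpNorm v ⊤ (volume.restrict (Ioo 0 T)) ≤ ENNReal.ofReal (√A) := by
  rw [eLpNorm_exponent_top]
  refine eLpNormEssSup_le_of_ae_bound ?_
  filter_upwards [h] with t ht
  exact Real.le_sqrt_of_sq_le ht

theorem eLpNorm_two_le {T A : ℝ} {v : ℝ → L2} (hv : LpL2 T 2 v)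
    (h : ∫ t in Ioo 0 T, ‖v t‖ ^ 2 ≤ A) :
    eLpNorm v 2 (volume.restrict (Ioo 0 T)) ≤ ENNReal.ofReal (√A) := by
  rw [MemLp.eLpNorm_eq_integral_rpow_norm (by norm_num) (by norm_num) hv]
  refine ENNReal.ofReal_le_ofReal ?_
  rw [Real.sqrt_eq_rpow]
  simp only [ENNReal.toReal_ofNat, Real.rpow_ofNat, one_div]
  exact Real.rpow_le_rpow (integral_nonneg fun t => by positivity) h (by norm_num)

end HNS

end

/-! ### The convergence theorem -/

theorem theorem13
    (ν ε₁ ε₂ : ℝ) (hν : 0 < ν) (hε₁ : 0 < ε₁) (hε₂ : 0 < ε₂)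
    -- initial data
    (u₀ : HNS.L2) (u₀α : ℝ → HNS.L2)
    (hu₀ : HNS.MemH1 u₀) (hu₀_even : HNS.EvenZ u₀) (hu₀_mean : HNS.ZeroMeanDx u₀)
    (hu₀_xz : HNS.DzInL2 (HNS.Dx u₀))
    (hu₀α : ∀ α ∈ Set.Ioc (0 : ℝ) 1, HNS.MemH1 (u₀α α))
    (hu₀α_even : ∀ α ∈ Set.Ioc (0 : ℝ) 1, HNS.EvenZ (u₀α α))
    (hu₀α_mean : ∀ α ∈ Set.Ioc (0 : ℝ) 1, HNS.ZeroMeanDx (u₀α α))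
    (hu₀α_z : ∀ α ∈ Set.Ioc (0 : ℝ) 1, HNS.MemH1 (HNS.Dz (u₀α α)))
    -- uniform bound
    (M : ℝ)
    (hM : ∀ α ∈ Set.Ioc (0 : ℝ) 1,
      ‖u₀α α‖ + ‖HNS.Dz (u₀α α)‖ + α * ‖HNS.Dz (HNS.Dz (u₀α α))‖ ≤ M)
    -- solutions
    (T : ℝ) (hT : 0 < T) (u : ℝ → HNS.L2) (uα : ℝ → ℝ → HNS.L2)
    (hu : HNS.IsStrongSolution ν ε₁ ε₂ T u₀ u)
    (huα : ∀ α ∈ Set.Ioc (0 : ℝ) 1, HNS.IsVoigtStrongSolution ν ε₁ ε₂ α T (u₀α α) (uα α))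
    -- convergence of the initial data in `L²`
    (hconv : Filter.Tendsto u₀α (nhdsWithin 0 (Set.Ioi 0)) (nhds u₀)) :
    Filter.Tendsto
        (fun α => MeasureTheory.eLpNorm (fun t => uα α t - u t) ⊤
          (MeasureTheory.volume.restrict (Set.Ioo 0 T)))
        (nhdsWithin 0 (Set.Ioi 0)) (nhds 0) ∧
      Filter.Tendsto
        (fun α => MeasureTheory.eLpNorm (fun t => HNS.Dz (uα α t) - HNS.Dz (u t)) 2
          (MeasureTheory.volume.restrict (Set.Ioo 0 T)))
        (nhdsWithin 0 (Set.Ioi 0)) (nhds 0) := by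
  obtain ⟨K, J, hKJ⟩ := hu.stability hν hε₁ hε₂ hT
  have hest := fun α (hα : α ∈ Set.Ioc (0 : ℝ) 1) => hKJ α hα M (u₀α α) (uα α) (huα α hα)
    (hu₀α α hα).2.isDz (hu₀α_z α hα).2.isDz
    (by linarith [hM α hα, norm_nonneg (u₀α α)])
  have hmem : ∀ᶠ α in nhdsWithin (0 : ℝ) (Set.Ioi 0), α ∈ Set.Ioc (0 : ℝ) 1 :=
    Ioc_mem_nhdsGT one_pos
  have hid : Filter.Tendsto (fun α : ℝ => α) (nhdsWithin 0 (Set.Ioi 0)) (nhds 0) :=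
    Filter.tendsto_id.mono_left nhdsWithin_le_nhds
  -- K, J and M do not depend on α, so the bound tends to 0 with α and the error in the initial
  -- data; its square root controls both norms.
  have hlim : Filter.Tendsto (fun α => ENNReal.ofReal
      (√(K * (‖u₀α α - u₀‖ ^ 2 / 2 + α * (M ^ 2 / 2 + M * J)))))
      (nhdsWithin 0 (Set.Ioi 0)) (nhds 0) := by
    have h1 := ((((hconv.sub_const u₀).norm.pow 2).div_const 2).add
      (hid.mul_const (M ^ 2 / 2 + M * J))).const_mul K
    simpa using ENNReal.tendsto_ofReal h1.sqrt
  refine ⟨tendsto_of_tendsto_of_tendsto_of_le_of_le' tendsto_const_nhds hlim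
    (Filter.Eventually.of_forall fun _ => zero_le) ?_,
    tendsto_of_tendsto_of_tendsto_of_le_of_le' tendsto_const_nhds hlim
    (Filter.Eventually.of_forall fun _ => zero_le) ?_⟩
  · filter_upwards [hmem] with α hα
    exact HNS.eLpNorm_top_le (hest α hα).1
  · filter_upwards [hmem] with α hα
    exact HNS.eLpNorm_two_le ((MeasureTheory.MemLp.sub (huα α hα).memLinftyH1.2.2.2
      hu.memLinftyH1.2.2.2).mono_exponent le_top) (hest α hα).2
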